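/- Let $M$ be a compact 3-manifold, possibly with boundary (for instance oriented with toroidal boundary), and fix a transverse orientation of $\partial M$, i.e. for each component of $\partial M$ one of the two normal directions, outward or inward. Let $\mathcal B\subset M$ be a cooriented branched surface, transverse to $\partial M$: a compact 2-complex with a well-defined tangent plane everywhere, locally modelled at interior points of $M$ on a plane, on three half-planes meeting along a line (two of them tangent to each other on one side, one on the other side), or on a triple point, where two such branch lines cross transversely and exactly six local sheets meet; and near $\partial M$ on the product of an interval with an arc or with the switch of a trivalent train track. We work in the PL category: $M$ is a finite simplicial complex in which the link of every simplex is a PL sphere or ball, and $\mathcal B$ is a subcomplex. The branching locus is the set of non-manifold points of $\mathcal B$; a sector is the metric closure of a component of $\mathcal B$ minus the branching locus; a complementary region is a component of $M$ cut open along $\mathcal B$. The maw vector field along the branching locus is tangent to $\mathcal B$ and points towards the one-sheeted side; along $\partial\mathcal B=\mathcal B\cap\partial M$ it points in the chosen normal direction of $\partial M$. A double corner of a sector $s$ is a corner of $\partial s$ at which the maw vector field points into $s$ along one of the two adjacent edges of $\partial s$ and out of $s$ along the other one. With $\mathrm{dc}(s)$ the number of double corners, the maw Euler characteristic is $$\chi_m(s)=\chi(s)-\tfrac12\,\mathrm{dc}(s).$$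 The maw dual graph $\Gamma(\mathcal B)$ is the oriented weighted graph with one vertex for each complementary region and, for each sector $s$, one edge of weight $\chi_m(s)$ crossing $s$ once in the direction of the coorientation, from the region behind $s$ to the region in front of $s$. Assume that the exterior of $\mathcal B$ is a union of sutured product balls $(D^2\times[0,1],\partial D^2\times[0,1])$, i.e. each complementary region $C$ is a 3-ball, and the parts $R_+(C)$ and $R_-(C)$ of its horizontal boundary, made of the sheets whose coorientation points out of $C$ and into $C$ respectively, are disks. Then $\Gamma(\mathcal B)$ is a 1-cycle: all weights $\chi_m(s)$ are integers, the boundary of the 1-chain $\sum_s\chi_m(s)\,a(s)$, where $a(s)$ is the edge crossing $s$, is zero, and at each vertex the total weight of the incoming edges is equal to the total weight of the outgoing edges. Moreover, for each complementary region $C$ such that every component of $\partial M$ meeting $C$ is oriented outward (in particular for every $C$ if $M$ is closed), both total weights at $C$ are equal to $\chi(D^2)=1$. -/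

import Mathlib

/-!
Branched surfaces are treated in the piecewise linear category: a compact 3-manifold is a finite
simplicial complex with the usual condition on links, a branched surface is a 2-dimensional
subcomplex whose vertex links are the links of the standard local models, and the surfaces and
3-manifolds obtained by cutting (sectors, complementary regions, horizontal boundary) are finite
complexes obtained by gluing simplices along faces.
-/

noncomputable section

namespace MawGraph

/-! ### PL balls and spheres (stellar equivalence) -/

/-- The full simplex with vertices `0, …, n`. -/
def fullSimplex (n : ℕ) : PreAbstractSimplicialComplex ℕ where
  faces := {s | s.Nonempty ∧ s ⊆ Finset.range (n + 1)}
  isRelLowerSet_faces := fun {_} h => ⟨h.1, fun _ hts ht => ⟨ht, hts.trans h.2⟩⟩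

/-- The boundary of the simplex with vertices `0, …, n + 1`, an `n`-sphere. -/
def simplexBoundary (n : ℕ) : PreAbstractSimplicialComplex ℕ where
  faces := {s | s.Nonempty ∧ s ⊂ Finset.range (n + 2)}
  isRelLowerSet_faces := fun {_} h => ⟨h.1, fun _ hts ht => ⟨ht, lt_of_le_of_lt hts h.2⟩⟩

/-- The stellar subdivision of `K` at the simplex `σ` with new vertex `a`: the open star of `σ`
is replaced by the cone with apex `a` over (boundary of `σ`) join (link of `σ`). -/
def stellarSubdivision (K : PreAbstractSimplicialComplex ℕ) (σ : Finset ℕ) (a : ℕ) :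
    PreAbstractSimplicialComplex ℕ where
  faces := {s | (s ∈ K.faces ∧ ¬ σ ⊆ s) ∨
    (a ∈ s ∧ s.erase a ∪ σ ∈ K.faces ∧ ¬ σ ⊆ s.erase a)}
  isRelLowerSet_faces := by
    intro s hs
    have hK : ∀ {x y : Finset ℕ}, x ∈ K.faces → y ⊆ x → y.Nonempty → y ∈ K.faces :=
      fun hx hyx hy => (K.isRelLowerSet_faces hx).2 hyx hy
    refine ⟨?_, ?_⟩
    · rcases hs with h | h
      · exact (K.isRelLowerSet_faces h.1).1
      · exact ⟨a, h.1⟩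
    · intro t hts ht
      have hta : t.erase a ⊆ s.erase a := Finset.erase_subset_erase a hts
      rcases hs with h | h
      · exact Or.inl ⟨hK h.1 hts ht, fun h' => h.2 (h'.trans hts)⟩
      · have hn : ¬ σ ⊆ t.erase a := fun h' => h.2.2 (h'.trans hta)
        by_cases hat : a ∈ t
        · refine Or.inr ⟨hat, hK h.2.1 (Finset.union_subset_union_left hta) ?_, hn⟩
          by_contra hne
          rw [Finset.not_nonempty_iff_eq_empty, Finset.union_eq_empty] at hne
          exact hn (by rw [hne.2]; exact Finset.empty_subset _)
        · rw [Finset.erase_eq_of_notMem hat] at hn hta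
          exact Or.inl ⟨hK h.2.1 (hta.trans Finset.subset_union_left) ht, hn⟩

/-- `L` is a stellar subdivision of `K` at one of its simplices, with a new vertex. -/
def StellarStep (K L : PreAbstractSimplicialComplex ℕ) : Prop :=
  ∃ σ ∈ K.faces, ∃ a : ℕ, {a} ∉ K.faces ∧ L = stellarSubdivision K σ a

/-- Stellar equivalence, i.e. PL homeomorphism, of finite complexes. -/
def StellarEquiv : PreAbstractSimplicialComplex ℕ → PreAbstractSimplicialComplex ℕ → Prop :=
  Relation.EqvGen StellarStep

/-- `K` is a PL `n`-ball. -/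
def IsPLBall {α : Type*} (n : ℕ) (K : PreAbstractSimplicialComplex α) : Prop :=
  ∃ f : α → ℕ, Function.Injective f ∧ StellarEquiv (K.map f) (fullSimplex n)

/-- `K` is a PL `n`-sphere. -/
def IsPLSphere {α : Type*} (n : ℕ) (K : PreAbstractSimplicialComplex α) : Prop :=
  ∃ f : α → ℕ, Function.Injective f ∧ StellarEquiv (K.map f) (simplexBoundary n)

/-! ### Graphs up to subdivision -/

/-- An identification of the graph `G` (without its isolated vertices) with a subdivision of the
multigraph with `n` nodes and `m` arcs, the arc `j` joining the two nodes `ends j`. -/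
structure Subdivides {V : Type*} (G : SimpleGraph V) {n m : ℕ}
    (ends : Fin m → Fin n × Fin n) where
  node : Fin n → V
  node_injective : Function.Injective node
  arc : ∀ j : Fin m, G.Walk (node (ends j).1) (node (ends j).2)
  arc_isPath : ∀ j, (arc j).IsPath
  edge_mem : ∀ e ∈ G.edgeSet, ∃! j, e ∈ (arc j).edges
  node_mem : ∀ i j, node i ∈ (arc j).support → i = (ends j).1 ∨ i = (ends j).2
  arc_disjoint : ∀ j k, j ≠ k → ∀ x ∈ (arc j).support, x ∈ (arc k).support →
    x ∈ Set.range node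

/-- A circle (as a triangle). -/
def circleModel : Fin 3 → Fin 3 × Fin 3 := ![(0, 1), (1, 2), (2, 0)]

/-- An arc. -/
def arcModel : Fin 1 → Fin 2 × Fin 2 := ![(0, 1)]

/-- The theta graph: three arcs joining two nodes. -/
def thetaModel : Fin 3 → Fin 2 × Fin 2 := ![(0, 1), (0, 1), (0, 1)]

/-- The tripod: three arcs from the centre `0` to the ends `1, 2, 3`. -/
def tripodModel : Fin 3 → Fin 4 × Fin 4 := ![(0, 1), (0, 2), (0, 3)]

/-- The link of a triple point, a complete graph on four nodes. In the plane `z = 0` with a sheet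
leaving upwards over `x ≥ 0` along the line `x = 0`, and a sheet leaving downwards over `y ≥ 0`
along the line `y = 0`, the nodes `0, 1, 2, 3` are the directions north, east, south, west; the
arcs `0, 1, 2, 3` are the quadrants of the plane between `0, 3`, between `3, 2`, between `2, 1` and
between `1, 0`; the arc `4` is the upper sheet and the arc `5` is the lower sheet. -/
def tripleModel : Fin 6 → Fin 4 × Fin 4 := ![(0, 3), (3, 2), (2, 1), (1, 0), (0, 2), (1, 3)]

/-! ### Triangulated 3-manifolds -/

/-- The link of the vertex `v`. -/
def vertexLink {V : Type*} [DecidableEq V] (K : PreAbstractSimplicialComplex V) (v : V) :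
    PreAbstractSimplicialComplex V where
  faces := {s | s.Nonempty ∧ v ∉ s ∧ insert v s ∈ K.faces}
  isRelLowerSet_faces := fun {_} h => ⟨h.1, fun _ hts ht => ⟨ht, fun hv => h.2.1 (hts hv),
    (K.isRelLowerSet_faces h.2.2).2 (Finset.insert_subset_insert v hts)
      (Finset.insert_nonempty _ _)⟩⟩

/-- The link of the edge `e` in a 3-dimensional complex, as a graph. -/
def edgeLink {V : Type*} [DecidableEq V] (K : PreAbstractSimplicialComplex V) (e : Finset V) :
    SimpleGraph V where
  Adj u w := u ≠ w ∧ u ∉ e ∧ w ∉ e ∧ insert u (insert w e) ∈ K.faces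
  symm := ⟨fun u w h => ⟨h.1.symm, h.2.2.1, h.2.1, by rw [Finset.insert_comm]; exact h.2.2.2⟩⟩
  loopless := ⟨fun _ h => h.1 rfl⟩

/-- A triangulated 3-manifold, possibly with boundary: a pure 3-dimensional complex in which the
link of every simplex is a sphere or a ball. It is compact when `V` is finite. -/
structure ThreeManifold (V : Type*) [DecidableEq V] where
  complex : PreAbstractSimplicialComplex V
  pure : ∀ σ ∈ complex.faces, ∃ τ ∈ complex.faces, τ.card = 4 ∧ σ ⊆ τ
  card_le : ∀ σ ∈ complex.faces, σ.card ≤ 4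
  triangle_link : ∀ f ∈ complex.faces, f.card = 3 →
    {τ | τ ∈ complex.faces ∧ τ.card = 4 ∧ f ⊆ τ}.ncard = 1 ∨
    {τ | τ ∈ complex.faces ∧ τ.card = 4 ∧ f ⊆ τ}.ncard = 2
  edge_link : ∀ e ∈ complex.faces, e.card = 2 →
    Nonempty (Subdivides (edgeLink complex e) circleModel) ∨
    Nonempty (Subdivides (edgeLink complex e) arcModel)
  vertex_link : ∀ v, {v} ∈ complex.faces →
    IsPLSphere 2 (vertexLink complex v) ∨ IsPLBall 2 (vertexLink complex v)

namespace ThreeManifold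

variable {V : Type*} [DecidableEq V]

/-- The tetrahedra of `M`. -/
def tets (M : ThreeManifold V) : Set (Finset V) := {τ | τ ∈ M.complex.faces ∧ τ.card = 4}

/-- `σ` lies in the boundary of `M`: it is a face of a triangle that lies in only one
tetrahedron. -/
def IsBdry (M : ThreeManifold V) (σ : Finset V) : Prop :=
  ∃ f ∈ M.complex.faces, f.card = 3 ∧ σ ⊆ f ∧ {τ | τ ∈ M.tets ∧ f ⊆ τ}.ncard = 1

/-- A transverse orientation of the boundary of `M`: each boundary component is normally oriented
either outwards or inwards. -/
structure BdryOrientation (M : ThreeManifold V) where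
  outward : V → Prop
  locally_constant : ∀ u w, M.IsBdry {u, w} → (outward u ↔ outward w)

end ThreeManifold

/-! ### Complexes glued from simplices -/

/-- A collection of simplices `top`, all of the same dimension, together with the relation `adj`
saying which of them are glued to each other along their common face. -/
structure Gluing (V : Type*) where
  top : Set (Finset V)
  adj : Finset V → Finset V → Prop

namespace Gluing

variable {V : Type*}

/-- The faces `σ` of `t` and of `t'` are identified by the gluing. -/
def SameCell (G : Gluing V) (σ : Finset V) : Finset V → Finset V → Prop :=
  Relation.EqvGen fun t t' => t ∈ G.top ∧ t' ∈ G.top ∧ σ ⊆ t ∧ σ ⊆ t' ∧ G.adj t t'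

/-- A face `σ` of a simplex `t`, as the pair `(σ, t)`. -/
def Flag (G : Gluing V) : Type _ :=
  {p : Finset V × Finset V // p.1.Nonempty ∧ p.1 ⊆ p.2 ∧ p.2 ∈ G.top}

/-- The identification of faces. -/
def flagSetoid (G : Gluing V) : Setoid G.Flag where
  r p q := p.1.1 = q.1.1 ∧ G.SameCell p.1.1 p.1.2 q.1.2
  iseqv :=
    { refl := fun _ => ⟨rfl, Relation.EqvGen.refl _⟩
      symm := fun h => ⟨h.1.symm, h.1 ▸ Relation.EqvGen.symm _ _ h.2⟩
      trans := fun h h' => ⟨h.1.trans h'.1, Relation.EqvGen.trans _ _ _ h.2 (h.1 ▸ h'.2)⟩ }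

/-- The cells of the glued complex. -/
def Cell (G : Gluing V) : Type _ := Quotient G.flagSetoid

/-- The cell given by a flag. -/
def Flag.cell {G : Gluing V} (p : G.Flag) : G.Cell := Quotient.mk G.flagSetoid p

/-- The simplex over which a cell lies. -/
def Cell.simplex {G : Gluing V} (x : G.Cell) : Finset V :=
  Quotient.lift (s := G.flagSetoid) (fun p => p.1.1) (fun _ _ h => h.1) x

/-- `x` is a face of `y`. -/
def Cell.IsFace {G : Gluing V} (x y : G.Cell) : Prop :=
  ∃ p q : G.Flag, p.cell = x ∧ q.cell = y ∧ p.1.2 = q.1.2 ∧ p.1.1 ⊆ q.1.1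

/-- The barycentric subdivision of the glued complex: its simplices are the flags of cells. -/
def barycentric (G : Gluing V) : PreAbstractSimplicialComplex G.Cell where
  faces := {s | s.Nonempty ∧ ∀ x ∈ s, ∀ y ∈ s, x.IsFace y ∨ y.IsFace x}
  isRelLowerSet_faces := fun {_} h =>
    ⟨h.1, fun _ hts ht => ⟨ht, fun x hx y hy => h.2 x (hts hx) y (hts hy)⟩⟩

instance [Finite V] (G : Gluing V) : Finite G.Flag := by
  have : Finite (Finset V) := by
    have := Fintype.ofFinite V
    infer_instance
  unfold Flag
  infer_instance

instance [Finite V] (G : Gluing V) : Finite G.Cell := by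
  unfold Cell
  infer_instance

instance [Finite V] (G : Gluing V) : Fintype G.Cell := Fintype.ofFinite _

/-- The Euler characteristic: the number of cells, with the sign `(-1) ^ dim`. -/
def eulerChar [Finite V] (G : Gluing V) : ℤ :=
  ∑ x : G.Cell, (-1) ^ (x.simplex.card + 1)

/-- The connected pieces: top-dimensional simplices up to passing through glued faces. -/
def Piece (G : Gluing V) : Type _ := Quot fun t t' : G.top => G.adj t.1 t'.1

/-- The piece of a top-dimensional simplex. -/
def piece (G : Gluing V) (t : Finset V) (ht : t ∈ G.top) : G.Piece := Quot.mk _ ⟨t, ht⟩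

/-- `t` belongs to the piece `c`. -/
def InPiece (G : Gluing V) (c : G.Piece) (t : Finset V) : Prop :=
  ∃ ht : t ∈ G.top, G.piece t ht = c

/-- A piece as a glued complex. -/
def sub (G : Gluing V) (c : G.Piece) : Gluing V := ⟨{t | G.InPiece c t}, G.adj⟩

instance [Finite V] (G : Gluing V) : Finite G.Piece := by
  have : Finite (Finset V) := by
    have := Fintype.ofFinite V
    infer_instance
  unfold Piece
  infer_instance

instance [Finite V] (G : Gluing V) : Fintype G.Piece := Fintype.ofFinite _

end Gluing

/-! ### Branched surfaces -/

section LinkGraph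

variable {V : Type*} [DecidableEq V]

/-- The link of `v` in the 2-complex with set of triangles `T`, as a graph. -/
def linkGraph (T : Set (Finset V)) (v : V) : SimpleGraph V where
  Adj u w := u ≠ w ∧ u ≠ v ∧ w ≠ v ∧ {v, u, w} ∈ T
  symm := ⟨fun u w h => ⟨h.1.symm, h.2.2.1, h.2.1, by
    rw [Finset.pair_comm w u]; exact h.2.2.2⟩⟩
  loopless := ⟨fun _ h => h.1 rfl⟩

/-- A branch edge: three sheets meet along it. -/
def IsBranchEdge (T : Set (Finset V)) (e : Finset V) : Prop :=
  e.card = 2 ∧ {t | t ∈ T ∧ e ⊆ t}.ncard = 3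

/-- `M` cut open along the 2-complex with set of triangles `T`. -/
def cutAlong (M : ThreeManifold V) (T : Set (Finset V)) : Gluing V where
  top := M.tets
  adj τ τ' := (τ ∩ τ').card = 3 ∧ τ ∩ τ' ∉ T

/-- In the link of `v` in `M`, the complement of the link of `v` in the 2-complex contains `F`
different regions, and the regions on the two sides of the arc `k` of the graph are the regions `i`
with `borders k i`. -/
def HasLocalRegions (M : ThreeManifold V) (T : Set (Finset V)) (v : V) {n m : ℕ}
    {ends : Fin m → Fin n × Fin n} (S : Subdivides (linkGraph T v) ends) (F : ℕ)
    (borders : Fin m → Fin F → Prop) : Prop :=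
  ∃ r : Fin F → Finset V, (∀ i, r i ∈ M.tets ∧ v ∈ r i) ∧
    (∀ i j, i ≠ j → ¬ (cutAlong M T).SameCell {v} (r i) (r j)) ∧
    ∀ k x y, s(x, y) ∈ (S.arc k).edges → ∀ i, borders k i →
      ∃ τ ∈ M.tets, {v, x, y} ⊆ τ ∧ (cutAlong M T).SameCell {v} τ (r i)

/-- A manifold point in the interior of `M`. -/
def IsSmoothVertex (T : Set (Finset V)) (v : V) : Prop :=
  Nonempty (Subdivides (linkGraph T v) circleModel)

/-- A point of the branching locus in the interior of `M` which is not a triple point: three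
half-disks meet along a line, any two of them bound one of the three local regions, and the
half-disk to which the maw points is the same on both halves of the line. -/
def IsBranchVertex (M : ThreeManifold V) (T : Set (Finset V)) (maw : Finset V → Finset V)
    (v : V) : Prop :=
  ∃ S : Subdivides (linkGraph T v) thetaModel,
    HasLocalRegions M T v S 3 (fun k i => i ≠ k) ∧
    maw {v, S.node 0} = {v, S.node 0, (S.arc 0).snd} ∧
    maw {v, S.node 1} = {v, S.node 1, (S.arc 0).penultimate}

/-- A triple point. The link divides the sphere into four triangles, the triangle `i` being the one
opposite to the node `i`. In the coordinates described at `tripleModel` the maw points west along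
the line `x = 0` and south along the line `y = 0`. -/
def IsTriplePoint (M : ThreeManifold V) (T : Set (Finset V)) (maw : Finset V → Finset V)
    (v : V) : Prop :=
  ∃ S : Subdivides (linkGraph T v) tripleModel,
    HasLocalRegions M T v S 4 (fun k i => i ≠ (tripleModel k).1 ∧ i ≠ (tripleModel k).2) ∧
    maw {v, S.node 0} = {v, S.node 0, (S.arc 0).snd} ∧
    maw {v, S.node 3} = {v, S.node 3, (S.arc 1).snd} ∧
    maw {v, S.node 2} = {v, S.node 2, (S.arc 1).penultimate} ∧
    maw {v, S.node 1} = {v, S.node 1, (S.arc 2).penultimate}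

end LinkGraph

/-- A branched surface in `M`, as a subcomplex with set of triangles `tri`. For a branch edge `e`,
`maw e` is the triangle on the one-sheeted side of `e`: the maw vector field (the branching
direction) along `e` points into `maw e`, and out of the two other triangles at `e`, which are
tangent to each other. In the boundary of `M`, the surface is a train track: the link of a vertex
is an arc or a tripod, properly embedded in the link of the vertex in `M`. -/
structure BranchedSurface {V : Type*} [DecidableEq V] (M : ThreeManifold V) where
  tri : Set (Finset V)
  tri_mem : ∀ t ∈ tri, t ∈ M.complex.faces ∧ t.card = 3 ∧ ¬ M.IsBdry t
  maw : Finset V → Finset V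
  maw_mem : ∀ e, IsBranchEdge tri e → maw e ∈ tri ∧ e ⊆ maw e
  interior_model : ∀ t ∈ tri, ∀ v ∈ t, ¬ M.IsBdry {v} →
    IsSmoothVertex tri v ∨ IsBranchVertex M tri maw v ∨ IsTriplePoint M tri maw v
  boundary_model : ∀ t ∈ tri, ∀ v ∈ t, M.IsBdry {v} →
    (∃ S : Subdivides (linkGraph tri v) arcModel, ∀ u ∈ (linkGraph tri v).support,
      (M.IsBdry {v, u} ↔ u = S.node 0 ∨ u = S.node 1)) ∨
    (∃ S : Subdivides (linkGraph tri v) tripodModel, ∀ u ∈ (linkGraph tri v).support,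
      (M.IsBdry {v, u} ↔ u = S.node 1 ∨ u = S.node 2 ∨ u = S.node 3))

namespace BranchedSurface

variable {V : Type*} [DecidableEq V] {M : ThreeManifold V}

/-- `B` cut open along its branching locus. -/
def sheets (B : BranchedSurface M) : Gluing V where
  top := B.tri
  adj t t' := (t ∩ t').card = 2 ∧ ¬ IsBranchEdge B.tri (t ∩ t')

/-- The sectors of `B`; the sector `s`, as a compact surface, is `B.sheets.sub s`. -/
abbrev Sector (B : BranchedSurface M) : Type _ := B.sheets.Piece

/-- `M` cut open along `B`. -/
def cut (B : BranchedSurface M) : Gluing V := cutAlong M B.tri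

/-- The complementary regions of `B`; the region `C`, as a compact 3-manifold (with cusps along
the branching locus), is `B.cut.sub C`. -/
abbrev Region (B : BranchedSurface M) : Type _ := B.cut.Piece

/-- The maw vector field points into `t` along its edge `e`, where `e` lies in the branching locus
or in the boundary of `M`. -/
def MawInward (B : BranchedSurface M) (n : M.BdryOrientation) (e t : Finset V) : Prop :=
  (IsBranchEdge B.tri e ∧ B.maw e = t) ∨ (M.IsBdry e ∧ ∀ v ∈ e, ¬ n.outward v)

/-- The maw vector field points out of `t` along its edge `e`, where `e` lies in the branching
locus or in the boundary of `M`. -/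
def MawOutward (B : BranchedSurface M) (n : M.BdryOrientation) (e t : Finset V) : Prop :=
  (IsBranchEdge B.tri e ∧ B.maw e ≠ t) ∨ (M.IsBdry e ∧ ∀ v ∈ e, n.outward v)

/-- The vertex `x` of the sector `s` is a double corner: the maw vector field points inward on one
of the two boundary edges of `s` at `x` and outward on the other one. (This happens only over
triple points and over points of the branching locus in the boundary of `M`.) -/
def IsDoubleCorner (B : BranchedSurface M) (n : M.BdryOrientation) (s : B.Sector)
    (x : (B.sheets.sub s).Cell) : Prop :=
  x.simplex.card = 1 ∧ ∃ p q : (B.sheets.sub s).Flag,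
    p.1.1.card = 2 ∧ q.1.1.card = 2 ∧ x.IsFace p.cell ∧ x.IsFace q.cell ∧
    B.MawInward n p.1.1 p.1.2 ∧ B.MawOutward n q.1.1 q.1.2

/-- The number of double corners of a sector. -/
def doubleCorners (B : BranchedSurface M) (n : M.BdryOrientation) (s : B.Sector) : ℕ :=
  {x | B.IsDoubleCorner n s x}.ncard

/-- The maw Euler characteristic of a sector. -/
def mawEulerChar [Finite V] (B : BranchedSurface M) (n : M.BdryOrientation) (s : B.Sector) : ℚ :=
  (B.sheets.sub s).eulerChar - (1 / 2) * B.doubleCorners n s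

/-- A coorientation: the coorientation of the triangle `t` points from the tetrahedron `back t` to
the tetrahedron `front t`. It is coherent across the edges at which `B` is a surface. At a branch
edge with one-sheeted side `a`, one of the other two sheets, `u`, lies above the other one, `l`:
the region above `a` is the one above `u`, the region below `a` is the one below `l`, and the region
below `u` is the one above `l`. -/
structure Coorientation (B : BranchedSurface M) where
  back : Finset V → Finset V
  front : Finset V → Finset V
  back_mem : ∀ t ∈ B.tri, back t ∈ M.tets ∧ t ⊆ back t
  front_mem : ∀ t ∈ B.tri, front t ∈ M.tets ∧ t ⊆ front t
  back_ne_front : ∀ t ∈ B.tri, back t ≠ front t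
  coherent_smooth : ∀ t ∈ B.tri, ∀ t' ∈ B.tri, B.sheets.adj t t' →
    B.cut.SameCell (t ∩ t') (back t) (back t') ∧ B.cut.SameCell (t ∩ t') (front t) (front t')
  coherent_branch : ∀ e, IsBranchEdge B.tri e → ∃ u l : Finset V,
    {t | t ∈ B.tri ∧ e ⊆ t} = {B.maw e, u, l} ∧
    B.cut.SameCell e (front (B.maw e)) (front u) ∧
    B.cut.SameCell e (back u) (front l) ∧
    B.cut.SameCell e (back l) (back (B.maw e))

theorem piece_eq_of_sameCell (B : BranchedSurface M) {σ τ τ' : Finset V}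
    (h : B.cut.SameCell σ τ τ') (hτ : τ ∈ B.cut.top) (hτ' : τ' ∈ B.cut.top) :
    B.cut.piece τ hτ = B.cut.piece τ' hτ' := by
  have key : (∃ (h1 : τ ∈ B.cut.top) (h2 : τ' ∈ B.cut.top),
      B.cut.piece τ h1 = B.cut.piece τ' h2) ∨ τ = τ' := by
    clear hτ hτ'
    induction h with
    | rel a b hab => exact Or.inl ⟨hab.1, hab.2.1, Quot.sound hab.2.2.2.2⟩
    | refl a => exact Or.inr rfl
    | symm a b _ ih =>
      rcases ih with ⟨h1, h2, h3⟩ | h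
      · exact Or.inl ⟨h2, h1, h3.symm⟩
      · exact Or.inr h.symm
    | trans a b c _ _ ih ih' =>
      rcases ih with ⟨h1, h2, h3⟩ | rfl
      · rcases ih' with ⟨k1, k2, k3⟩ | rfl
        · exact Or.inl ⟨h1, k2, h3.trans k3⟩
        · exact Or.inl ⟨h1, h2, h3⟩
      · exact ih'
  rcases key with ⟨_, _, h3⟩ | rfl
  · exact h3
  · rfl

end BranchedSurface

/-! ### The exterior and the maw dual graph -/

/-- A finite oriented graph with rational weights on its edges. -/
structure WeightedGraph (Vertex Edge : Type*) where
  source : Edge → Vertex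
  target : Edge → Vertex
  weight : Edge → ℚ

namespace WeightedGraph

variable {Vertex Edge : Type*} [Fintype Edge]

open Classical in
/-- The total weight of the edges pointing into `v`. -/
def incoming (Γ : WeightedGraph Vertex Edge) (v : Vertex) : ℚ :=
  ∑ e : Edge with Γ.target e = v, Γ.weight e

open Classical in
/-- The total weight of the edges pointing out of `v`. -/
def outgoing (Γ : WeightedGraph Vertex Edge) (v : Vertex) : ℚ :=
  ∑ e : Edge with Γ.source e = v, Γ.weight e

/-- The boundary of the 1-chain given by the weighted edges. -/
def boundary (Γ : WeightedGraph Vertex Edge) : Vertex →₀ ℚ :=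
  ∑ e : Edge, Γ.weight e •
    (Finsupp.single (Γ.target e) (1 : ℚ) - Finsupp.single (Γ.source e) (1 : ℚ))

/-- The weighted graph is a 1-cycle with integer coefficients. -/
def IsCycle (Γ : WeightedGraph Vertex Edge) : Prop :=
  (∀ e : Edge, ∃ k : ℤ, Γ.weight e = k) ∧ Γ.boundary = 0

end WeightedGraph

namespace BranchedSurface.Coorientation

variable {V : Type*} [DecidableEq V] {M : ThreeManifold V} {B : BranchedSurface M}

/-- The part `R₊` of the horizontal boundary of the region `C`: the sheets of `B` whose
coorientation points out of `C`, glued along an edge when they are adjacent there to the same local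
region of the complement. (The two sheets forming a cusp of `C` lie one in `R₊` and one in `R₋`,
and are not glued to each other: the vertical boundary lies in between.) -/
def plusBoundary (o : B.Coorientation) (C : B.Region) : Gluing V where
  top := {t | t ∈ B.tri ∧ B.cut.InPiece C (o.back t)}
  adj t t' := (t ∩ t').card = 2 ∧ B.cut.SameCell (t ∩ t') (o.back t) (o.back t')

/-- The part `R₋` of the horizontal boundary of the region `C`: the sheets of `B` whose
coorientation points into `C`. -/
def minusBoundary (o : B.Coorientation) (C : B.Region) : Gluing V where
  top := {t | t ∈ B.tri ∧ B.cut.InPiece C (o.front t)}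
  adj t t' := (t ∩ t').card = 2 ∧ B.cut.SameCell (t ∩ t') (o.front t) (o.front t')

/-- The region `C` is a sutured product ball `(D × [0,1], ∂D × [0,1])`, `D` a disk: it is a ball,
and `R₊` and `R₋` are disks. (The set of sutures, consisting of the cusps of `C`, thickened to the
vertical boundary, and of the part of `C` in the boundary of `M`, is the complement in the sphere
`∂C` of the two disks, an annulus.) -/
def IsProductBall (o : B.Coorientation) (C : B.Region) : Prop :=
  IsPLBall 3 (B.cut.sub C).barycentric ∧
  IsPLBall 2 (o.plusBoundary C).barycentric ∧
  IsPLBall 2 (o.minusBoundary C).barycentric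

/-- The region behind a sector. -/
def backRegion (o : B.Coorientation) : B.Sector → B.Region :=
  Quot.lift (fun t => B.cut.piece (o.back t.1) (o.back_mem t.1 t.2).1) fun t t' h =>
    B.piece_eq_of_sameCell (o.coherent_smooth t.1 t.2 t'.1 t'.2 h).1 _ _

/-- The region in front of a sector. -/
def frontRegion (o : B.Coorientation) : B.Sector → B.Region :=
  Quot.lift (fun t => B.cut.piece (o.front t.1) (o.front_mem t.1 t.2).1) fun t t' h =>
    B.piece_eq_of_sameCell (o.coherent_smooth t.1 t.2 t'.1 t'.2 h).2 _ _

/-- The maw dual graph: a vertex for every complementary region, and for every sector an edge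
crossing it in the direction of the coorientation, weighted by the maw Euler characteristic. -/
def mawDualGraph [Finite V] (o : B.Coorientation) (n : M.BdryOrientation) :
    WeightedGraph B.Region B.Sector where
  source := o.backRegion
  target := o.frontRegion
  weight := B.mawEulerChar n

end BranchedSurface.Coorientation

end MawGraph

end

/-!
Remove from each sector the part of its boundary along which the maw vector field points into it.
This part consists of circles and of arcs that end at the double corners, so the half-open sector
that remains has Euler characteristic `χ(s) - dc(s) / 2 = χ_m(s)`, which is therefore an integer.

The half-open sectors that have a region `C` behind them tile `R₊(C)`: where two sheets of `R₊(C)`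
are glued along a branch edge, only the one on the one-sheeted side misses the edge, and the upper
of the two tangent sheets, which ends there as a sheet of `R₊`, contains it. What the tiles leave
uncovered is the part of `R₊(C)` in the components of `∂M` that are oriented inward, a union of
circles and of arcs that end at the cusps of `C` on these components. The outgoing weight at `C` is
thus `χ(R₊(C))` minus half the number of these cusps. Reversing the coorientation exchanges `R₊`
with `R₋` and outgoing with incoming weights, and it preserves the cusps.
-/

noncomputable section

namespace MawGraph

/-! ### Euler characteristic of PL balls -/

section EulerChar

variable {α β : Type*}

/-- The Euler characteristic of a finite complex, by convention `0` for an infinite one. -/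
def simplicialEulerChar (K : PreAbstractSimplicialComplex α) : ℤ :=
  ∑ᶠ s ∈ K.faces, (-1) ^ (s.card + 1)

-- `s ↦ s ∆ {w}` is a sign-reversing involution without fixed points.
theorem sum_neg_one_pow_card_eq_zero [DecidableEq α] {S : Finset (Finset α)} {w : α}
    (hS : ∀ s ∈ S, symmDiff s {w} ∈ S) : ∑ s ∈ S, (-1 : ℤ) ^ s.card = 0 := by
  refine Finset.sum_involution (fun s _ => symmDiff s {w}) (fun s _ => ?_) (fun s _ _ h => ?_) hS
    fun s _ => symmDiff_symmDiff_cancel_right {w} s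
  · by_cases hw : w ∈ s
    · rw [symmDiff_of_ge (Finset.singleton_subset_iff.2 hw), Finset.sdiff_singleton_eq_erase,
        ← Finset.card_erase_add_one hw, pow_succ]
      ring
    · rw [Disjoint.symmDiff_eq_sup (Finset.disjoint_singleton_right.2 hw), Finset.sup_eq_union,
        Finset.union_comm, ← Finset.insert_eq, Finset.card_insert_of_notMem hw, pow_succ]
      ring
  · simp only [symmDiff_eq_left, Finset.bot_eq_empty, Finset.singleton_ne_empty] at h

theorem finsum_mem_neg_one_pow_of_infinite {S : Set α} (hS : ¬ S.Finite) (f : α → ℕ) :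
    ∑ᶠ s ∈ S, (-1 : ℤ) ^ f s = 0 := by
  have hsupport : Function.support (fun s => (-1 : ℤ) ^ f s) = Set.univ :=
    Set.eq_univ_of_forall fun s => pow_ne_zero _ (by norm_num)
  refine finsum_mem_eq_zero_of_infinite ?_
  rwa [hsupport, Set.inter_univ]

theorem finsum_neg_one_pow_card_eq_zero [DecidableEq α] {S : Set (Finset α)} {w : α}
    (hS : ∀ s ∈ S, symmDiff s {w} ∈ S) : ∑ᶠ s ∈ S, (-1 : ℤ) ^ s.card = 0 := by
  by_cases hfin : S.Finite
  · rw [finsum_mem_eq_finite_toFinset_sum _ hfin]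
    exact sum_neg_one_pow_card_eq_zero (by simpa using hS)
  · exact finsum_mem_neg_one_pow_of_infinite hfin _

theorem sum_nonempty_subsets_eq_one [DecidableEq α] {σ : Finset α} (hσ : σ.Nonempty) :
    ∑ s ∈ σ.powerset.erase ∅, (-1 : ℤ) ^ (s.card + 1) = 1 := by
  have h := Finset.sum_powerset_neg_one_pow_card_of_nonempty hσ
  rw [← Finset.add_sum_erase _ _ (Finset.empty_mem_powerset σ), Finset.card_empty, pow_zero] at h
  simp only [pow_succ, mul_neg, mul_one, Finset.sum_neg_distrib]
  linarith

theorem simplicialEulerChar_fullSimplex (n : ℕ) : simplicialEulerChar (fullSimplex n) = 1 := by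
  have h : (fullSimplex n).faces = ((Finset.range (n + 1)).powerset.erase ∅ : Finset _) := by
    ext s
    simp only [fullSimplex, Finset.nonempty_iff_ne_empty, Set.mem_ofPred_eq, Finset.mem_coe,
      Finset.mem_erase, Finset.mem_powerset]
  rw [simplicialEulerChar, h, finsum_mem_coe_finset]
  exact sum_nonempty_subsets_eq_one (by simp)

theorem simplicialEulerChar_map [DecidableEq β] (K : PreAbstractSimplicialComplex α) {f : α → β}
    (hf : Function.Injective f) : simplicialEulerChar (K.map f) = simplicialEulerChar K := by
  have h : (K.map f).faces = Finset.image f '' K.faces := by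
    ext s
    simp [PreAbstractSimplicialComplex.map]
  rw [simplicialEulerChar, h, finsum_mem_image (Finset.image_injective hf).injOn,
    simplicialEulerChar]
  simp only [Finset.card_image_of_injective _ hf]

section StellarSubdivision

variable {K : PreAbstractSimplicialComplex ℕ} {σ : Finset ℕ} {a : ℕ}

/-- The sets `r` for which `insert a r` is a new face of `stellarSubdivision K σ a`: the faces, the
empty one included, of the join of the boundary of `σ` and the link of `σ`. -/
def coneBase (K : PreAbstractSimplicialComplex ℕ) (σ : Finset ℕ) : Set (Finset ℕ) :=
  {r | r ∪ σ ∈ K.faces ∧ ¬ σ ⊆ r}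

theorem notMem_of_mem_faces (ha : {a} ∉ K.faces) {s : Finset ℕ} (hs : s ∈ K.faces) : a ∉ s :=
  fun h => ha ((K.isRelLowerSet_faces hs).2 (Finset.singleton_subset_iff.2 h)
    (Finset.singleton_nonempty a))

theorem notMem_of_mem_coneBase (ha : {a} ∉ K.faces) {r : Finset ℕ} (hr : r ∈ coneBase K σ) :
    a ∉ r :=
  fun h => notMem_of_mem_faces ha hr.1 (Finset.mem_union_left _ h)

theorem faces_stellarSubdivision (ha : {a} ∉ K.faces) :
    (stellarSubdivision K σ a).faces =
      {s ∈ K.faces | ¬ σ ⊆ s} ∪ insert a '' coneBase K σ := by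
  ext s
  simp only [stellarSubdivision, coneBase, Set.mem_union, Set.mem_image, Set.mem_ofPred_eq]
  refine or_congr_right ⟨fun h => ⟨s.erase a, h.2, Finset.insert_erase h.1⟩, ?_⟩
  rintro ⟨r, hr, rfl⟩
  rw [Finset.erase_insert (notMem_of_mem_coneBase ha hr)]
  exact ⟨Finset.mem_insert_self a r, hr⟩

theorem injOn_insert_coneBase (ha : {a} ∉ K.faces) :
    Set.InjOn (insert a) (coneBase K σ) := fun r hr r' hr' h => by
  rw [← Finset.erase_insert (notMem_of_mem_coneBase ha hr), h,
    Finset.erase_insert (notMem_of_mem_coneBase ha hr')]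

theorem finite_faces_of_finite_coneBase (hσ : σ.Nonempty)
    (h₁ : {s ∈ K.faces | ¬ σ ⊆ s}.Finite) (h₂ : (coneBase K σ).Finite) : K.faces.Finite := by
  obtain ⟨w, hw⟩ := hσ
  refine (h₁.union (h₂.image (insert w))).subset fun s hs => ?_
  by_cases h : σ ⊆ s
  · refine Or.inr ⟨s.erase w, ⟨?_, fun h' => Finset.notMem_erase w s (h' hw)⟩,
      Finset.insert_erase (h hw)⟩
    rwa [Finset.erase_union_of_mem hw, Finset.union_eq_left.2 h]
  · exact Or.inl ⟨hs, h⟩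

theorem finite_coneBase (h : K.faces.Finite) : (coneBase K σ).Finite := by
  refine (h.biUnion fun s _ => s.powerset.finite_toSet).subset fun r hr => ?_
  exact Set.mem_biUnion hr.1 (Finset.mem_coe.2 (Finset.mem_powerset.2 Finset.subset_union_left))

theorem finite_faces_stellarSubdivision_iff (hσ : σ ∈ K.faces) (ha : {a} ∉ K.faces) :
    (stellarSubdivision K σ a).faces.Finite ↔ K.faces.Finite := by
  rw [faces_stellarSubdivision ha, Set.finite_union,
    Set.finite_image_iff (injOn_insert_coneBase ha)]
  exact ⟨fun h => finite_faces_of_finite_coneBase (K.isRelLowerSet_faces hσ).1 h.1 h.2,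
    fun h => ⟨h.subset fun _ hs => hs.1, finite_coneBase h⟩⟩

theorem sum_star_add_sum_coneBase (hσ : σ.Nonempty) (hK : K.faces.Finite) :
    ∑ᶠ s ∈ {s ∈ K.faces | σ ⊆ s}, (-1 : ℤ) ^ s.card +
      ∑ᶠ r ∈ coneBase K σ, (-1 : ℤ) ^ r.card = 0 := by
  obtain ⟨w, hw⟩ := hσ
  have hunion : {s ∈ K.faces | σ ⊆ s} ∪ coneBase K σ = {r | r ∪ σ ∈ K.faces} := by
    ext r
    by_cases h : σ ⊆ r
    · simp [coneBase, h, Finset.union_eq_left.2 h]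
    · simp [coneBase, h]
  have hdisj : Disjoint {s ∈ K.faces | σ ⊆ s} (coneBase K σ) :=
    Set.disjoint_left.2 fun s hs hs' => hs'.2 hs.2
  rw [← finsum_mem_union hdisj (hK.subset fun _ hs => hs.1) (finite_coneBase hK), hunion]
  refine finsum_neg_one_pow_card_eq_zero (w := w) fun r hr => ?_
  have h : symmDiff r {w} ∪ σ = r ∪ σ := by
    ext x
    rcases eq_or_ne x w with rfl | hx
    · simp [hw]
    · simp [Finset.mem_symmDiff, hx]
  simpa only [Set.mem_ofPred_eq, h] using hr

theorem simplicialEulerChar_stellarSubdivision (hσ : σ ∈ K.faces) (ha : {a} ∉ K.faces) :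
    simplicialEulerChar (stellarSubdivision K σ a) = simplicialEulerChar K := by
  by_cases hK : K.faces.Finite
  · have hdisj : Disjoint {s ∈ K.faces | ¬ σ ⊆ s} (insert a '' coneBase K σ) := by
      rw [Set.disjoint_left]
      rintro _ hs ⟨r, -, rfl⟩
      exact notMem_of_mem_faces ha hs.1 (Finset.mem_insert_self a r)
    have hfaces : K.faces = {s ∈ K.faces | ¬ σ ⊆ s} ∪ {s ∈ K.faces | σ ⊆ s} := by
      ext s
      simp [← and_or_left, em']
    have hcone : ∑ᶠ s ∈ insert a '' coneBase K σ, (-1 : ℤ) ^ (s.card + 1) =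
        ∑ᶠ r ∈ coneBase K σ, (-1 : ℤ) ^ r.card := by
      rw [finsum_mem_image (injOn_insert_coneBase ha)]
      refine finsum_mem_congr rfl fun r hr => ?_
      rw [Finset.card_insert_of_notMem (notMem_of_mem_coneBase ha hr)]
      ring
    have hstar : ∑ᶠ s ∈ {s ∈ K.faces | σ ⊆ s}, (-1 : ℤ) ^ (s.card + 1) =
        - ∑ᶠ s ∈ {s ∈ K.faces | σ ⊆ s}, (-1 : ℤ) ^ s.card := by
      rw [← finsum_mem_neg_distrib _ (hK.subset fun _ hs => hs.1)]
      simp only [pow_succ, mul_neg, mul_one]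
    rw [simplicialEulerChar, faces_stellarSubdivision ha, finsum_mem_union hdisj
      (hK.subset fun _ hs => hs.1) ((finite_coneBase hK).image _), hcone, simplicialEulerChar]
    conv_rhs => rw [hfaces, finsum_mem_union (Set.disjoint_left.2 fun s hs hs' => hs.2 hs'.2)
      (hK.subset fun _ hs => hs.1) (hK.subset fun _ hs => hs.1), hstar]
    linarith [sum_star_add_sum_coneBase (K.isRelLowerSet_faces hσ).1 hK]
  · rw [simplicialEulerChar, simplicialEulerChar, finsum_mem_neg_one_pow_of_infinite hK,
      finsum_mem_neg_one_pow_of_infinite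
        ((finite_faces_stellarSubdivision_iff hσ ha).not.2 hK)]

end StellarSubdivision

theorem StellarEquiv.simplicialEulerChar_eq {K L : PreAbstractSimplicialComplex ℕ}
    (h : StellarEquiv K L) : simplicialEulerChar K = simplicialEulerChar L := by
  induction h with
  | rel K L h =>
    obtain ⟨σ, hσ, a, ha, rfl⟩ := h
    exact (simplicialEulerChar_stellarSubdivision hσ ha).symm
  | refl => rfl
  | symm _ _ _ ih => exact ih.symm
  | trans _ _ _ _ _ ih ih' => exact ih.trans ih'

theorem IsPLBall.simplicialEulerChar_eq_one {n : ℕ} {K : PreAbstractSimplicialComplex α}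
    (h : IsPLBall n K) : simplicialEulerChar K = 1 := by
  obtain ⟨f, hf, h⟩ := h
  rw [← simplicialEulerChar_map K hf, h.simplicialEulerChar_eq, simplicialEulerChar_fullSimplex]

end EulerChar

section OrderComplex

variable {P : Type*} [PartialOrder P]

open Classical in
/-- The chains of a partially ordered set with elements in `D`, the empty one included. -/
def chains (D : Finset P) : Finset (Finset P) :=
  {s ∈ D.powerset | IsChain (· ≤ ·) (s : Set P)}

theorem mem_chains {D s : Finset P} :
    s ∈ chains D ↔ s ⊆ D ∧ IsChain (· ≤ ·) (s : Set P) := by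
  simp [chains]

variable [Fintype P]

open Classical in
-- Every nonempty chain has exactly one greatest element.
theorem sum_chains_eq_sum_greatest (f : Finset P → ℤ) {D : Finset P}
    (hD : ∀ y ∈ D, ∀ x ≤ y, x ∈ D) :
    ∑ s ∈ (chains D).erase ∅, f s =
      ∑ y ∈ D, ∑ s ∈ chains ({x | x ≤ y} : Finset P) with y ∈ s, f s := by
  have hmem : ∀ (y : P) (s : Finset P),
      (y ∈ D ∧ s ∈ {s ∈ chains ({x | x ≤ y} : Finset P) | y ∈ s}) ↔
        y ∈ {y ∈ s | ∀ x ∈ s, x ≤ y} ∧ s ∈ (chains D).erase ∅ := by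
    intro y s
    simp only [Finset.mem_filter, Finset.mem_erase, mem_chains, Finset.subset_iff,
      Finset.mem_univ, true_and]
    exact ⟨fun h => ⟨⟨h.2.2, h.2.1.1⟩, Finset.ne_empty_of_mem h.2.2,
      fun x hx => hD y h.1 x (h.2.1.1 hx), h.2.1.2⟩,
      fun h => ⟨h.2.2.1 h.1.1, ⟨h.1.2, h.2.2.2⟩, h.1.1⟩⟩
  rw [Finset.sum_comm' hmem]
  refine Finset.sum_congr rfl fun s hs => ?_
  obtain ⟨hne, hs⟩ := Finset.mem_erase.1 hs
  obtain ⟨y, hy⟩ := s.exists_maximal (Finset.nonempty_iff_ne_empty.2 hne)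
  have hgreatest : ∀ x ∈ s, x ≤ y := fun x hx =>
    ((mem_chains.1 hs).2.total hx hy.1).elim id fun h => hy.2 hx h
  have huniq : {y ∈ s | ∀ x ∈ s, x ≤ y} = {y} := by
    ext x
    rw [Finset.mem_filter, Finset.mem_singleton]
    exact ⟨fun h => (hgreatest x h.1).antisymm (h.2 y hy.1), fun h => h ▸ ⟨hy.1, hgreatest⟩⟩
  rw [huniq, Finset.sum_const, Finset.card_singleton, one_smul]

open Classical in
-- The order complex of `{x | x ≤ y}` is a cone with apex `y`.
theorem sum_chains_le_eq_one (y : P) :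
    ∑ s ∈ (chains ({x | x ≤ y} : Finset P)).erase ∅, (-1 : ℤ) ^ (s.card + 1) = 1 := by
  have hzero : ∑ s ∈ chains ({x | x ≤ y} : Finset P), (-1 : ℤ) ^ s.card = 0 := by
    refine sum_neg_one_pow_card_eq_zero (w := y) fun s hs => ?_
    obtain ⟨hle, hchain⟩ := mem_chains.1 hs
    have hsub : symmDiff s {y} ⊆ insert y s := fun x hx => by
      rw [Finset.mem_symmDiff, Finset.mem_singleton] at hx
      rw [Finset.mem_insert]
      tauto
    have hinsert : IsChain (· ≤ ·) ((insert y s : Finset P) : Set P) := by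
      rw [Finset.coe_insert]
      exact hchain.insert fun z hz _ => Or.inr ((Finset.mem_filter_univ z).1 (hle hz))
    exact mem_chains.2 ⟨hsub.trans (Finset.insert_subset (by simp) hle),
      hinsert.mono (Finset.coe_subset.2 hsub)⟩
  have hempty : ∅ ∈ chains ({x | x ≤ y} : Finset P) := by simp [mem_chains]
  rw [← Finset.add_sum_erase _ _ hempty, Finset.card_empty, pow_zero] at hzero
  simp only [pow_succ, mul_neg, mul_one, Finset.sum_neg_distrib]
  linarith

open Classical in
theorem sum_chains_greatest_eq {ε : P → ℤ} (hε : ∀ y, ∑ x with x ≤ y, ε x = 1) (y : P) :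
    ∑ s ∈ chains ({x | x ≤ y} : Finset P) with y ∈ s, (-1 : ℤ) ^ (s.card + 1) = ε y := by
  induction y using WellFoundedLT.induction with
  | _ y ih =>
    have h := sum_chains_le_eq_one y
    have hε' := hε y
    have hmem : y ∈ ({x | x ≤ y} : Finset P) := by simp
    have hlower : ∀ z ∈ ({x | x ≤ y} : Finset P), ∀ x ≤ z, x ∈ ({x | x ≤ y} : Finset P) := by
      simp only [Finset.mem_filter_univ]
      exact fun z hz x hx => hx.trans hz
    rw [sum_chains_eq_sum_greatest _ hlower, ← Finset.add_sum_erase _ _ hmem] at h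
    rw [← Finset.add_sum_erase _ _ hmem] at hε'
    have hlt : ∀ x ∈ ({x | x ≤ y} : Finset P).erase y, x < y := by
      intro x hx
      rw [Finset.mem_erase, Finset.mem_filter_univ] at hx
      exact lt_of_le_of_ne hx.2 hx.1
    rw [Finset.sum_congr rfl fun x hx => ih x (hlt x hx)] at h
    linarith

open Classical in
-- The hypothesis determines `ε` (Möbius inversion).
theorem sum_chains_eq_sum {ε : P → ℤ} (hε : ∀ y, ∑ x with x ≤ y, ε x = 1) :
    ∑ s ∈ (chains (Finset.univ : Finset P)).erase ∅, (-1 : ℤ) ^ (s.card + 1) = ∑ y, ε y := by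
  rw [sum_chains_eq_sum_greatest _ fun _ _ x _ => Finset.mem_univ x]
  exact Finset.sum_congr rfl fun y _ => sum_chains_greatest_eq hε y

end OrderComplex

/-! ### Cells of a glued complex -/

namespace Gluing

variable {V : Type*} {G H : Gluing V}

theorem SameCell.refl (σ t : Finset V) : G.SameCell σ t t := Relation.EqvGen.refl t

theorem SameCell.symm {σ t t' : Finset V} (h : G.SameCell σ t t') : G.SameCell σ t' t :=
  Relation.EqvGen.symm _ _ h

theorem SameCell.trans {σ t t' t'' : Finset V} (h₁ : G.SameCell σ t t')
    (h₂ : G.SameCell σ t' t'') : G.SameCell σ t t'' :=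
  Relation.EqvGen.trans _ _ _ h₁ h₂

theorem SameCell.of_adj {σ t t' : Finset V} (ht : t ∈ G.top) (ht' : t' ∈ G.top) (hσ : σ ⊆ t)
    (hσ' : σ ⊆ t') (h : G.adj t t') : G.SameCell σ t t' :=
  Relation.EqvGen.rel _ _ ⟨ht, ht', hσ, hσ', h⟩

theorem SameCell.equivalence (G : Gluing V) (σ : Finset V) : Equivalence (G.SameCell σ) :=
  Relation.EqvGen.is_equivalence _

theorem SameCell.rel {σ : Finset V} {r : Finset V → Finset V → Prop} (hr : Equivalence r)
    (h : ∀ t t', t ∈ G.top → t' ∈ G.top → σ ⊆ t → σ ⊆ t' → G.adj t t' → r t t')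
    {t t' : Finset V} (ht : G.SameCell σ t t') : r t t' := by
  induction ht with
  | rel a b h' => exact h a b h'.1 h'.2.1 h'.2.2.1 h'.2.2.2.1 h'.2.2.2.2
  | refl a => exact hr.refl a
  | symm a b _ ih => exact hr.symm ih
  | trans a b c _ _ ih ih' => exact hr.trans ih ih'

theorem SameCell.iff {σ : Finset V} {p : Finset V → Prop}
    (h : ∀ t t', t ∈ G.top → t' ∈ G.top → σ ⊆ t → σ ⊆ t' → G.adj t t' → (p t ↔ p t'))
    {t t' : Finset V} (ht : G.SameCell σ t t') : p t ↔ p t' :=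
  ht.rel (r := fun t t' => p t ↔ p t') ⟨fun _ => Iff.rfl, Iff.symm, Iff.trans⟩ h

theorem SameCell.mono {σ σ' t t' : Finset V} (hσ : σ ⊆ σ') (h : G.SameCell σ' t t') :
    G.SameCell σ t t' :=
  h.rel (SameCell.equivalence G σ) fun _ _ ht ht' hs hs' =>
    .of_adj ht ht' (hσ.trans hs) (hσ.trans hs')

theorem SameCell.mem_top_iff {σ t t' : Finset V} (h : G.SameCell σ t t') :
    t ∈ G.top ↔ t' ∈ G.top :=
  h.iff fun _ _ ht ht' _ _ _ => iff_of_true ht ht'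

theorem SameCell.subset_iff {σ t t' : Finset V} (h : G.SameCell σ t t') : σ ⊆ t ↔ σ ⊆ t' :=
  h.iff fun _ _ _ _ hs hs' _ => iff_of_true hs hs'

theorem SameCell.inPiece_iff {σ t t' : Finset V} (h : G.SameCell σ t t') (c : G.Piece) :
    G.InPiece c t ↔ G.InPiece c t' := by
  refine h.iff fun t t' ht ht' _ _ hadj => ?_
  have heq : G.piece t ht = G.piece t' ht' := Quot.sound hadj
  exact ⟨fun ⟨_, hc⟩ => ⟨ht', heq.symm.trans hc⟩, fun ⟨_, hc⟩ => ⟨ht, heq.trans hc⟩⟩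

theorem SameCell.piece_eq {σ t t' : Finset V} (h : G.SameCell σ t t') (ht : t ∈ G.top)
    (ht' : t' ∈ G.top) : G.piece t ht = G.piece t' ht' :=
  ((h.inPiece_iff _).2 ⟨ht', rfl⟩).2

theorem Flag.cell_eq_iff {p q : G.Flag} :
    p.cell = q.cell ↔ p.1.1 = q.1.1 ∧ G.SameCell p.1.1 p.1.2 q.1.2 :=
  Quotient.eq (r := G.flagSetoid)

theorem Cell.exists_flag (x : G.Cell) : ∃ p : G.Flag, p.cell = x := Quotient.exists_rep x

@[simp] theorem Flag.simplex_cell (p : G.Flag) : p.cell.simplex = p.1.1 := rfl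

theorem Cell.simplex_nonempty (x : G.Cell) : x.simplex.Nonempty := by
  obtain ⟨p, rfl⟩ := x.exists_flag
  exact p.2.1

/-- The face `σ` of the flag `p`. -/
def Flag.face (p : G.Flag) (σ : Finset V) (hσ : σ.Nonempty) (h : σ ⊆ p.1.1) : G.Flag :=
  ⟨(σ, p.1.2), hσ, h.trans p.2.2.1, p.2.2.2⟩

theorem Flag.isFace_cell_iff {q : G.Flag} {x : G.Cell} :
    x.IsFace q.cell ↔ ∃ σ hσ, ∃ h : σ ⊆ q.1.1, (q.face σ hσ h).cell = x := by
  constructor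
  · rintro ⟨p, q', rfl, hq, htop, hsub⟩
    obtain ⟨hsimplex, hsame⟩ := Flag.cell_eq_iff.1 hq
    refine ⟨p.1.1, p.2.1, hsub.trans hsimplex.subset, Flag.cell_eq_iff.2 ⟨rfl, ?_⟩⟩
    have h := (hsame.mono hsub).symm
    rwa [← htop] at h
  · rintro ⟨σ, hσ, h, rfl⟩
    exact ⟨_, q, rfl, rfl, rfl, h⟩

theorem Flag.cell_isFace_cell_iff {p q : G.Flag} :
    p.cell.IsFace q.cell ↔ p.1.1 ⊆ q.1.1 ∧ G.SameCell p.1.1 p.1.2 q.1.2 := by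
  rw [Flag.isFace_cell_iff]
  constructor
  · rintro ⟨σ, hσ, h, heq⟩
    obtain ⟨rfl, hsame⟩ := Flag.cell_eq_iff.1 heq
    exact ⟨h, hsame.symm⟩
  · exact fun h => ⟨p.1.1, p.2.1, h.1, Flag.cell_eq_iff.2 ⟨rfl, h.2.symm⟩⟩

instance : PartialOrder G.Cell where
  le := Cell.IsFace
  le_refl x := by
    obtain ⟨p, rfl⟩ := x.exists_flag
    exact Flag.cell_isFace_cell_iff.2 ⟨subset_rfl, .refl _ _⟩
  le_trans x y z hxy hyz := by
    obtain ⟨p, rfl⟩ := x.exists_flag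
    obtain ⟨q, rfl⟩ := y.exists_flag
    obtain ⟨r, rfl⟩ := z.exists_flag
    rw [Flag.cell_isFace_cell_iff] at *
    exact ⟨hxy.1.trans hyz.1, hxy.2.trans (hyz.2.mono hxy.1)⟩
  le_antisymm x y hxy hyx := by
    obtain ⟨p, rfl⟩ := x.exists_flag
    obtain ⟨q, rfl⟩ := y.exists_flag
    rw [Flag.cell_isFace_cell_iff] at *
    exact Flag.cell_eq_iff.2 ⟨hxy.1.antisymm hyx.1, hxy.2⟩

theorem Flag.cell_le_cell_iff {p q : G.Flag} :
    p.cell ≤ q.cell ↔ p.1.1 ⊆ q.1.1 ∧ G.SameCell p.1.1 p.1.2 q.1.2 :=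
  Flag.cell_isFace_cell_iff

theorem Cell.simplex_mono {x y : G.Cell} (h : x ≤ y) : x.simplex ⊆ y.simplex := by
  obtain ⟨p, rfl⟩ := x.exists_flag
  obtain ⟨q, rfl⟩ := y.exists_flag
  exact (Flag.cell_le_cell_iff.1 h).1

theorem Cell.eq_of_le_of_card_le {x y : G.Cell} (h : x ≤ y)
    (hcard : y.simplex.card ≤ x.simplex.card) : x = y := by
  obtain ⟨p, rfl⟩ := x.exists_flag
  obtain ⟨q, rfl⟩ := y.exists_flag
  obtain ⟨hsub, hsame⟩ := Flag.cell_le_cell_iff.1 h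
  exact Flag.cell_eq_iff.2 ⟨Finset.eq_of_subset_of_card_le hsub hcard, hsame⟩

theorem Cell.eq_of_le_of_le_of_simplex_eq {x x' y : G.Cell} (h : x ≤ y) (h' : x' ≤ y)
    (heq : x.simplex = x'.simplex) : x = x' := by
  obtain ⟨p, rfl⟩ := x.exists_flag
  obtain ⟨p', rfl⟩ := x'.exists_flag
  obtain ⟨q, rfl⟩ := y.exists_flag
  rw [Flag.simplex_cell, Flag.simplex_cell] at heq
  exact Flag.cell_eq_iff.2 ⟨heq, (Flag.cell_le_cell_iff.1 h).2.trans
    (heq ▸ (Flag.cell_le_cell_iff.1 h').2.symm)⟩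

theorem Cell.exists_le_simplex_eq (y : G.Cell) {σ : Finset V} (hσ : σ.Nonempty)
    (h : σ ⊆ y.simplex) : ∃ x ≤ y, x.simplex = σ := by
  obtain ⟨q, rfl⟩ := y.exists_flag
  exact ⟨(q.face σ hσ h).cell, Flag.cell_le_cell_iff.2 ⟨h, .refl _ _⟩, rfl⟩

/-- The sign with which a cell contributes to the Euler characteristic. -/
def Cell.sign (x : G.Cell) : ℤ := (-1) ^ (x.simplex.card + 1)

section Finite

variable [Finite V]

theorem eulerChar_eq_sum_sign (G : Gluing V) : G.eulerChar = ∑ x : G.Cell, x.sign := rfl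

open Classical in
theorem sum_le_eq_sum_powerset (y : G.Cell) (f : Finset V → ℤ) :
    ∑ x with x ≤ y, f x.simplex = ∑ σ ∈ y.simplex.powerset.erase ∅, f σ := by
  refine Finset.sum_bij (fun x _ => x.simplex) (fun x hx => ?_) (fun x hx x' hx' h => ?_)
    (fun σ hσ => ?_) fun x _ => rfl
  · exact Finset.mem_erase.2 ⟨x.simplex_nonempty.ne_empty,
      Finset.mem_powerset.2 (Cell.simplex_mono (Finset.mem_filter.1 hx).2)⟩
  · exact Cell.eq_of_le_of_le_of_simplex_eq (Finset.mem_filter.1 hx).2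
      (Finset.mem_filter.1 hx').2 h
  · obtain ⟨hne, hsub⟩ := Finset.mem_erase.1 hσ
    obtain ⟨x, hx, rfl⟩ := y.exists_le_simplex_eq (Finset.nonempty_iff_ne_empty.2 hne)
      (Finset.mem_powerset.1 hsub)
    exact ⟨x, Finset.mem_filter.2 ⟨Finset.mem_univ x, hx⟩, rfl⟩

theorem simplicialEulerChar_barycentric (G : Gluing V) :
    simplicialEulerChar G.barycentric = G.eulerChar := by
  classical
  have hfaces : G.barycentric.faces = ((chains Finset.univ).erase ∅ : Finset (Finset G.Cell)) := by
    ext s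
    rw [Finset.mem_coe, Finset.mem_erase, mem_chains, ← Finset.nonempty_iff_ne_empty]
    refine and_congr_right fun _ => ⟨fun h => ⟨s.subset_univ, fun x hx y hy _ => h x hx y hy⟩,
      fun h x hx y hy => h.2.total hx hy⟩
  rw [simplicialEulerChar, hfaces, finsum_mem_coe_finset, eulerChar_eq_sum_sign]
  refine sum_chains_eq_sum fun y => ?_
  rw [← sum_nonempty_subsets_eq_one y.simplex_nonempty, ← sum_le_eq_sum_powerset]
  rfl

theorem eulerChar_eq_one_of_isPLBall {n : ℕ} (h : IsPLBall n G.barycentric) : G.eulerChar = 1 := by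
  rw [← simplicialEulerChar_barycentric, h.simplicialEulerChar_eq_one]

end Finite

/-! ### Maps of glued complexes and unions of pieces -/

/-- The simplices of `G` are simplices of `H`, and those glued in `G` are glued in `H`. -/
def GluesInto (G H : Gluing V) : Prop :=
  G.top ⊆ H.top ∧ ∀ t t', t ∈ G.top → t' ∈ G.top → G.adj t t' → ∀ σ, σ ⊆ t → σ ⊆ t' →
    H.SameCell σ t t'

theorem GluesInto.sameCell (h : G.GluesInto H) {σ t t' : Finset V} (ht : G.SameCell σ t t') :
    H.SameCell σ t t' :=
  ht.rel (SameCell.equivalence H σ) fun t t' ht ht' hs hs' hadj => h.2 t t' ht ht' hadj σ hs hs'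

/-- A flag of `G` as a flag of `H`. -/
def GluesInto.flag (h : G.GluesInto H) (p : G.Flag) : H.Flag :=
  ⟨p.1, p.2.1, p.2.2.1, h.1 p.2.2.2⟩

/-- The quotient map on cells. -/
def GluesInto.cellMap (h : G.GluesInto H) (x : G.Cell) : H.Cell :=
  Quotient.lift (s := G.flagSetoid) (fun p => (h.flag p).cell)
    (fun _ _ hpq => Flag.cell_eq_iff.2 ⟨hpq.1, h.sameCell hpq.2⟩) x

@[simp] theorem GluesInto.simplex_cellMap (h : G.GluesInto H) (x : G.Cell) :
    (h.cellMap x).simplex = x.simplex := by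
  obtain ⟨p, rfl⟩ := x.exists_flag
  rfl

/-- The piece containing a cell. -/
def Cell.piece (x : G.Cell) : G.Piece :=
  Quotient.lift (s := G.flagSetoid) (fun p => G.piece p.1.2 p.2.2.2)
    (fun _ _ hpq => hpq.2.piece_eq _ _) x

theorem Cell.piece_eq_of_le {x y : G.Cell} (h : x ≤ y) : x.piece = y.piece := by
  obtain ⟨p, rfl⟩ := x.exists_flag
  obtain ⟨q, rfl⟩ := y.exists_flag
  exact (Flag.cell_le_cell_iff.1 h).2.piece_eq _ _

/-- The union of a set of pieces as a glued complex. -/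
def restrict (G : Gluing V) (P : Set G.Piece) : Gluing V :=
  ⟨{t | ∃ ht, G.piece t ht ∈ P}, G.adj⟩

theorem sub_eq_restrict (G : Gluing V) (c : G.Piece) : G.sub c = G.restrict {c} := rfl

variable {P : Set G.Piece}

theorem restrict_gluesInto (G : Gluing V) (P : Set G.Piece) : (G.restrict P).GluesInto G :=
  ⟨fun _ ht => ht.1, fun _ _ ht ht' h _ hσ hσ' => .of_adj ht.1 ht'.1 hσ hσ' h⟩

theorem sameCell_restrict_iff {σ t t' : Finset V} (ht : t ∈ (G.restrict P).top) :
    (G.restrict P).SameCell σ t t' ↔ G.SameCell σ t t' := by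
  refine ⟨(restrict_gluesInto G P).sameCell, fun h => ?_⟩
  refine (h.rel (r := fun t t' => (t ∈ (G.restrict P).top ↔ t' ∈ (G.restrict P).top) ∧
    (t ∈ (G.restrict P).top → (G.restrict P).SameCell σ t t'))
    ⟨fun t => ⟨Iff.rfl, fun _ => .refl σ t⟩,
      fun h => ⟨h.1.symm, fun h' => (h.2 (h.1.2 h')).symm⟩,
      fun h h' => ⟨h.1.trans h'.1, fun hx => (h.2 hx).trans (h'.2 (h.1.1 hx))⟩⟩ ?_).2 ht
  intro t t' ht ht' hs hs' hadj
  have heq : G.piece t ht = G.piece t' ht' := Quot.sound hadj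
  have hiff : t ∈ (G.restrict P).top ↔ t' ∈ (G.restrict P).top :=
    ⟨fun ⟨_, h⟩ => ⟨ht', heq ▸ h⟩, fun ⟨_, h⟩ => ⟨ht, heq ▸ h⟩⟩
  exact ⟨hiff, fun h => .of_adj h (hiff.1 h) hs hs' hadj⟩

/-- The inclusion of a union of pieces. -/
def inclusion (P : Set G.Piece) : (G.restrict P).Cell → G.Cell :=
  (restrict_gluesInto G P).cellMap

@[simp] theorem simplex_inclusion (x : (G.restrict P).Cell) :
    (inclusion P x).simplex = x.simplex :=
  (restrict_gluesInto G P).simplex_cellMap x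

theorem inclusion_le_inclusion_iff {x y : (G.restrict P).Cell} :
    inclusion P x ≤ inclusion P y ↔ x ≤ y := by
  obtain ⟨p, rfl⟩ := x.exists_flag
  obtain ⟨q, rfl⟩ := y.exists_flag
  have h := sameCell_restrict_iff (σ := p.1.1) (t' := q.1.2) p.2.2.2
  exact Flag.cell_le_cell_iff.trans ((and_congr_right fun _ => h.symm).trans
    (Flag.cell_le_cell_iff (p := p) (q := q)).symm)

theorem inclusion_injective : Function.Injective (inclusion P) := fun _ _ h =>
  le_antisymm (inclusion_le_inclusion_iff.1 h.le) (inclusion_le_inclusion_iff.1 h.ge)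

theorem exists_inclusion_eq_iff {y : G.Cell} : (∃ x, inclusion P x = y) ↔ y.piece ∈ P := by
  constructor
  · rintro ⟨x, rfl⟩
    obtain ⟨p, rfl⟩ := x.exists_flag
    exact p.2.2.2.2
  · intro hy
    obtain ⟨q, rfl⟩ := y.exists_flag
    exact ⟨Flag.cell ⟨q.1, q.2.1, q.2.2.1, q.2.2.2, hy⟩, rfl⟩

open Classical in
theorem sum_restrict [Finite V] (P : Set G.Piece) (f : G.Cell → ℤ) :
    ∑ x, f (inclusion P x) = ∑ y with y.piece ∈ P, f y := by
  refine Finset.sum_bij (fun x _ => inclusion P x) (fun x _ => ?_)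
    (fun x _ y _ h => inclusion_injective h) (fun y hy => ?_) fun _ _ => rfl
  · exact (Finset.mem_filter_univ _).2 (exists_inclusion_eq_iff.1 ⟨x, rfl⟩)
  · obtain ⟨x, hx⟩ := exists_inclusion_eq_iff.2 ((Finset.mem_filter_univ y).1 hy)
    exact ⟨x, Finset.mem_univ x, hx⟩

open Classical in
theorem eulerChar_restrict [Finite V] (P : Set G.Piece) :
    (G.restrict P).eulerChar = ∑ y : G.Cell with y.piece ∈ P, y.sign := by
  rw [← sum_restrict, eulerChar_eq_sum_sign]
  simp only [Cell.sign, simplex_inclusion]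

end Gluing

/-! ### Arcs of a subdivided graph -/

namespace Subdivides

variable {V : Type*} {G : SimpleGraph V} {n m : ℕ} {ends : Fin m → Fin n × Fin n}

/-- The two ends of the arc `j` of a multigraph. -/
def endNode (ends : Fin m → Fin n × Fin n) (j : Fin m) (b : Bool) : Fin n :=
  if b then (ends j).2 else (ends j).1

/-- The number of ends of arcs at the node `i`. -/
def nodeDegree (ends : Fin m → Fin n × Fin n) (i : Fin n) : ℕ :=
  (Finset.univ.filter fun p : Fin m × Bool => endNode ends p.1 p.2 = i).card

theorem endNode_injective (hne : ∀ j, (ends j).1 ≠ (ends j).2) (j : Fin m) :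
    Function.Injective (endNode ends j) := by
  rintro (_ | _) (_ | _) h
  exacts [rfl, (hne j h).elim, (hne j h.symm).elim, rfl]

/-- The neighbour on the arc `j` of its end `b`. -/
def nbr (S : Subdivides G ends) (j : Fin m) (b : Bool) : V :=
  if b then (S.arc j).penultimate else (S.arc j).snd

variable (S : Subdivides G ends)

theorem not_nil (hne : ∀ j, (ends j).1 ≠ (ends j).2) (j : Fin m) : ¬ (S.arc j).Nil := by
  intro h
  exact hne j (S.node_injective h.eq)

theorem nbr_mem_edges (hne : ∀ j, (ends j).1 ≠ (ends j).2) (j : Fin m) (b : Bool) :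
    s(S.node (endNode ends j b), S.nbr j b) ∈ (S.arc j).edges := by
  rw [← SimpleGraph.Walk.adj_toSubgraph_iff_mem_edges]
  cases b
  · exact (S.arc j).toSubgraph_adj_snd (S.not_nil hne j)
  · exact ((S.arc j).toSubgraph_adj_penultimate (S.not_nil hne j)).symm

theorem eq_nbr_of_mem_edges (hne : ∀ j, (ends j).1 ≠ (ends j).2) {i : Fin n} {j : Fin m} {y : V}
    (h : s(S.node i, y) ∈ (S.arc j).edges) : ∃ b, i = endNode ends j b ∧ y = S.nbr j b := by
  have hadj := SimpleGraph.Walk.adj_toSubgraph_iff_mem_edges.2 h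
  rcases S.node_mem i j ((S.arc j).fst_mem_support_of_mem_edges h) with rfl | rfl
  · refine ⟨false, rfl, ?_⟩
    have : y ∈ (S.arc j).toSubgraph.neighborSet (S.node (ends j).1) := hadj
    rw [(S.arc_isPath j).neighborSet_toSubgraph_startpoint (S.not_nil hne j)] at this
    exact this
  · refine ⟨true, rfl, ?_⟩
    have : y ∈ (S.arc j).toSubgraph.neighborSet (S.node (ends j).2) := hadj
    rw [(S.arc_isPath j).neighborSet_toSubgraph_endpoint (S.not_nil hne j)] at this
    exact this

theorem mem_edges_of_adj {j : Fin m} {x y z : V} (hx : x ∉ Set.range S.node)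
    (h : s(x, y) ∈ (S.arc j).edges) (hz : G.Adj x z) : s(x, z) ∈ (S.arc j).edges := by
  obtain ⟨k, hk, -⟩ := S.edge_mem s(x, z) hz
  by_cases hjk : j = k
  · exact hjk ▸ hk
  · exact absurd (S.arc_disjoint j k hjk x ((S.arc j).fst_mem_support_of_mem_edges h)
      ((S.arc k).fst_mem_support_of_mem_edges hk)) hx

theorem ncard_neighborSet {j : Fin m} {x y : V} (hx : x ∉ Set.range S.node)
    (h : s(x, y) ∈ (S.arc j).edges) : (G.neighborSet x).ncard = 2 := by
  have h1 : G.neighborSet x = (S.arc j).toSubgraph.neighborSet x := by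
    ext z
    constructor
    · exact fun hz => SimpleGraph.Walk.adj_toSubgraph_iff_mem_edges.2 (S.mem_edges_of_adj hx h hz)
    · exact fun hz => hz.adj_sub
  obtain ⟨i, rfl, hi⟩ := SimpleGraph.Walk.mem_support_iff_exists_getVert.1
    ((S.arc j).fst_mem_support_of_mem_edges h)
  rw [h1]
  refine (S.arc_isPath j).ncard_neighborSet_toSubgraph_internal_eq_two ?_ (lt_of_le_of_ne hi ?_)
  · rintro rfl
    exact hx ⟨_, (SimpleGraph.Walk.getVert_zero _).symm⟩
  · rintro rfl
    exact hx ⟨_, (SimpleGraph.Walk.getVert_length _).symm⟩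

theorem getVert_notMem_range {j : Fin m} {i : ℕ} (h0 : i ≠ 0) (hi : i < (S.arc j).length) :
    (S.arc j).getVert i ∉ Set.range S.node := by
  rintro ⟨k, hk⟩
  have hpath := S.arc_isPath j
  rcases S.node_mem k j (hk ▸ (S.arc j).getVert_mem_support i) with rfl | rfl
  · exact h0 ((hpath.getVert_eq_start_iff hi.le).1 hk.symm)
  · exact hi.ne ((hpath.getVert_eq_end_iff hi.le).1 hk.symm)

theorem rel_of_mem_edges {j : Fin m} {r : Sym2 V → Sym2 V → Prop} (hr : Equivalence r)
    (h : ∀ x y z, x ∉ Set.range S.node → s(x, y) ∈ (S.arc j).edges → s(x, z) ∈ (S.arc j).edges →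
      r s(x, y) s(x, z)) {e e' : Sym2 V} (he : e ∈ (S.arc j).edges) (he' : e' ∈ (S.arc j).edges) :
    r e e' := by
  set p := S.arc j
  have hmem (i : ℕ) (hi : i < p.length) : s(p.getVert i, p.getVert (i + 1)) ∈ p.edges :=
    SimpleGraph.Walk.adj_toSubgraph_iff_mem_edges.1 (p.toSubgraph_adj_getVert hi)
  have hfirst (i : ℕ) (hi : i < p.length) :
      r s(p.getVert 0, p.getVert (0 + 1)) s(p.getVert i, p.getVert (i + 1)) := by
    induction i with
    | zero => exact hr.refl _
    | succ i ih =>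
      refine hr.trans (ih (by omega)) ?_
      have hprev := hmem i (by omega)
      rw [Sym2.eq_swap] at hprev ⊢
      exact h _ _ _ (S.getVert_notMem_range i.succ_ne_zero hi) hprev (hmem _ hi)
  have hind (e : Sym2 V) (he : e ∈ p.edges) : r s(p.getVert 0, p.getVert (0 + 1)) e := by
    induction e with
    | h x y =>
      obtain ⟨i, heq, hi⟩ := p.toSubgraph_adj_iff.1
        (SimpleGraph.Walk.adj_toSubgraph_iff_mem_edges.2 he)
      exact heq ▸ hfirst i hi
  exact hr.trans (hr.symm (hind e he)) (hind e' he')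

end Subdivides

/-! ### The triangles around a vertex -/

section Around

variable {V : Type*} [DecidableEq V] {T : Set (Finset V)} {v : V}

theorem exists_linkGraph_adj {t : Finset V} (h3 : t.card = 3) (ht : t ∈ T) {x : V} (hv : v ∈ t)
    (hx : x ∈ t) (hxv : x ≠ v) : ∃ y, t = {v, x, y} ∧ (linkGraph T v).Adj x y := by
  obtain ⟨y, hy⟩ : ∃ y, t.erase v = {x, y} ∧ x ≠ y := by
    have h2 : (t.erase v).card = 2 := by rw [Finset.card_erase_of_mem hv, h3]
    obtain ⟨a, b, hab, h⟩ := Finset.card_eq_two.1 h2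
    have : x ∈ t.erase v := Finset.mem_erase.2 ⟨hxv, hx⟩
    rw [h] at this
    rcases Finset.mem_insert.1 this with rfl | h'
    · exact ⟨b, h, hab⟩
    · rw [Finset.mem_singleton] at h'
      subst h'
      exact ⟨a, by rw [h, Finset.pair_comm], hab.symm⟩
  have ht' : t = {v, x, y} := by rw [← hy.1, Finset.insert_erase hv]
  have hyv : y ≠ v := by
    have : y ∈ t.erase v := by rw [hy.1]; simp
    exact Finset.ne_of_mem_erase this
  exact ⟨y, ht', hy.2, hxv, hyv, ht' ▸ ht⟩

theorem exists_linkGraph_adj' {t : Finset V} (h3 : t.card = 3) (ht : t ∈ T) (hv : v ∈ t) :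
    ∃ x y, t = {v, x, y} ∧ (linkGraph T v).Adj x y := by
  obtain ⟨x, hx⟩ : (t.erase v).Nonempty := by
    rw [← Finset.card_pos, Finset.card_erase_of_mem hv, h3]; norm_num
  obtain ⟨y, h⟩ := exists_linkGraph_adj h3 ht hv (Finset.mem_of_mem_erase hx)
    (Finset.ne_of_mem_erase hx)
  exact ⟨x, y, h⟩

theorem eq_edge_of_triangle_eq {x y x' y' : V} (h : (linkGraph T v).Adj x y)
    (h' : (linkGraph T v).Adj x' y') (he : ({v, x, y} : Finset V) = {v, x', y'}) :
    s(x, y) = s(x', y') := by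
  have h1 : ({x, y} : Finset V) = {x', y'} := by
    have := congrArg (fun t => t.erase v) he
    simpa [Finset.erase_insert, h.2.1.symm, h.2.2.1.symm, h'.2.1.symm, h'.2.2.1.symm] using this
  have hx : x ∈ ({x', y'} : Finset V) := h1 ▸ by simp
  have hy : y ∈ ({x', y'} : Finset V) := h1 ▸ by simp
  have hxy := h.1
  simp only [Finset.mem_insert, Finset.mem_singleton] at hx hy
  rw [Sym2.eq_iff]
  rcases hx with rfl | rfl <;> rcases hy with rfl | rfl <;> simp_all

theorem ncard_triangles_eq (hT : ∀ t ∈ T, t.card = 3) {x : V} (hx : x ≠ v) :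
    {t | t ∈ T ∧ {v, x} ⊆ t}.ncard = ((linkGraph T v).neighborSet x).ncard := by
  symm
  refine Set.ncard_congr (fun y _ => {v, x, y}) ?_ ?_ ?_
  · intro y hy
    refine ⟨hy.2.2.2, ?_⟩
    intro z hz
    simp only [Finset.mem_insert, Finset.mem_singleton] at hz ⊢
    tauto
  · intro y y' hy hy' h
    have := eq_edge_of_triangle_eq hy hy' h
    rcases Sym2.eq_iff.1 this with h | h
    · exact h.2
    · exact h.2.trans h.1
  · rintro t ⟨ht, hs⟩
    obtain ⟨y, rfl, hy⟩ := exists_linkGraph_adj (hT t ht) ht (hs (by simp) : v ∈ t)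
      (hs (by simp) : x ∈ t) hx
    exact ⟨y, hy, rfl⟩

theorem inter_eq_pair {t t' : Finset V} (h3 : t.card = 3) (h3' : t'.card = 3) (hne : t ≠ t')
    {e : Finset V} (he : e.card = 2) (h : e ⊆ t) (h' : e ⊆ t') : t ∩ t' = e := by
  symm
  refine Finset.eq_of_subset_of_card_le (Finset.subset_inter h h') ?_
  rw [he]
  by_contra hc
  have h1 : t ∩ t' = t := Finset.eq_of_subset_of_card_le Finset.inter_subset_left (by omega)
  have h2 : t ∩ t' = t' := Finset.eq_of_subset_of_card_le Finset.inter_subset_right (by omega)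
  exact hne (h1.symm.trans h2)

theorem exists_eq_pair {e : Finset V} (he : e.card = 2) (hv : v ∈ e) : ∃ x, x ≠ v ∧ e = {v, x} := by
  have h1 : (e.erase v).card = 1 := by rw [Finset.card_erase_of_mem hv, he]
  obtain ⟨x, hx⟩ := Finset.card_eq_one.1 h1
  have : x ∈ e.erase v := by rw [hx]; simp
  exact ⟨x, Finset.ne_of_mem_erase this, by rw [← hx, Finset.insert_erase hv]⟩

namespace Subdivides

variable {n m : ℕ} {ends : Fin m → Fin n × Fin n} (S : Subdivides (linkGraph T v) ends)

/-- The triangle `t` at `v` corresponds to an edge of the arc `j` of the link. -/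
def InArc (j : Fin m) (t : Finset V) : Prop :=
  ∃ x y, t = {v, x, y} ∧ s(x, y) ∈ (S.arc j).edges

/-- The edge of the surface at the end `b` of the arc `j`. -/
def endEdge (j : Fin m) (b : Bool) : Finset V := {v, S.node (endNode ends j b)}

/-- The triangle at the end `b` of the arc `j`. -/
def endTri (j : Fin m) (b : Bool) : Finset V := {v, S.node (endNode ends j b), S.nbr j b}

variable {S}

theorem InArc.mem {j : Fin m} {t : Finset V} (h : S.InArc j t) : t ∈ T ∧ v ∈ t := by
  obtain ⟨x, y, rfl, h⟩ := h
  have : (linkGraph T v).Adj x y := (S.arc j).adj_of_mem_edges h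
  exact ⟨this.2.2.2, by simp⟩

theorem InArc.unique {j k : Fin m} {t : Finset V} (h : S.InArc j t) (h' : S.InArc k t) :
    j = k := by
  obtain ⟨x, y, rfl, h⟩ := h
  obtain ⟨x', y', ht, h'⟩ := h'
  have h1 : (linkGraph T v).Adj x y := (S.arc j).adj_of_mem_edges h
  have h2 : (linkGraph T v).Adj x' y' := (S.arc k).adj_of_mem_edges h'
  have h3 := eq_edge_of_triangle_eq h1 h2 ht
  exact (S.edge_mem s(x, y) h1).unique h (h3 ▸ h')

theorem exists_inArc (hT : ∀ t ∈ T, t.card = 3) {t : Finset V} (ht : t ∈ T) (hv : v ∈ t) :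
    ∃ j, S.InArc j t := by
  obtain ⟨x, y, rfl, h⟩ := exists_linkGraph_adj' (hT t ht) ht hv
  obtain ⟨j, hj, -⟩ := S.edge_mem s(x, y) h
  exact ⟨j, x, y, rfl, hj⟩

theorem inArc_endTri (hne : ∀ j, (ends j).1 ≠ (ends j).2) (j : Fin m) (b : Bool) :
    S.InArc j (S.endTri j b) :=
  ⟨_, _, rfl, S.nbr_mem_edges hne j b⟩

theorem node_ne (hne : ∀ j, (ends j).1 ≠ (ends j).2) (j : Fin m) (b : Bool) :
    S.node (endNode ends j b) ≠ v := by
  have : (linkGraph T v).Adj _ _ := (S.arc j).adj_of_mem_edges (S.nbr_mem_edges hne j b)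
  exact this.2.1

theorem card_endEdge (hne : ∀ j, (ends j).1 ≠ (ends j).2) (j : Fin m) (b : Bool) :
    (S.endEdge j b).card = 2 :=
  Finset.card_pair (node_ne hne j b).symm

theorem endEdge_subset (j : Fin m) (b : Bool) : S.endEdge j b ⊆ S.endTri j b := by
  intro z hz
  simp only [endEdge, endTri, Finset.mem_insert, Finset.mem_singleton] at hz ⊢
  tauto

theorem mem_endEdge (j : Fin m) (b : Bool) : v ∈ S.endEdge j b := by simp [endEdge]

theorem InArc.exists_adj {j : Fin m} {t : Finset V} (hT : ∀ t ∈ T, t.card = 3)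
    (h : S.InArc j t) {x : V} (hx : x ≠ v) (hxt : x ∈ t) :
    ∃ y, t = {v, x, y} ∧ s(x, y) ∈ (S.arc j).edges := by
  obtain ⟨y, rfl, hy⟩ := exists_linkGraph_adj (hT t h.mem.1) h.mem.1 h.mem.2 hxt hx
  obtain ⟨x', y', ht, h'⟩ := h
  have h2 : (linkGraph T v).Adj x' y' := (S.arc j).adj_of_mem_edges h'
  exact ⟨y, rfl, eq_edge_of_triangle_eq hy h2 ht ▸ h'⟩

theorem InArc.eq_endTri (hT : ∀ t ∈ T, t.card = 3) (hne : ∀ j, (ends j).1 ≠ (ends j).2)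
    {j : Fin m} {t : Finset V} (h : S.InArc j t) {i : Fin n} (hi : S.node i ∈ t)
    (hiv : S.node i ≠ v) : ∃ b, i = endNode ends j b ∧ t = S.endTri j b := by
  obtain ⟨y, rfl, hy⟩ := h.exists_adj hT hiv hi
  obtain ⟨b, rfl, rfl⟩ := S.eq_nbr_of_mem_edges hne hy
  exact ⟨b, rfl, rfl⟩

theorem InArc.of_mem_of_mem {j : Fin m} {t t' : Finset V} (hT : ∀ t ∈ T, t.card = 3)
    (h : S.InArc j t) {x : V} (hx : x ∉ Set.range S.node) (hxv : x ≠ v) (hxt : x ∈ t)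
    (ht' : t' ∈ T) (hv : v ∈ t') (hxt' : x ∈ t') : S.InArc j t' := by
  obtain ⟨y, rfl, hy⟩ := h.exists_adj hT hxv hxt
  obtain ⟨z, rfl, hz⟩ := exists_linkGraph_adj (hT t' ht') ht' hv hxt' hxv
  exact ⟨x, z, rfl, S.mem_edges_of_adj hx hy hz⟩

theorem ncard_of_notMem_range (hT : ∀ t ∈ T, t.card = 3) {x : V} (hx : x ∉ Set.range S.node)
    (hxv : x ≠ v) {t : Finset V} (ht : t ∈ T) (hs : {v, x} ⊆ t) :
    {t | t ∈ T ∧ {v, x} ⊆ t}.ncard = 2 := by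
  obtain ⟨j, hj⟩ := exists_inArc (S := S) hT ht (hs (by simp) : v ∈ t)
  obtain ⟨y, rfl, hy⟩ := hj.exists_adj hT hxv (hs (by simp) : x ∈ t)
  rw [ncard_triangles_eq hT hxv]
  exact S.ncard_neighborSet hx hy

theorem endTri_injective (hne : ∀ j, (ends j).1 ≠ (ends j).2)
    {i : Fin n} {j k : Fin m} {b c : Bool} (hj : endNode ends j b = i) (hk : endNode ends k c = i)
    (h : S.endTri j b = S.endTri k c) : j = k ∧ b = c := by
  obtain rfl : j = k := (inArc_endTri hne j b).unique (h ▸ inArc_endTri hne k c)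
  exact ⟨rfl, endNode_injective hne j (hj.trans hk.symm)⟩

theorem triangles_at_node (hT : ∀ t ∈ T, t.card = 3) (hne : ∀ j, (ends j).1 ≠ (ends j).2)
    (i : Fin n) (hi : ∃ j b, endNode ends j b = i) :
    {t | t ∈ T ∧ {v, S.node i} ⊆ t} =
      (fun p : Fin m × Bool => S.endTri p.1 p.2) '' {p | endNode ends p.1 p.2 = i} := by
  have hiv : S.node i ≠ v := by
    obtain ⟨j, b, rfl⟩ := hi
    exact node_ne hne j b
  ext t
  constructor
  · rintro ⟨ht, hs⟩
    obtain ⟨j, hj⟩ := exists_inArc (S := S) hT ht (hs (by simp) : v ∈ t)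
    obtain ⟨b, rfl, rfl⟩ := hj.eq_endTri hT hne (hs (by simp) : S.node i ∈ t) hiv
    exact ⟨(j, b), rfl, rfl⟩
  · rintro ⟨⟨j, b⟩, rfl, rfl⟩
    exact ⟨(inArc_endTri hne j b).mem.1, endEdge_subset j b⟩

theorem ncard_at_node (hT : ∀ t ∈ T, t.card = 3) (hne : ∀ j, (ends j).1 ≠ (ends j).2)
    (i : Fin n) (hi : ∃ j b, endNode ends j b = i) :
    {t | t ∈ T ∧ {v, S.node i} ⊆ t}.ncard = nodeDegree ends i := by
  rw [triangles_at_node hT hne i hi, Set.InjOn.ncard_image, nodeDegree, ← Set.ncard_coe_finset]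
  · congr 1
    ext
    simp
  · rintro ⟨j, b⟩ hj ⟨k, c⟩ hk h
    obtain ⟨rfl, rfl⟩ := endTri_injective hne hj hk h
    rfl

theorem InArc.rel {j : Fin m} {r : Finset V → Finset V → Prop} (hr : Equivalence r)
    (h : ∀ t t' x, S.InArc j t → S.InArc j t' → x ∉ Set.range S.node → x ≠ v → x ∈ t → x ∈ t' →
      r t t') {t t' : Finset V} (ht : S.InArc j t) (ht' : S.InArc j t') : r t t' := by
  obtain ⟨x, y, rfl, hxy⟩ := ht
  obtain ⟨x', y', rfl, hxy'⟩ := ht'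
  let φ : Sym2 V → Finset V := Sym2.lift ⟨fun x y => {v, x, y}, fun x y => by
    simp only [Finset.pair_comm x y]⟩
  refine S.rel_of_mem_edges (j := j) (r := fun e e' => r (φ e) (φ e'))
    ⟨fun _ => hr.refl _, hr.symm, hr.trans⟩ (fun x y z hx h1 h2 => ?_) hxy hxy'
  have hadj : (linkGraph T v).Adj x y := (S.arc j).adj_of_mem_edges h1
  exact h _ _ x ⟨x, y, rfl, h1⟩ ⟨x, z, rfl, h2⟩ hx hadj.2.1 (by simp [φ]) (by simp [φ])

end Subdivides

end Around

/-! ### Local regions around an edge -/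

-- The degree sum of a connected graph on `k` vertices is at least `2 (k - 1)`.
theorem sum_le_two_of_degree_add_le_two {α : Type*} [Fintype α] {Γ : SimpleGraph α}
    [DecidableRel Γ.Adj] (hΓ : Γ.Connected) {f : α → ℕ} (h : ∀ a, Γ.degree a + f a ≤ 2) :
    ∑ a, f a ≤ 2 := by
  classical
  have hedges := hΓ.card_vert_le_card_edgeSet_add_one
  rw [Nat.card_eq_fintype_card, Nat.card_eq_fintype_card, ← SimpleGraph.edgeFinset_card] at hedges
  have hdegree := Γ.sum_degrees_eq_twice_card_edges
  have hsum : ∑ a, (Γ.degree a + f a) ≤ ∑ _a : α, 2 := Finset.sum_le_sum fun a _ => h a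
  rw [Finset.sum_add_distrib, Finset.sum_const, Finset.card_univ, smul_eq_mul] at hsum
  omega

section EdgeRegions

variable {V : Type*} [DecidableEq V]

/-- The triangles of the tetrahedron `τ` at its edge `e`. -/
def trianglesBetween (e τ : Finset V) : Finset (Finset V) := (τ \ e).image fun x => insert x e

theorem mem_trianglesBetween {e f τ : Finset V} (he : e.card = 2) (heτ : e ⊆ τ) :
    f ∈ trianglesBetween e τ ↔ f.card = 3 ∧ e ⊆ f ∧ f ⊆ τ := by
  rw [trianglesBetween, Finset.mem_image]
  constructor
  · rintro ⟨x, hx, rfl⟩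
    obtain ⟨hxτ, hxe⟩ := Finset.mem_sdiff.1 hx
    exact ⟨by rw [Finset.card_insert_of_notMem hxe, he], Finset.subset_insert _ _,
      Finset.insert_subset hxτ heτ⟩
  · rintro ⟨hf, hef, hfτ⟩
    obtain ⟨x, hx⟩ : ∃ x, f \ e = {x} := Finset.card_eq_one.1 (by
      rw [Finset.card_sdiff_of_subset hef]
      omega)
    have hxf := Finset.mem_sdiff.1 (hx.symm.subset (Finset.mem_singleton_self x))
    refine ⟨x, Finset.mem_sdiff.2 ⟨hfτ hxf.1, hxf.2⟩, ?_⟩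
    rw [Finset.insert_eq, ← hx, Finset.sdiff_union_of_subset hef]

theorem card_trianglesBetween_le {e τ : Finset V} (he : e ⊆ τ) :
    (trianglesBetween e τ).card ≤ τ.card - e.card :=
  Finset.card_image_le.trans (Finset.card_sdiff_of_subset he).le

namespace ThreeManifold

variable (M : ThreeManifold V)

theorem eq_or_eq_of_subset {f a b c : Finset V} (hf : f.card = 3) (ha : a ∈ M.tets)
    (hb : b ∈ M.tets) (hc : c ∈ M.tets) (hfa : f ⊆ a) (hfb : f ⊆ b) (hfc : f ⊆ c) (hab : a ≠ b) :
    c = a ∨ c = b := by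
  have hface : f ∈ M.complex.faces :=
    (M.complex.isRelLowerSet_faces ha.1).2 hfa (Finset.card_pos.1 (by omega))
  obtain ⟨hle, hfin⟩ : {τ | τ ∈ M.complex.faces ∧ τ.card = 4 ∧ f ⊆ τ}.ncard ≤ 2 ∧
      {τ | τ ∈ M.complex.faces ∧ τ.card = 4 ∧ f ⊆ τ}.Finite := by
    rcases M.triangle_link f hface hf with h | h <;>
      exact ⟨by omega, Set.finite_of_ncard_ne_zero (by omega)⟩
  by_contra! hcon
  have hsub : (({a, b, c} : Finset (Finset V)) : Set (Finset V)) ⊆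
      {τ | τ ∈ M.complex.faces ∧ τ.card = 4 ∧ f ⊆ τ} := by
    intro x hx
    simp only [Finset.coe_insert, Finset.coe_singleton, Set.mem_insert_iff,
      Set.mem_singleton_iff] at hx
    rcases hx with rfl | rfl | rfl
    exacts [⟨ha.1, ha.2, hfa⟩, ⟨hb.1, hb.2, hfb⟩, ⟨hc.1, hc.2, hfc⟩]
  have hcard := Set.ncard_le_ncard hsub hfin
  rw [Set.ncard_coe_finset, Finset.card_eq_three.2 ⟨a, b, c, hab, hcon.1.symm, hcon.2.symm, rfl⟩]
    at hcard
  omega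

end ThreeManifold

variable {M : ThreeManifold V} {T : Set (Finset V)} {e : Finset V}

/-- The tetrahedra of the local region of `τ₀` at `e`, adjacent when they share a triangle not
in `T`. -/
def regionGraph (M : ThreeManifold V) (T : Set (Finset V)) (e τ₀ : Finset V) :
    SimpleGraph {τ // (cutAlong M T).SameCell e τ₀ τ} where
  Adj a b := a ≠ b ∧ (cutAlong M T).adj a.1 b.1
  symm := ⟨fun a b h => ⟨h.1.symm, by
    change (b.1 ∩ a.1).card = 3 ∧ b.1 ∩ a.1 ∉ T
    rw [Finset.inter_comm]
    exact h.2⟩⟩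
  loopless := ⟨fun _ h => h.1 rfl⟩

theorem regionGraph_connected (τ₀ : Finset V) : (regionGraph M T e τ₀).Connected := by
  let G := cutAlong M T
  have hreach {τ τ' : Finset V} (h : G.SameCell e τ τ') :
      ∀ (hτ : G.SameCell e τ₀ τ) (hτ' : G.SameCell e τ₀ τ'),
        (regionGraph M T e τ₀).Reachable ⟨τ, hτ⟩ ⟨τ', hτ'⟩ := by
    induction h with
    | rel a b h =>
      intro ha hb
      rcases eq_or_ne a b with rfl | hab
      · rfl
      · exact SimpleGraph.Adj.reachable ⟨fun h => hab (congrArg Subtype.val h), h.2.2.2.2⟩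
    | refl a => exact fun _ _ => .rfl
    | symm a b _ ih => exact fun hb ha => (ih ha hb).symm
    | trans a b c hab _ ih ih' => exact fun ha hc => (ih ha (ha.trans hab)).trans (ih' _ hc)
  have : Nonempty {τ // G.SameCell e τ₀ τ} := ⟨⟨τ₀, .refl _ _⟩⟩
  exact ⟨fun a b => hreach (a.2.symm.trans b.2) a.2 b.2⟩

open Classical in
theorem degree_regionGraph_add_le_two (he : e.card = 2) {τ₀ : Finset V}
    (hτ₀ : τ₀ ∈ M.tets) (heτ₀ : e ⊆ τ₀) [Fintype {τ // (cutAlong M T).SameCell e τ₀ τ}]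
    (a : {τ // (cutAlong M T).SameCell e τ₀ τ}) :
    (regionGraph M T e τ₀).degree a + {f ∈ trianglesBetween e a.1 | f ∈ T}.card ≤ 2 := by
  have hmem (b : {τ // (cutAlong M T).SameCell e τ₀ τ}) : b.1 ∈ M.tets ∧ e ⊆ b.1 :=
    ⟨b.2.mem_top_iff.1 hτ₀, b.2.subset_iff.1 heτ₀⟩
  have hdegree : (regionGraph M T e τ₀).degree a ≤ {f ∈ trianglesBetween e a.1 | f ∉ T}.card := by
    refine Finset.card_le_card_of_injOn (fun b => a.1 ∩ b.1) (fun b hb => ?_) ?_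
    · obtain ⟨-, hcard, hT⟩ := (SimpleGraph.mem_neighborFinset _ _ _).1 hb
      exact Finset.mem_coe.2 <| Finset.mem_filter.2 ⟨(mem_trianglesBetween he (hmem a).2).2
        ⟨hcard, Finset.subset_inter (hmem a).2 (hmem b).2, Finset.inter_subset_left⟩,
        hT⟩
    · intro b hb c hc (hbc : a.1 ∩ b.1 = a.1 ∩ c.1)
      obtain ⟨hne, hcard, -⟩ := (SimpleGraph.mem_neighborFinset _ _ _).1 hb
      obtain ⟨hne', -⟩ := (SimpleGraph.mem_neighborFinset _ _ _).1 hc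
      rcases M.eq_or_eq_of_subset hcard (hmem a).1 (hmem b).1 (hmem c).1 Finset.inter_subset_left
        Finset.inter_subset_right (hbc ▸ Finset.inter_subset_right)
        (fun h => hne (Subtype.ext h)) with h | h
      · exact (hne' (Subtype.ext h.symm)).elim
      · exact Subtype.ext h.symm
  have htriangles := card_trianglesBetween_le (hmem a).2
  rw [(hmem a).1.2, he, ← Finset.card_filter_add_card_filter_not (· ∈ T)] at htriangles
  omega

/-- The sides of a local region at an edge: its pairs of a triangle of `T` and a tetrahedron
at this triangle. -/
def regionSides (M : ThreeManifold V) (T : Set (Finset V)) (e τ₀ : Finset V) :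
    Set (Finset V × Finset V) :=
  {q | q.1 ∈ T ∧ q.1.card = 3 ∧ e ⊆ q.1 ∧ q.1 ⊆ q.2 ∧ (cutAlong M T).SameCell e τ₀ q.2}

theorem card_le_two_of_subset_regionSides [Finite V] (he : e.card = 2) {τ₀ : Finset V}
    (hτ₀ : τ₀ ∈ M.tets) (heτ₀ : e ⊆ τ₀) {D : Finset (Finset V × Finset V)}
    (hD : (D : Set (Finset V × Finset V)) ⊆ regionSides M T e τ₀) : D.card ≤ 2 := by
  classical
  have := Fintype.ofFinite V
  refine le_trans ?_ (sum_le_two_of_degree_add_le_two (regionGraph_connected τ₀)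
    (degree_regionGraph_add_le_two (T := T) he hτ₀ heτ₀))
  rw [← Finset.card_sigma]
  refine Finset.card_le_card_of_surjOn (fun p => (p.2, p.1.1)) fun q hq => ?_
  obtain ⟨hT, hcard, heq, hsub, hsame⟩ := hD hq
  refine ⟨⟨⟨q.2, hsame⟩, q.1⟩, Finset.mem_coe.2 (Finset.mem_sigma.2 ⟨Finset.mem_univ _,
    Finset.mem_filter.2 ⟨(mem_trianglesBetween he (heq.trans hsub)).2 ⟨hcard, heq, hsub⟩, hT⟩⟩),
    rfl⟩

end EdgeRegions

/-! ### Branch edges -/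

namespace BranchedSurface

variable {V : Type*} [DecidableEq V] {M : ThreeManifold V} {B : BranchedSurface M}

theorem card_of_mem_tri {t : Finset V} (ht : t ∈ B.tri) : t.card = 3 := (B.tri_mem t ht).2.1

namespace Coorientation

/-- The opposite coorientation. It exchanges incoming and outgoing edges of the maw dual graph, and
`R₊` and `R₋`. -/
def reverse (o : B.Coorientation) : B.Coorientation where
  back := o.front
  front := o.back
  back_mem := o.front_mem
  front_mem := o.back_mem
  back_ne_front t ht := (o.back_ne_front t ht).symm
  coherent_smooth t ht t' ht' h := (o.coherent_smooth t ht t' ht' h).symm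
  coherent_branch e he := by
    obtain ⟨u, l, h, habove, hbetween, hbelow⟩ := o.coherent_branch e he
    exact ⟨l, u, by rw [h, Set.pair_comm], hbelow.symm, hbetween.symm, habove.symm⟩

/-- At the branch edge `e`, the two sheets other than the one-sheeted side are the upper sheet `u`
and the lower sheet `l`. -/
structure UpperLower (o : B.Coorientation) (e u l : Finset V) : Prop where
  branch : IsBranchEdge B.tri e
  triangles : {t | t ∈ B.tri ∧ e ⊆ t} = {B.maw e, u, l}
  above : B.cut.SameCell e (o.front (B.maw e)) (o.front u)
  between : B.cut.SameCell e (o.back u) (o.front l)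
  below : B.cut.SameCell e (o.back l) (o.back (B.maw e))

variable {o : B.Coorientation} {e u l : Finset V}

theorem exists_upperLower (o : B.Coorientation) (he : IsBranchEdge B.tri e) :
    ∃ u l, o.UpperLower e u l := by
  obtain ⟨u, l, h, habove, hbetween, hbelow⟩ := o.coherent_branch e he
  exact ⟨u, l, he, h, habove, hbetween, hbelow⟩

namespace UpperLower

theorem reverse (h : o.UpperLower e u l) : o.reverse.UpperLower e l u :=
  ⟨h.branch, by rw [h.triangles, Set.pair_comm], h.below.symm, h.between.symm, h.above.symm⟩

theorem mem_iff (h : o.UpperLower e u l) {t : Finset V} :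
    t ∈ B.tri ∧ e ⊆ t ↔ t = B.maw e ∨ t = u ∨ t = l :=
  Set.ext_iff.1 h.triangles t

theorem upper_mem (h : o.UpperLower e u l) : u ∈ B.tri ∧ e ⊆ u :=
  h.mem_iff.2 (Or.inr (Or.inl rfl))

theorem lower_mem (h : o.UpperLower e u l) : l ∈ B.tri ∧ e ⊆ l :=
  h.mem_iff.2 (Or.inr (Or.inr rfl))

theorem distinct (h : o.UpperLower e u l) : B.maw e ≠ u ∧ B.maw e ≠ l ∧ u ≠ l := by
  have hcard := h.branch.2
  have hset : {t | t ∈ B.tri ∧ e ⊆ t} = (({B.maw e, u, l} : Finset (Finset V)) : Set _) := by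
    rw [h.triangles, Finset.coe_insert, Finset.coe_pair]
  rw [hset, Set.ncard_coe_finset] at hcard
  have not_card_pair (a b : Finset V) : ({a, b} : Finset (Finset V)).card ≠ 3 :=
    fun h' => absurd (Finset.card_le_two (a := a) (b := b)) (by omega)
  refine ⟨?_, ?_, ?_⟩ <;> intro heq
  · exact not_card_pair u l (by rwa [heq, Finset.insert_eq_of_mem (by simp)] at hcard)
  · exact not_card_pair u l (by rwa [heq, Finset.insert_eq_of_mem (by simp)] at hcard)
  · exact not_card_pair (B.maw e) l
      (by rwa [heq, Finset.insert_eq_of_mem (Finset.mem_singleton_self l)] at hcard)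

theorem eq_of_ne (h : o.UpperLower e u l) {t t' : Finset V} (ht : t ∈ B.tri) (het : e ⊆ t)
    (ht' : t' ∈ B.tri) (het' : e ⊆ t') (hmaw : B.maw e ≠ t) (hmaw' : B.maw e ≠ t')
    (hne : t ≠ t') : t = u ∧ t' = l ∨ t = l ∧ t' = u := by
  have := h.mem_iff.1 ⟨ht, het⟩
  have := h.mem_iff.1 ⟨ht', het'⟩
  grind

/-- Otherwise the region above `u` at `e` would have a third side besides the two sides of the
cusp. -/
theorem not_sameCell_back [Finite V] (h : o.UpperLower e u l) :
    ¬ B.cut.SameCell e (o.back u) (o.back l) := by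
  intro hsame
  obtain ⟨hu, heu⟩ := h.upper_mem
  obtain ⟨hl, hel⟩ := h.lower_mem
  have hle : ({(u, o.back u), (l, o.front l), (l, o.back l)} : Finset (Finset V × Finset V)).card ≤
      2 := by
    refine card_le_two_of_subset_regionSides h.branch.1 (o.back_mem u hu).1
      (heu.trans (o.back_mem u hu).2) (M := M) (T := B.tri) ?_
    intro q hq
    simp only [Finset.coe_insert, Finset.coe_singleton, Set.mem_insert_iff,
      Set.mem_singleton_iff] at hq
    rcases hq with rfl | rfl | rfl
    · exact ⟨hu, card_of_mem_tri hu, heu, (o.back_mem u hu).2, .refl _ _⟩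
    · exact ⟨hl, card_of_mem_tri hl, hel, (o.front_mem l hl).2, h.between⟩
    · exact ⟨hl, card_of_mem_tri hl, hel, (o.back_mem l hl).2, hsame⟩
  have hul := h.distinct.2.2
  have hback := o.back_ne_front l hl
  rw [Finset.card_eq_three.2 ⟨_, _, _, by simp [hul], by simp [hul], by simp [hback.symm], rfl⟩]
    at hle
  omega

end UpperLower

end Coorientation

end BranchedSurface

namespace Gluing

variable {V : Type*} [Finite V] {G : Gluing V}

open Classical in
theorem card_vertices_of_card_eq_two {z : G.Cell} (hz : z.simplex.card = 2) :
    (Finset.univ.filter fun x : G.Cell => x.simplex.card = 1 ∧ x ≤ z).card = 2 := by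
  have hsum := sum_le_eq_sum_powerset z fun σ => if σ.card = 1 then 1 else 0
  have hpow : (z.simplex.powerset.erase ∅).filter (fun σ => σ.card = 1) =
      z.simplex.powersetCard 1 := by
    ext σ
    simp only [Finset.mem_filter, Finset.mem_erase, Finset.mem_powerset, Finset.mem_powersetCard]
    exact ⟨fun h => ⟨h.1.2, h.2⟩, fun h => ⟨⟨by rintro rfl; simp at h, h.1⟩, h.2⟩⟩
  rw [Finset.sum_boole, Finset.sum_boole, hpow, Finset.card_powersetCard, hz, Finset.filter_filter]
    at hsum
  simpa only [and_comm, Nat.choose_one_right, Nat.cast_inj] using hsum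

open Classical in
/-- The handshake lemma: the endpoints of an edge share its sign equally. -/
theorem two_mul_sum_sign {I : Finset G.Cell} (hI : ∀ z ∈ I, ∀ x ≤ z, x ∈ I)
    (hcard : ∀ x ∈ I, x.simplex.card ≤ 2) :
    2 * ∑ x ∈ I, x.sign = ∑ x ∈ I with x.simplex.card = 1,
      (2 - (I.filter fun z => z.simplex.card = 2 ∧ x ≤ z).card : ℤ) := by
  have hcases (x) (hx : x ∈ I) : ¬ x.simplex.card = 1 ↔ x.simplex.card = 2 := by
    have := hcard x hx
    have := x.simplex_nonempty.card_pos
    omega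
  have hbelow (z) (hz : z ∈ I.filter fun z => z.simplex.card = 2) :
      (I.filter fun x => x.simplex.card = 1 ∧ x ≤ z).card = 2 := by
    obtain ⟨hz, hz2⟩ := Finset.mem_filter.1 hz
    rw [← card_vertices_of_card_eq_two hz2]
    congr 1
    ext x
    simp only [Finset.mem_filter, Finset.mem_univ, true_and, and_iff_right_iff_imp]
    exact fun hx => hI z hz x hx.2
  have hdouble : ∑ x ∈ I with x.simplex.card = 1,
      ((I.filter fun z => z.simplex.card = 2 ∧ x ≤ z).card : ℤ) =
      2 * (I.filter fun z => z.simplex.card = 2).card := by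
    have hcount := Finset.sum_card_bipartiteAbove_eq_sum_card_bipartiteBelow (fun x z => x ≤ z)
      (s := I.filter fun x => x.simplex.card = 1) (t := I.filter fun z => z.simplex.card = 2)
    simp only [Finset.bipartiteAbove, Finset.bipartiteBelow, Finset.filter_filter] at hcount
    rw [← Nat.cast_sum, hcount, Finset.sum_congr rfl hbelow, Finset.sum_const]
    push_cast [smul_eq_mul]
    ring
  rw [Finset.sum_sub_distrib, hdouble, Finset.sum_const,
    ← Finset.sum_filter_add_sum_filter_not I (fun x => x.simplex.card = 1),
    Finset.filter_congr hcases,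
    Finset.sum_congr (g := fun _ => (1 : ℤ)) rfl fun x hx => by
      simp [Cell.sign, (Finset.mem_filter.1 hx).2],
    Finset.sum_congr (g := fun _ => (-1 : ℤ)) (s₁ := I.filter fun x => x.simplex.card = 2) rfl
      fun x hx => by simp [Cell.sign, (Finset.mem_filter.1 hx).2]]
  simp only [Finset.sum_const, nsmul_eq_mul]
  ring

end Gluing

namespace BranchedSurface

variable {V : Type*} [DecidableEq V] {M : ThreeManifold V} {B : BranchedSurface M}
  {e σ t t' u l : Finset V}

theorem inter_eq_of_subset (he : e.card = 2) (ht : e ⊆ t) (ht' : e ⊆ t')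
    (hcard : (t ∩ t').card = 2) : t ∩ t' = e :=
  (Finset.eq_of_subset_of_card_le (Finset.subset_inter ht ht') (by rw [hcard, he])).symm

theorem sheets_sameCell_iff_of_isBranchEdge (he : IsBranchEdge B.tri e) :
    B.sheets.SameCell e t t' ↔ t = t' := by
  refine ⟨fun h => h.rel eq_equivalence fun t t' _ _ hs hs' hadj => ?_, fun h => h ▸ .refl e t⟩
  exact absurd (inter_eq_of_subset he.1 hs hs' hadj.1 ▸ he) hadj.2

namespace Coorientation

/-- The sheets of `B`, glued along an edge when they have the same local region behind them: the
disjoint union of the surfaces `R₊` of all the regions. -/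
def plusGluing (o : B.Coorientation) : Gluing V where
  top := B.tri
  adj t t' := (t ∩ t').card = 2 ∧ B.cut.SameCell (t ∩ t') (o.back t) (o.back t')

variable {o : B.Coorientation}

theorem sheets_gluesInto_plusGluing (o : B.Coorientation) : B.sheets.GluesInto o.plusGluing :=
  ⟨subset_rfl, fun t t' ht ht' h _ hσ hσ' =>
    .of_adj ht ht' hσ hσ' ⟨h.1, (o.coherent_smooth t ht t' ht' h).1⟩⟩

theorem back_sameCell (h : o.plusGluing.SameCell σ t t') :
    B.cut.SameCell σ (o.back t) (o.back t') := by
  refine h.rel (r := fun t t' => B.cut.SameCell σ (o.back t) (o.back t'))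
    ⟨fun _ => .refl _ _, .symm, .trans⟩ fun t t' _ _ hσ hσ' hadj => ?_
  exact hadj.2.mono (Finset.subset_inter hσ hσ')

theorem sheets_sameCell_of_forall_not_isBranchEdge (hσ : ∀ e, σ ⊆ e → ¬ IsBranchEdge B.tri e)
    (h : o.plusGluing.SameCell σ t t') : B.sheets.SameCell σ t t' :=
  Gluing.SameCell.rel (G := o.plusGluing) (Gluing.SameCell.equivalence B.sheets σ) (ht := h)
    fun _ _ ht ht' hs hs' hadj =>
      .of_adj ht ht' hs hs' ⟨hadj.1, hσ _ (Finset.subset_inter hs hs')⟩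

namespace UpperLower

theorem maw_mem (h : o.UpperLower e u l) : B.maw e ∈ B.tri ∧ e ⊆ B.maw e :=
  B.maw_mem e h.branch

theorem plusGluing_sameCell (h : o.UpperLower e u l) (hσ : σ ⊆ e) :
    o.plusGluing.SameCell σ (B.maw e) l := by
  have hinter := inter_eq_pair (card_of_mem_tri h.maw_mem.1) (card_of_mem_tri h.lower_mem.1)
    h.distinct.2.1 h.branch.1 h.maw_mem.2 h.lower_mem.2
  refine .of_adj h.maw_mem.1 h.lower_mem.1 (hσ.trans h.maw_mem.2) (hσ.trans h.lower_mem.2)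
    ⟨by rw [hinter, h.branch.1], ?_⟩
  rw [hinter]
  exact h.below.symm

theorem ne_upper_of_adj [Finite V] (h : o.UpperLower e u l) (ht : t ∈ B.tri) (het : e ⊆ t)
    (hadj : o.plusGluing.adj t t') (het' : e ⊆ t') (ht' : t' ∈ B.tri) : t ≠ u := by
  rintro rfl
  have hinter := inter_eq_of_subset h.branch.1 het het' hadj.1
  have hback : B.cut.SameCell e (o.back t) (o.back t') := hinter ▸ hadj.2
  rcases h.mem_iff.1 ⟨ht', het'⟩ with rfl | rfl | rfl
  · exact h.not_sameCell_back (hback.trans h.below.symm)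
  · have := hadj.1
    rw [Finset.inter_self, card_of_mem_tri ht] at this
    omega
  · exact h.not_sameCell_back hback

end UpperLower

end Coorientation

end BranchedSurface

/-! ### Corners of sectors -/

open Subdivides

theorem ThreeManifold.IsBdry.mono {V : Type*} [DecidableEq V] {M : ThreeManifold V}
    {σ τ : Finset V} (h : M.IsBdry τ) (hσ : σ ⊆ τ) : M.IsBdry σ := by
  obtain ⟨f, hf, h3, hτ, h1⟩ := h
  exact ⟨f, hf, h3, hσ.trans hτ, h1⟩

namespace BranchedSurface

variable {V : Type*} [DecidableEq V] {M : ThreeManifold V} {B : BranchedSurface M} {v : V}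
  {n m : ℕ} {ends : Fin m → Fin n × Fin n}

theorem sheets_sameCell_of_inArc {S : Subdivides (linkGraph B.tri v) ends} {j : Fin m}
    {t t' : Finset V} (h : S.InArc j t) (h' : S.InArc j t') : B.sheets.SameCell {v} t t' := by
  refine InArc.rel (Gluing.SameCell.equivalence B.sheets {v}) ?_ h h'
  intro t t' x h h' hx hxv hxt hxt'
  obtain rfl | hne := eq_or_ne t t'
  · exact .refl _ _
  have hs : {v, x} ⊆ t := Finset.insert_subset h.mem.2 (Finset.singleton_subset_iff.2 hxt)
  have hs' : {v, x} ⊆ t' := Finset.insert_subset h'.mem.2 (Finset.singleton_subset_iff.2 hxt')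
  have he : ({v, x} : Finset V).card = 2 := Finset.card_pair hxv.symm
  have hinter := inter_eq_pair (card_of_mem_tri h.mem.1) (card_of_mem_tri h'.mem.1) hne he hs hs'
  refine .of_adj h.mem.1 h'.mem.1 (Finset.singleton_subset_iff.2 h.mem.2)
    (Finset.singleton_subset_iff.2 h'.mem.2) ⟨by rw [hinter, he], ?_⟩
  rw [hinter]
  intro hb
  have := ncard_of_notMem_range (S := S) (fun _ => card_of_mem_tri) hx hxv h.mem.1 hs
  have := hb.2
  omega

theorem exists_eq_node_of_isBranchEdge (S : Subdivides (linkGraph B.tri v) ends) {e : Finset V}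
    (he : IsBranchEdge B.tri e) (hv : v ∈ e) : ∃ i, e = {v, S.node i} := by
  obtain ⟨x, hxv, rfl⟩ := exists_eq_pair he.1 hv
  obtain ⟨t, ht, hs⟩ : {t | t ∈ B.tri ∧ {v, x} ⊆ t}.Nonempty :=
    Set.nonempty_of_ncard_ne_zero (by rw [he.2]; norm_num)
  by_contra! hx
  have := ncard_of_notMem_range (S := S) (x := x) (fun _ => card_of_mem_tri)
    (by rintro ⟨i, rfl⟩; exact hx i rfl) hxv ht hs
  have := he.2
  omega

theorem nodeDegree_eq_three_of_isBranchEdge (S : Subdivides (linkGraph B.tri v) ends)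
    (hne : ∀ j, (ends j).1 ≠ (ends j).2) {i : Fin n} (hi : ∃ j b, endNode ends j b = i)
    (he : IsBranchEdge B.tri {v, S.node i}) : nodeDegree ends i = 3 := by
  rw [← he.2, Subdivides.ncard_at_node (fun _ => card_of_mem_tri) hne i hi]

/-- The arcs of the link of `v` are the corners at `v` of the sectors, that is, every node of the
link lies in the branching locus or in the boundary of `M`. -/
structure CornerModel (S : Subdivides (linkGraph B.tri v) ends) : Prop where
  ne : ∀ j, (ends j).1 ≠ (ends j).2
  degree : ∀ i, nodeDegree ends i = 1 ∨ nodeDegree ends i = 3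
  bdry : ∀ t ∈ B.tri, v ∈ t → ∀ x ∈ t, x ≠ v →
    (M.IsBdry {v, x} ↔ ∃ i, x = S.node i ∧ nodeDegree ends i = 1)

namespace CornerModel

variable {S : Subdivides (linkGraph B.tri v) ends} {j k : Fin m} {b : Bool} {e t t' : Finset V}
  {nu : M.BdryOrientation}

theorem exists_end (hS : CornerModel S) (i : Fin n) : ∃ j b, endNode ends j b = i := by
  have hpos : 0 < nodeDegree ends i := by
    have := hS.degree i
    omega
  obtain ⟨⟨j, b⟩, h⟩ := Finset.card_pos.1 hpos
  exact ⟨j, b, (Finset.mem_filter.1 h).2⟩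

theorem node_ne (hS : CornerModel S) (i : Fin n) : S.node i ≠ v := by
  obtain ⟨j, b, rfl⟩ := hS.exists_end i
  exact Subdivides.node_ne hS.ne j b

theorem ncard_at_node (hS : CornerModel S) (i : Fin n) :
    {t | t ∈ B.tri ∧ {v, S.node i} ⊆ t}.ncard = nodeDegree ends i :=
  Subdivides.ncard_at_node (fun _ => card_of_mem_tri) hS.ne i (hS.exists_end i)

theorem isBranchEdge_iff (hS : CornerModel S) (i : Fin n) :
    IsBranchEdge B.tri {v, S.node i} ↔ nodeDegree ends i = 3 := by
  rw [IsBranchEdge, Finset.card_pair (hS.node_ne i).symm, hS.ncard_at_node]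
  exact and_iff_right rfl

theorem exists_node_of_isBranchEdge (hS : CornerModel S) (he : IsBranchEdge B.tri e)
    (hv : v ∈ e) : ∃ i, e = {v, S.node i} ∧ nodeDegree ends i = 3 := by
  obtain ⟨i, rfl⟩ := exists_eq_node_of_isBranchEdge S he hv
  exact ⟨i, rfl, (hS.isBranchEdge_iff i).1 he⟩

theorem inArc_iff_of_sheets_adj (hS : CornerModel S) (ht : t ∈ B.tri) (hvt : v ∈ t)
    (ht' : t' ∈ B.tri) (hvt' : v ∈ t') (hadj : B.sheets.adj t t') :
    S.InArc j t ↔ S.InArc j t' := by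
  obtain ⟨x, hxv, he⟩ := exists_eq_pair hadj.1 (Finset.mem_inter.2 ⟨hvt, hvt'⟩)
  have hxt : x ∈ t ∩ t' := by simp [he]
  rw [Finset.mem_inter] at hxt
  by_cases hx : x ∈ Set.range S.node
  · obtain ⟨i, rfl⟩ := hx
    obtain hd | hd := hS.degree i
    · obtain ⟨a, ha⟩ := Set.ncard_eq_one.1 ((hS.ncard_at_node i).trans hd)
      have hta : t = a := Set.mem_singleton_iff.1 (ha ▸ ⟨ht, he ▸ Finset.inter_subset_left⟩)
      have hta' : t' = a := Set.mem_singleton_iff.1 (ha ▸ ⟨ht', he ▸ Finset.inter_subset_right⟩)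
      rw [hta, hta']
    · exact absurd (he ▸ (hS.isBranchEdge_iff i).2 hd) hadj.2
  · exact ⟨fun h => h.of_mem_of_mem (fun _ => card_of_mem_tri) hx hxv hxt.1 ht' hvt' hxt.2,
      fun h => h.of_mem_of_mem (fun _ => card_of_mem_tri) hx hxv hxt.2 ht hvt hxt.1⟩

theorem inArc_iff_of_sheets_sameCell (hS : CornerModel S) (h : B.sheets.SameCell {v} t t') :
    S.InArc j t ↔ S.InArc j t' :=
  h.iff fun _ _ ht ht' hvt hvt' hadj => hS.inArc_iff_of_sheets_adj ht
    (Finset.singleton_subset_iff.1 hvt) ht' (Finset.singleton_subset_iff.1 hvt') hadj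

/-- The maw vector field points into the sector at the end `b` of the arc `j`. -/
def InwardEnd (nu : M.BdryOrientation) (S : Subdivides (linkGraph B.tri v) ends) (j : Fin m)
    (b : Bool) : Prop :=
  B.MawInward nu (S.endEdge j b) (S.endTri j b)

theorem isBdry_endEdge_iff (hS : CornerModel S) (j : Fin m) (b : Bool) :
    M.IsBdry (S.endEdge j b) ↔ nodeDegree ends (endNode ends j b) = 1 := by
  have hin := inArc_endTri (S := S) hS.ne j b
  rw [endEdge, hS.bdry _ hin.mem.1 hin.mem.2 _ (by simp [endTri]) (hS.node_ne _)]
  constructor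
  · rintro ⟨i, hi, hd⟩
    rwa [S.node_injective hi]
  · exact fun h => ⟨_, rfl, h⟩

theorem isBranchEdge_endEdge_iff (hS : CornerModel S) (j : Fin m) (b : Bool) :
    IsBranchEdge B.tri (S.endEdge j b) ↔ nodeDegree ends (endNode ends j b) = 3 :=
  hS.isBranchEdge_iff _

theorem forall_mem_endEdge_outward_iff (hS : CornerModel S)
    (h : nodeDegree ends (endNode ends j b) = 1) (p : Prop → Prop) :
    (∀ x ∈ S.endEdge j b, p (nu.outward x)) ↔ p (nu.outward v) := by
  have hconst := nu.locally_constant _ _ ((hS.isBdry_endEdge_iff j b).2 h)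
  simp [endEdge, hconst]

theorem inwardEnd_iff_of_degree_three (hS : CornerModel S)
    (h : nodeDegree ends (endNode ends j b) = 3) :
    InwardEnd nu S j b ↔ B.maw (S.endEdge j b) = S.endTri j b := by
  simp [InwardEnd, MawInward, hS.isBdry_endEdge_iff, hS.isBranchEdge_endEdge_iff, h]

theorem inwardEnd_iff_of_degree_one (hS : CornerModel S)
    (h : nodeDegree ends (endNode ends j b) = 1) : InwardEnd nu S j b ↔ ¬ nu.outward v := by
  simp [InwardEnd, MawInward, hS.isBdry_endEdge_iff, hS.isBranchEdge_endEdge_iff, h,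
    hS.forall_mem_endEdge_outward_iff h Not]

theorem mawOutward_endEdge_iff (hS : CornerModel S) (j : Fin m) (b : Bool) :
    B.MawOutward nu (S.endEdge j b) (S.endTri j b) ↔ ¬ InwardEnd nu S j b := by
  obtain hd | hd := hS.degree (endNode ends j b)
  · simpa [hS.inwardEnd_iff_of_degree_one hd, MawOutward, hS.isBdry_endEdge_iff,
      hS.isBranchEdge_endEdge_iff, hd] using hS.forall_mem_endEdge_outward_iff hd id
  · simp [hS.inwardEnd_iff_of_degree_three hd, MawOutward, hS.isBdry_endEdge_iff,
      hS.isBranchEdge_endEdge_iff, hd]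

theorem exists_eq_end (hS : CornerModel S) (ht : S.InArc j t) (he : e.card = 2) (hv : v ∈ e)
    (hs : e ⊆ t) (h : IsBranchEdge B.tri e ∨ M.IsBdry e) :
    ∃ b, e = S.endEdge j b ∧ t = S.endTri j b := by
  obtain ⟨i, rfl⟩ : ∃ i, e = {v, S.node i} := by
    obtain h | h := h
    · obtain ⟨i, hi, -⟩ := hS.exists_node_of_isBranchEdge h hv
      exact ⟨i, hi⟩
    · obtain ⟨x, hxv, rfl⟩ := exists_eq_pair he hv
      obtain ⟨i, rfl, -⟩ := (hS.bdry t ht.mem.1 ht.mem.2 x (hs (by simp)) hxv).1 h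
      exact ⟨i, rfl⟩
  obtain ⟨b, rfl, rfl⟩ := ht.eq_endTri (fun _ => card_of_mem_tri) hS.ne
    (hs (by simp) : S.node i ∈ t) (hS.node_ne i)
  exact ⟨b, rfl, rfl⟩

end CornerModel

theorem not_isBranchEdge_of_nodeDegree_ne (S : Subdivides (linkGraph B.tri v) ends)
    (hne : ∀ j, (ends j).1 ≠ (ends j).2) (hends : ∀ i, ∃ j b, endNode ends j b = i)
    (hdeg : ∀ i, nodeDegree ends i ≠ 3) {e : Finset V} (hv : v ∈ e) : ¬ IsBranchEdge B.tri e := by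
  intro he
  obtain ⟨i, rfl⟩ := exists_eq_node_of_isBranchEdge S he hv
  exact hdeg i (nodeDegree_eq_three_of_isBranchEdge S hne (hends i) he)

namespace CornerModel

theorem of_not_isBdry {S : Subdivides (linkGraph B.tri v) ends}
    (hne : ∀ j, (ends j).1 ≠ (ends j).2) (hdeg : ∀ i, nodeDegree ends i = 3)
    (hv : ¬ M.IsBdry {v}) : CornerModel S where
  ne := hne
  degree i := Or.inr (hdeg i)
  bdry _ _ _ _ _ _ := iff_of_false (fun h => hv (h.mono (by simp))) (by simp [hdeg])

theorem of_isBdry_iff {S : Subdivides (linkGraph B.tri v) ends}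
    (hne : ∀ j, (ends j).1 ≠ (ends j).2)
    (hdeg : ∀ i, nodeDegree ends i = 1 ∨ nodeDegree ends i = 3)
    (h : ∀ u ∈ (linkGraph B.tri v).support,
      (M.IsBdry {v, u} ↔ ∃ i, u = S.node i ∧ nodeDegree ends i = 1)) : CornerModel S where
  ne := hne
  degree := hdeg
  bdry t ht hv x hx hxv := by
    obtain ⟨y, -, hadj⟩ := exists_linkGraph_adj (card_of_mem_tri ht) ht hv hx hxv
    exact h x ⟨y, hadj⟩

theorem of_arc {S : Subdivides (linkGraph B.tri v) arcModel}
    (h : ∀ u ∈ (linkGraph B.tri v).support, (M.IsBdry {v, u} ↔ u = S.node 0 ∨ u = S.node 1)) :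
    CornerModel S :=
  of_isBdry_iff (by decide) (by decide) fun u hu =>
    (h u hu).trans (by simp [Fin.exists_fin_two, show ∀ i, nodeDegree arcModel i = 1 by decide])

theorem of_tripod {S : Subdivides (linkGraph B.tri v) tripodModel}
    (h : ∀ u ∈ (linkGraph B.tri v).support,
      (M.IsBdry {v, u} ↔ u = S.node 1 ∨ u = S.node 2 ∨ u = S.node 3)) : CornerModel S :=
  of_isBdry_iff (by decide) (by decide) fun u hu => (h u hu).trans (by
    simp [Fin.exists_fin_succ, show nodeDegree tripodModel = ![3, 1, 1, 1] by decide])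

end CornerModel

theorem exists_cornerModel {t e : Finset V} (ht : t ∈ B.tri) (hvt : v ∈ t) (hve : v ∈ e)
    (he : IsBranchEdge B.tri e ∨ M.IsBdry e) :
    ∃ (n m : ℕ) (ends : Fin m → Fin n × Fin n) (S : Subdivides (linkGraph B.tri v) ends),
      CornerModel S := by
  by_cases hb : M.IsBdry {v}
  · obtain ⟨S, hS⟩ | ⟨S, hS⟩ := B.boundary_model t ht v hvt hb
    · exact ⟨_, _, _, S, .of_arc hS⟩
    · exact ⟨_, _, _, S, .of_tripod hS⟩
  · have he := he.resolve_right fun h => hb (h.mono (Finset.singleton_subset_iff.2 hve))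
    obtain ⟨⟨S⟩⟩ | ⟨S, -⟩ | ⟨S, -⟩ := B.interior_model t ht v hvt hb
    · exact absurd he
        (not_isBranchEdge_of_nodeDegree_ne S (by decide) (by decide) (by decide) hve)
    · exact ⟨_, _, _, S, .of_not_isBdry (by decide) (by decide) hb⟩
    · exact ⟨_, _, _, S, .of_not_isBdry (by decide) (by decide) hb⟩

/-! ### Arcs of the link of a vertex with the same region behind them -/

namespace Coorientation

variable {o : B.Coorientation} {S : Subdivides (linkGraph B.tri v) ends} {i : Fin n}
  {j k : Fin m} {e t t' u l : Finset V}

/-- The arcs `j` and `k` of the link of `v` lie in the link of the same vertex of the surfaces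
`R₊`. -/
def ArcsGlued (o : B.Coorientation) (S : Subdivides (linkGraph B.tri v) ends) (j k : Fin m) :
    Prop :=
  o.plusGluing.SameCell {v} (S.endTri j false) (S.endTri k false)

theorem arcsGlued_equivalence (o : B.Coorientation) (S : Subdivides (linkGraph B.tri v) ends) :
    Equivalence (o.ArcsGlued S) :=
  (Gluing.SameCell.equivalence o.plusGluing {v}).comap fun j => S.endTri j false

theorem plusGluing_sameCell_of_inArc (ht : S.InArc j t) (ht' : S.InArc j t') :
    o.plusGluing.SameCell {v} t t' :=
  o.sheets_gluesInto_plusGluing.sameCell (sheets_sameCell_of_inArc ht ht')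

theorem arcsGlued_iff (hS : CornerModel S) (ht : S.InArc j t) (ht' : S.InArc k t') :
    o.ArcsGlued S j k ↔ o.plusGluing.SameCell {v} t t' :=
  have h := plusGluing_sameCell_of_inArc (o := o) ht (inArc_endTri hS.ne j false)
  have h' := plusGluing_sameCell_of_inArc (o := o) ht' (inArc_endTri hS.ne k false)
  ⟨fun hjk => h.trans (hjk.trans h'.symm), fun htt' => h.symm.trans (htt'.trans h')⟩

theorem arcsGlued_of_upperLower (hS : CornerModel S)
    (h : o.UpperLower {v, S.node i} u l) (hsep : ¬ o.plusGluing.SameCell {v} u l)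
    {p q r : Fin m × Bool} (hp : endNode ends p.1 p.2 = i) (hq : endNode ends q.1 q.2 = i)
    (hr : endNode ends r.1 r.2 = i) (hpq : p ≠ q) (hpr : p ≠ r) (hqr : q ≠ r)
    (hmaw : B.maw {v, S.node i} = S.endTri p.1 p.2) :
    (o.ArcsGlued S p.1 q.1 ∨ o.ArcsGlued S p.1 r.1) ∧ ¬ o.ArcsGlued S q.1 r.1 := by
  have hin (p : Fin m × Bool) := inArc_endTri (S := S) hS.ne p.1 p.2
  have hsub (p : Fin m × Bool) (hp : endNode ends p.1 p.2 = i) :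
      {v, S.node i} ⊆ S.endTri p.1 p.2 := hp ▸ S.endEdge_subset p.1 p.2
  have hne {p q : Fin m × Bool} (hp : endNode ends p.1 p.2 = i) (hq : endNode ends q.1 q.2 = i)
      (hpq : p ≠ q) : S.endTri p.1 p.2 ≠ S.endTri q.1 q.2 := fun heq =>
    hpq (Prod.ext_iff.2 (endTri_injective hS.ne hp hq heq))
  have hglue := h.plusGluing_sameCell (σ := {v}) (by simp)
  rw [arcsGlued_iff hS (hin p) (hin q), arcsGlued_iff hS (hin p) (hin r),
    arcsGlued_iff hS (hin q) (hin r), ← hmaw]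
  obtain ⟨hu, hl⟩ | ⟨hl, hu⟩ := h.eq_of_ne (hin q).mem.1 (hsub q hq) (hin r).mem.1 (hsub r hr)
    (hmaw ▸ hne hp hq hpq) (hmaw ▸ hne hp hr hpr) (hne hq hr hqr)
  · rw [hu, hl]
    exact ⟨Or.inr hglue, hsep⟩
  · rw [hu, hl]
    exact ⟨Or.inl hglue, fun h => hsep h.symm⟩

end Coorientation
end BranchedSurface

/-! ### Half-open sectors -/

namespace BranchedSurface

variable {V : Type*} [DecidableEq V] {M : ThreeManifold V} {B : BranchedSurface M} {v : V}
  {n m : ℕ} {ends : Fin m → Fin n × Fin n} {nu : M.BdryOrientation} {σ t t' : Finset V}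

/-- `σ` lies in a part of the boundary of `M` with inward orientation. -/
def InwardBdry (nu : M.BdryOrientation) (σ : Finset V) : Prop :=
  M.IsBdry σ ∧ ∀ v ∈ σ, ¬ nu.outward v

/-- The face `σ` of the triangle `t` lies in the part of the boundary of the sector of `t` along
which the maw vector field points into the sector. The half-open sector is obtained by removing
these faces. -/
def InwardFace (B : BranchedSurface M) (nu : M.BdryOrientation) (σ t : Finset V) : Prop :=
  ∃ e t', e.card = 2 ∧ σ ⊆ e ∧ e ⊆ t' ∧ B.sheets.SameCell σ t t' ∧ B.MawInward nu e t'

theorem InwardFace.exists_isBranchEdge (h : B.InwardFace nu σ t) (hσ : ¬ InwardBdry nu σ) :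
    ∃ e, σ ⊆ e ∧ IsBranchEdge B.tri e ∧ B.sheets.SameCell σ t (B.maw e) := by
  obtain ⟨e, t', -, hσe, -, hs, ⟨he, rfl⟩ | ⟨he, hout⟩⟩ := h
  · exact ⟨e, hσe, he, hs⟩
  · exact absurd ⟨he.mono hσe, fun v hv => hout v (hσe hv)⟩ hσ

variable {S : Subdivides (linkGraph B.tri v) ends} {j : Fin m}

namespace CornerModel

theorem exists_face_iff_of_inArc (hS : CornerModel S) (ht : S.InArc j t)
    {Q : Finset V → Finset V → Prop} (hQ : ∀ e t, Q e t → IsBranchEdge B.tri e ∨ M.IsBdry e) :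
    (∃ e t', e.card = 2 ∧ {v} ⊆ e ∧ e ⊆ t' ∧ B.sheets.SameCell {v} t t' ∧ Q e t') ↔
      ∃ b, Q (S.endEdge j b) (S.endTri j b) := by
  constructor
  · rintro ⟨e, t', he, hve, het, hs, hQe⟩
    rw [hS.inArc_iff_of_sheets_sameCell hs] at ht
    obtain ⟨b, rfl, rfl⟩ :=
      hS.exists_eq_end ht he (Finset.singleton_subset_iff.1 hve) het (hQ _ _ hQe)
    exact ⟨b, hQe⟩
  · rintro ⟨b, hb⟩
    exact ⟨S.endEdge j b, S.endTri j b, card_endEdge hS.ne j b,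
      Finset.singleton_subset_iff.2 (mem_endEdge j b), endEdge_subset j b,
      sheets_sameCell_of_inArc ht (inArc_endTri hS.ne j b), hb⟩

theorem inwardFace_iff_of_inArc (hS : CornerModel S) (ht : S.InArc j t) :
    B.InwardFace nu {v} t ↔ ∃ b, InwardEnd nu S j b :=
  hS.exists_face_iff_of_inArc ht fun _ _ h => h.imp And.left And.left

end CornerModel

namespace Coorientation

variable {o : B.Coorientation} {e u l : Finset V}

/-- Every cell of `R₊` over `σ` belongs to exactly one of the half-open sectors that have its
region behind them. -/
def HasUniqueOpenFace (o : B.Coorientation) (nu : M.BdryOrientation) (σ : Finset V) : Prop :=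
  ∀ t ∈ B.tri, σ ⊆ t → ∃ t', o.plusGluing.SameCell σ t t' ∧ ¬ B.InwardFace nu σ t' ∧
    ∀ t'', o.plusGluing.SameCell σ t t'' → ¬ B.InwardFace nu σ t'' → B.sheets.SameCell σ t' t''

theorem hasUniqueOpenFace_of_forall_not_isBranchEdge
    (hbranch : ∀ e, σ ⊆ e → ¬ IsBranchEdge B.tri e) (hσ : ¬ InwardBdry nu σ) :
    o.HasUniqueOpenFace nu σ := by
  refine fun t _ _ => ⟨t, .refl _ _, fun h => ?_, fun t' h _ =>
    sheets_sameCell_of_forall_not_isBranchEdge hbranch h⟩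
  obtain ⟨e, hσe, he, -⟩ := h.exists_isBranchEdge hσ
  exact hbranch e hσe he

theorem plusGluing_adj_symm (h : o.plusGluing.adj t t') : o.plusGluing.adj t' t := by
  change (t' ∩ t).card = 2 ∧ B.cut.SameCell (t' ∩ t) _ _
  rw [Finset.inter_comm]
  exact ⟨h.1, h.2.symm⟩

theorem UpperLower.eq_upper_iff [Finite V] (h : o.UpperLower e u l)
    (hs : o.plusGluing.SameCell e t t') : t = u ↔ t' = u :=
  hs.iff fun _ _ ht ht' het het' hadj =>
    iff_of_false (h.ne_upper_of_adj ht het hadj het' ht')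
      (h.ne_upper_of_adj ht' het' (plusGluing_adj_symm hadj) het ht)

theorem inwardFace_iff_of_isBranchEdge (he : IsBranchEdge B.tri e) (hσ : ¬ InwardBdry nu e) :
    B.InwardFace nu e t ↔ B.maw e = t := by
  constructor
  · intro h
    obtain ⟨e', hee', he', hs⟩ := h.exists_isBranchEdge hσ
    obtain rfl := Finset.eq_of_subset_of_card_le hee' (by rw [he.1, he'.1])
    exact ((sheets_sameCell_iff_of_isBranchEdge he).1 hs).symm
  · rintro rfl
    exact ⟨e, _, he.1, subset_rfl, (B.maw_mem e he).2, .refl _ _, Or.inl ⟨he, rfl⟩⟩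

theorem hasUniqueOpenFace_of_isBranchEdge [Finite V] (he : IsBranchEdge B.tri e)
    (hσ : ¬ InwardBdry nu e) : o.HasUniqueOpenFace nu e := by
  intro t ht het
  obtain ⟨u, l, h⟩ := o.exists_upperLower he
  obtain ⟨hmu, hml, hul⟩ := h.distinct
  simp only [inwardFace_iff_of_isBranchEdge he hσ, sheets_sameCell_iff_of_isBranchEdge he]
  have hlower {t t'} (hs : o.plusGluing.SameCell e t t') (htu : t ≠ u) (ht : t ∈ B.tri)
      (het : e ⊆ t) (hm : B.maw e ≠ t') : l = t' := by
    obtain rfl | rfl | rfl := h.mem_iff.1 ⟨hs.mem_top_iff.1 ht, hs.subset_iff.1 het⟩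
    · exact absurd rfl hm
    · exact absurd ((h.eq_upper_iff hs).2 rfl) htu
    · rfl
  obtain rfl | rfl | rfl := h.mem_iff.1 ⟨ht, het⟩
  · exact ⟨l, h.plusGluing_sameCell subset_rfl, hml, fun t' hs => hlower hs hmu ht het⟩
  · exact ⟨t, .refl _ _, hmu, fun t' hs _ => ((h.eq_upper_iff hs).1 rfl).symm⟩
  · exact ⟨t, .refl _ _, hml, fun t' hs => hlower hs hul.symm ht het⟩

theorem hasUniqueOpenFace_of_arcs (hS : CornerModel S)
    (hex : ∀ j, ∃ k, o.ArcsGlued S j k ∧ ∀ b, ¬ CornerModel.InwardEnd nu S k b)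
    (huniq : ∀ j k, o.ArcsGlued S j k → (∀ b, ¬ CornerModel.InwardEnd nu S j b) →
      (∀ b, ¬ CornerModel.InwardEnd nu S k b) → j = k) : o.HasUniqueOpenFace nu {v} := by
  intro t ht hvt
  rw [Finset.singleton_subset_iff] at hvt
  obtain ⟨j, hj⟩ := exists_inArc (S := S) (fun _ => card_of_mem_tri) ht hvt
  obtain ⟨k, hjk, hk⟩ := hex j
  have hin := inArc_endTri (S := S) hS.ne k false
  refine ⟨_, (arcsGlued_iff hS hj hin).1 hjk, ?_, fun t' hs hopen => ?_⟩
  · rw [hS.inwardFace_iff_of_inArc hin, not_exists]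
    exact hk
  have ht' := hs.mem_top_iff.1 ht
  have hvt' := hs.subset_iff.1 (Finset.singleton_subset_iff.2 hvt)
  obtain ⟨k', hk'⟩ := exists_inArc (S := S) (fun _ => card_of_mem_tri) ht'
    (Finset.singleton_subset_iff.1 hvt')
  rw [hS.inwardFace_iff_of_inArc hk', not_exists] at hopen
  obtain rfl := huniq k k' ((arcsGlued_equivalence o S).trans
    ((arcsGlued_equivalence o S).symm hjk) ((arcsGlued_iff hS hj hk').2 hs)) hk hopen
  exact sheets_sameCell_of_inArc hin hk'

end Coorientation
end BranchedSurface

namespace BranchedSurface.Coorientation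

variable {V : Type*} [DecidableEq V] {M : ThreeManifold V} {B : BranchedSurface M} {v : V}
  {n m F : ℕ} {ends : Fin m → Fin n × Fin n} {S : Subdivides (linkGraph B.tri v) ends}
  {borders : Fin m → Fin F → Prop} {nu : M.BdryOrientation} {o : B.Coorientation}
  {i : Fin n} {j k : Fin m} {e t u l : Finset V}

theorem exists_localRegion_sides (o : B.Coorientation)
    (h : HasLocalRegions M B.tri v S F borders) :
    ∃ r : Fin F → Finset V, (∀ a b, B.cut.SameCell {v} (r a) (r b) → a = b) ∧
      ∀ k t, S.InArc k t → ∀ a b, borders k a → borders k b → a ≠ b →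
        (B.cut.SameCell {v} (o.back t) (r a) ∧ B.cut.SameCell {v} (o.front t) (r b)) ∨
        (B.cut.SameCell {v} (o.back t) (r b) ∧ B.cut.SameCell {v} (o.front t) (r a)) := by
  obtain ⟨r, -, hdisj, hside⟩ := h
  refine ⟨r, fun a b => not_imp_not.1 (hdisj a b), fun k t ht a b ha hb hab => ?_⟩
  have ht3 := ht.mem.1
  obtain ⟨x, y, rfl, hxy⟩ := ht
  obtain ⟨τ, hτ, hτs, hτr⟩ := hside k x y hxy a ha
  obtain ⟨τ', hτ', hτs', hτr'⟩ := hside k x y hxy b hb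
  have hne : τ ≠ τ' := by
    rintro rfl
    exact hdisj a b hab (hτr.symm.trans hτr')
  have hsides {c} (hc : c ∈ M.tets) (hfc : {v, x, y} ⊆ c) : c = τ ∨ c = τ' :=
    M.eq_or_eq_of_subset (card_of_mem_tri ht3) hτ hτ' hc hτs hτs' hfc hne
  have hback := hsides (o.back_mem _ ht3).1 (o.back_mem _ ht3).2
  have hfront := hsides (o.front_mem _ ht3).1 (o.front_mem _ ht3).2
  have hbf := o.back_ne_front _ ht3
  obtain hback | hback := hback <;> obtain hfront | hfront := hfront
  · exact absurd (hback.trans hfront.symm) hbf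
  · exact Or.inl ⟨hback ▸ hτr, hfront ▸ hτr'⟩
  · exact Or.inr ⟨hback ▸ hτr', hfront ▸ hτr⟩
  · exact absurd (hback.trans hfront.symm) hbf

theorem not_plusGluing_sameCell_of_hasLocalRegions
    (h : HasLocalRegions M B.tri v S F borders)
    (hborders : ∀ k, ∃ a b, a ≠ b ∧ borders k a ∧ borders k b) (hul : o.UpperLower e u l)
    (hv : v ∈ e) : ¬ o.plusGluing.SameCell {v} u l := by
  intro hs
  have hve := Finset.singleton_subset_iff.2 hv
  obtain ⟨hl, hel⟩ := hul.lower_mem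
  obtain ⟨r, hr, hside⟩ := exists_localRegion_sides o h
  obtain ⟨k, hk⟩ := exists_inArc (S := S) (fun _ => card_of_mem_tri) hl (hel hv)
  obtain ⟨a, b, hab, ha, hb⟩ := hborders k
  have hback : B.cut.SameCell {v} (o.back l) (o.front l) :=
    (back_sameCell hs).symm.trans (hul.between.mono hve)
  obtain ⟨h₁, h₂⟩ | ⟨h₁, h₂⟩ := hside k l hk a b ha hb hab
  · exact hab (hr a b (h₁.symm.trans (hback.trans h₂)))
  · exact hab (hr a b (h₂.symm.trans (hback.symm.trans h₁)))

theorem not_arcsGlued_of_hasLocalRegions (hne : ∀ j, (ends j).1 ≠ (ends j).2)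
    (h : HasLocalRegions M B.tri v S F borders) {a b c d : Fin F} (ha : borders j a)
    (hb : borders j b) (hab : a ≠ b) (hc : borders k c) (hd : borders k d) (hcd : c ≠ d)
    (hac : a ≠ c) (had : a ≠ d) (hbc : b ≠ c) (hbd : b ≠ d) : ¬ o.ArcsGlued S j k := by
  intro hjk
  obtain ⟨r, hr, hside⟩ := exists_localRegion_sides o h
  have hback := back_sameCell hjk
  obtain ⟨h₁, -⟩ | ⟨h₁, -⟩ := hside j _ (inArc_endTri hne j false) a b ha hb hab <;>
    obtain ⟨h₂, -⟩ | ⟨h₂, -⟩ := hside k _ (inArc_endTri hne k false) c d hc hd hcd <;>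
    have hreg := hr _ _ (h₁.symm.trans (hback.trans h₂))
  exacts [hac hreg, had hreg, hbc hreg, hbd hreg]

theorem inwardEnd_iff_eq (hS : CornerModel S) {p q : Fin m × Bool}
    (hd : nodeDegree ends (endNode ends q.1 q.2) = 3)
    (hp : endNode ends p.1 p.2 = endNode ends q.1 q.2)
    (hmaw : B.maw (S.endEdge q.1 q.2) = S.endTri p.1 p.2) :
    CornerModel.InwardEnd nu S q.1 q.2 ↔ q = p := by
  rw [hS.inwardEnd_iff_of_degree_three hd, hmaw]
  exact ⟨fun h => (Prod.ext_iff.2 (endTri_injective hS.ne hp rfl h)).symm, fun h => h ▸ rfl⟩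

theorem forall_not_inwardEnd_iff (hS : CornerModel S) (hd : ∀ i, nodeDegree ends i = 3)
    {mawEnd : Fin n → Fin m × Bool} (hend : ∀ i, endNode ends (mawEnd i).1 (mawEnd i).2 = i)
    (hmaw : ∀ i, B.maw {v, S.node i} = S.endTri (mawEnd i).1 (mawEnd i).2) (j : Fin m) :
    (∀ b, ¬ CornerModel.InwardEnd nu S j b) ↔ ∀ b, (j, b) ≠ mawEnd (endNode ends j b) :=
  forall_congr' fun b =>
    not_congr (inwardEnd_iff_eq (q := (j, b)) hS (hd _) (hend _) (hmaw _))

theorem hasUniqueOpenFace_of_isBranchVertex (hv : ¬ M.IsBdry {v})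
    (h : IsBranchVertex M B.tri B.maw v) : o.HasUniqueOpenFace nu {v} := by
  obtain ⟨S, hr, h0, h1⟩ := h
  have hS : CornerModel S := .of_not_isBdry (by decide) (by decide) hv
  have hopen (j) : (∀ b, ¬ CornerModel.InwardEnd nu S j b) ↔ j = 1 ∨ j = 2 :=
    (forall_not_inwardEnd_iff (mawEnd := ![(0, false), (0, true)]) hS (by decide) (by decide)
      (by rintro i; fin_cases i; exacts [h0, h1]) j).trans (by decide +revert)
  obtain ⟨u, l, hul⟩ := o.exists_upperLower ((hS.isBranchEdge_iff 0).2 (by decide))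
  have hsep := not_plusGluing_sameCell_of_hasLocalRegions hr (by decide) hul (by simp)
  obtain ⟨hglued, hfree⟩ := arcsGlued_of_upperLower (p := (0, false)) (q := (1, false))
    (r := (2, false)) hS hul hsep rfl rfl rfl (by decide) (by decide) (by decide) h0
  have heq := arcsGlued_equivalence o S
  refine hasUniqueOpenFace_of_arcs hS ?_ ?_ <;> simp only [hopen]
  · rintro j
    fin_cases j
    · exact hglued.elim (⟨1, ·, by decide⟩) (⟨2, ·, by decide⟩)
    · exact ⟨1, heq.refl _, by decide⟩
    · exact ⟨2, heq.refl _, by decide⟩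
  · rintro j k hjk (rfl | rfl) (rfl | rfl)
    exacts [rfl, absurd hjk hfree, absurd (heq.symm hjk) hfree, rfl]

/-- The end, at each node of the link of a triple point, of the arc to which the maw points. -/
def tripleMawEnd : Fin 4 → Fin 6 × Bool := ![(0, false), (2, true), (1, true), (1, false)]

theorem hasUniqueOpenFace_of_isTriplePoint (hv : ¬ M.IsBdry {v})
    (h : IsTriplePoint M B.tri B.maw v) : o.HasUniqueOpenFace nu {v} := by
  obtain ⟨S, hr, h0, h3, h2, h1⟩ := h
  have hS : CornerModel S := .of_not_isBdry (by decide) (by decide) hv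
  have hend : ∀ i, endNode tripleModel (tripleMawEnd i).1 (tripleMawEnd i).2 = i := by decide
  have hmaw (i) : B.maw {v, S.node i} = S.endTri (tripleMawEnd i).1 (tripleMawEnd i).2 := by
    fin_cases i
    exacts [h0, h1, h2, h3]
  have hopen (j) : (∀ b, ¬ CornerModel.InwardEnd nu S j b) ↔ j = 3 ∨ j = 4 ∨ j = 5 :=
    (forall_not_inwardEnd_iff hS (by decide) hend hmaw j).trans (by decide +revert)
  have hnode (i : Fin 4) (q r : Fin 6 × Bool) (hqr : endNode tripleModel q.1 q.2 = i ∧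
      endNode tripleModel r.1 r.2 = i ∧ tripleMawEnd i ≠ q ∧ tripleMawEnd i ≠ r ∧ q ≠ r) :
      (o.ArcsGlued S (tripleMawEnd i).1 q.1 ∨ o.ArcsGlued S (tripleMawEnd i).1 r.1) ∧
      ¬ o.ArcsGlued S q.1 r.1 := by
    obtain ⟨u, l, hul⟩ := o.exists_upperLower ((hS.isBranchEdge_iff i).2 (by decide +revert))
    have hsep := not_plusGluing_sameCell_of_hasLocalRegions hr (by decide) hul (by simp)
    exact arcsGlued_of_upperLower hS hul hsep (hend i) hqr.1 hqr.2.1 hqr.2.2.1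
      hqr.2.2.2.1 hqr.2.2.2.2 (hmaw i)
  obtain ⟨h0, h34⟩ := hnode 0 (3, true) (4, false) (by decide)
  obtain ⟨h2, h35⟩ := hnode 1 (3, false) (5, false) (by decide)
  obtain ⟨h1, -⟩ := hnode 3 (0, true) (5, true) (by decide)
  have h45 : ¬ o.ArcsGlued S 4 5 :=
    not_arcsGlued_of_hasLocalRegions (a := 1) (b := 3) (c := 0) (d := 2) hS.ne hr (by decide)
      (by decide) (by decide) (by decide) (by decide) (by decide) (by decide) (by decide)
      (by decide) (by decide)
  have heq := arcsGlued_equivalence o S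
  have hopen0 : ∃ k, o.ArcsGlued S 0 k ∧ (k = 3 ∨ k = 4 ∨ k = 5) :=
    h0.elim (⟨3, ·, by decide⟩) (⟨4, ·, by decide⟩)
  refine hasUniqueOpenFace_of_arcs hS ?_ ?_ <;> simp only [hopen]
  · rintro j
    fin_cases j
    · exact hopen0
    · obtain h | h := h1
      · exact hopen0.imp fun k hk => ⟨heq.trans h hk.1, hk.2⟩
      · exact ⟨5, h, by decide⟩
    · exact h2.elim (⟨3, ·, by decide⟩) (⟨5, ·, by decide⟩)
    · exact ⟨3, heq.refl _, by decide⟩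
    · exact ⟨4, heq.refl _, by decide⟩
    · exact ⟨5, heq.refl _, by decide⟩
  · rintro j k hjk (rfl | rfl | rfl) (rfl | rfl | rfl)
    exacts [rfl, absurd hjk h34, absurd hjk h35, absurd (heq.symm hjk) h34, rfl, absurd hjk h45,
      absurd (heq.symm hjk) h35, absurd (heq.symm hjk) h45, rfl]

end BranchedSurface.Coorientation

namespace BranchedSurface.Coorientation

variable {V : Type*} [DecidableEq V] {M : ThreeManifold V} {B : BranchedSurface M} {v : V}
  {n m : ℕ} {ends : Fin m → Fin n × Fin n} {S : Subdivides (linkGraph B.tri v) ends}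
  {nu : M.BdryOrientation} {o : B.Coorientation} {i : Fin n} {j k : Fin m} {b : Bool}
  {t t' u l σ : Finset V}

theorem arcsGlued_upper_iff [Finite V] (hS : CornerModel S)
    (hi : ∀ i', nodeDegree ends i' = 3 → i' = i) (hj : endNode ends j b = i)
    (h : o.UpperLower {v, S.node i} (S.endTri j b) l) : o.ArcsGlued S j k ↔ j = k := by
  refine ⟨fun hjk => ?_, fun hjk => hjk ▸ (arcsGlued_equivalence o S).refl j⟩
  have eq_upper {t} (ht : S.InArc j t) (het : {v, S.node i} ⊆ t) : t = S.endTri j b := by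
    obtain ⟨c, hc, rfl⟩ := ht.eq_endTri (fun _ => card_of_mem_tri) hS.ne
      (het (by simp) : S.node i ∈ t) (hS.node_ne i)
    rw [endNode_injective hS.ne j (hj.trans hc)]
  refine (((arcsGlued_iff hS (inArc_endTri hS.ne j b) (inArc_endTri hS.ne k b)).1 hjk).iff
    (p := S.InArc j) ?_).1 (inArc_endTri hS.ne j b) |>.unique (inArc_endTri hS.ne k b)
  intro t t' ht ht' hvt hvt' hadj
  rw [Finset.singleton_subset_iff] at hvt hvt'
  by_cases hb : IsBranchEdge B.tri (t ∩ t')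
  · obtain ⟨i', hinter, hd⟩ := hS.exists_node_of_isBranchEdge hb (Finset.mem_inter.2 ⟨hvt, hvt'⟩)
    obtain rfl := hi i' hd
    have het : {v, S.node i'} ⊆ t := hinter ▸ Finset.inter_subset_left
    have het' : {v, S.node i'} ⊆ t' := hinter ▸ Finset.inter_subset_right
    exact iff_of_false (fun h' => h.ne_upper_of_adj ht het hadj het' ht' (eq_upper h' het))
      fun h' => h.ne_upper_of_adj ht' het' (plusGluing_adj_symm hadj) het ht (eq_upper h' het')
  · exact hS.inArc_iff_of_sheets_adj ht hvt ht' hvt' ⟨hadj.1, hb⟩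

theorem endNode_tripodModel_false (j : Fin 3) : endNode tripodModel j false = 0 := by
  decide +revert

/-- The arcs `p`, `q`, `r` of a tripod in the link of `v` are the directions of the one-sheeted
side, of the upper sheet and of the lower sheet at the branching locus. -/
structure TripodArcs (o : B.Coorientation) (S : Subdivides (linkGraph B.tri v) tripodModel)
    (p q r : Fin 3) : Prop where
  maw : B.maw {v, S.node 0} = S.endTri p false
  upperLower : o.UpperLower {v, S.node 0} (S.endTri q false) (S.endTri r false)

theorem exists_tripodArcs {S : Subdivides (linkGraph B.tri v) tripodModel} (hS : CornerModel S)
    (o : B.Coorientation) : ∃ p q r, o.TripodArcs S p q r := by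
  have he : IsBranchEdge B.tri {v, S.node 0} := (hS.isBranchEdge_iff 0).2 (by decide)
  obtain ⟨u, l, h⟩ := o.exists_upperLower he
  have exists_arc {t} (ht : t ∈ B.tri ∧ {v, S.node 0} ⊆ t) : ∃ j, t = S.endTri j false := by
    obtain ⟨j, hj⟩ := exists_inArc (S := S) (fun _ => card_of_mem_tri) ht.1 (ht.2 (by simp))
    obtain ⟨b, hb, rfl⟩ := hj.eq_endTri (fun _ => card_of_mem_tri) hS.ne
      (ht.2 (by simp) : S.node 0 ∈ t) (hS.node_ne 0)
    obtain rfl : b = false :=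
      endNode_injective hS.ne j (hb.symm.trans (endNode_tripodModel_false j).symm)
    exact ⟨j, rfl⟩
  obtain ⟨p, hp⟩ := exists_arc (B.maw_mem _ he)
  obtain ⟨q, rfl⟩ := exists_arc h.upper_mem
  obtain ⟨r, rfl⟩ := exists_arc h.lower_mem
  exact ⟨p, q, r, hp, h⟩

namespace TripodArcs

variable {S : Subdivides (linkGraph B.tri v) tripodModel} {p q r : Fin 3} {j k : Fin 3}

theorem distinct (h : o.TripodArcs S p q r) : p ≠ q ∧ p ≠ r ∧ q ≠ r := by
  obtain ⟨hpq, hpr, hqr⟩ := h.maw ▸ h.upperLower.distinct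
  exact ⟨fun h => hpq (h ▸ rfl), fun h => hpr (h ▸ rfl), fun h => hqr (h ▸ rfl)⟩

theorem arcsGlued_iff [Finite V] (h : o.TripodArcs S p q r) (hS : CornerModel S) :
    o.ArcsGlued S j k ↔ (j = q ↔ k = q) := by
  have heq := arcsGlued_equivalence o S
  have hq k : o.ArcsGlued S q k ↔ q = k :=
    arcsGlued_upper_iff hS (by decide) (endNode_tripodModel_false q) h.upperLower
  have hpr : o.ArcsGlued S p r := by
    simpa [h.maw, ArcsGlued] using h.upperLower.plusGluing_sameCell (σ := {v}) (by simp)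
  obtain ⟨hpq, hpr', hqr⟩ := h.distinct
  obtain rfl | hj := eq_or_ne j q
  · simp [hq, eq_comm]
  obtain rfl | hk := eq_or_ne k q
  · exact (⟨heq.symm, heq.symm⟩ : o.ArcsGlued S j k ↔ _).trans ((hq j).trans (by simp [eq_comm]))
  have hcases {j} (hj : j ≠ q) : j = p ∨ j = r := by omega
  refine iff_of_true ?_ (iff_of_false hj hk)
  obtain rfl | rfl := hcases hj <;> obtain rfl | rfl := hcases hk
  exacts [heq.refl _, hpr, heq.symm hpr, heq.refl _]

theorem hasUniqueOpenFace [Finite V] (h : o.TripodArcs S p q r) (hS : CornerModel S)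
    (hv : nu.outward v) : o.HasUniqueOpenFace nu {v} := by
  obtain ⟨hpq, hpr, hqr⟩ := h.distinct
  have hopen (j) : (∀ b, ¬ CornerModel.InwardEnd nu S j b) ↔ j ≠ p := by
    have hd : nodeDegree tripodModel (endNode tripodModel j true) = 1 := by decide +revert
    have hj : CornerModel.InwardEnd nu S j false ↔ (j, false) = (p, false) :=
      inwardEnd_iff_eq (p := (p, false)) (q := (j, false)) hS
        (endNode_tripodModel_false j ▸ by decide) (by simp [endNode_tripodModel_false])
        ((congrArg (fun i => B.maw {v, S.node i}) (endNode_tripodModel_false j)).trans h.maw)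
    simp [Bool.forall_bool, hS.inwardEnd_iff_of_degree_one hd, hj, hv]
  refine hasUniqueOpenFace_of_arcs hS ?_ ?_ <;> simp only [hopen, h.arcsGlued_iff hS]
  · intro j
    obtain rfl | hj := eq_or_ne j p
    · exact ⟨r, iff_of_false hpq hqr.symm, hpr.symm⟩
    · exact ⟨j, Iff.rfl, hj⟩
  · intro j k hjk hj hk
    omega

end TripodArcs

theorem hasUniqueOpenFace_singleton [Finite V] (ht : t ∈ B.tri) (hvt : v ∈ t)
    (hv : ¬ InwardBdry nu {v}) : o.HasUniqueOpenFace nu {v} := by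
  have of_not_branch (h : ∀ e, v ∈ e → ¬ IsBranchEdge B.tri e) : o.HasUniqueOpenFace nu {v} :=
    hasUniqueOpenFace_of_forall_not_isBranchEdge
      (fun e he => h e (Finset.singleton_subset_iff.1 he)) hv
  by_cases hb : M.IsBdry {v}
  · obtain ⟨S, -⟩ | ⟨S, hS⟩ := B.boundary_model t ht v hvt hb
    · exact of_not_branch fun e => not_isBranchEdge_of_nodeDegree_ne S (by decide) (by decide)
        (by decide)
    · obtain ⟨p, q, r, h⟩ := exists_tripodArcs (.of_tripod hS) o
      exact h.hasUniqueOpenFace (.of_tripod hS) (by simpa [InwardBdry, hb] using hv)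
  · obtain ⟨⟨S⟩⟩ | h | h := B.interior_model t ht v hvt hb
    · exact of_not_branch fun e => not_isBranchEdge_of_nodeDegree_ne S (by decide) (by decide)
        (by decide)
    · exact hasUniqueOpenFace_of_isBranchVertex hb h
    · exact hasUniqueOpenFace_of_isTriplePoint hb h

theorem hasUniqueOpenFace [Finite V] (hne : σ.Nonempty) (hσ : ¬ InwardBdry nu σ) :
    o.HasUniqueOpenFace nu σ := by
  intro t ht hσt
  by_cases hbranch : ∃ e, σ ⊆ e ∧ IsBranchEdge B.tri e
  · obtain ⟨e, hσe, he⟩ := hbranch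
    obtain hcard | hcard : σ.card = 1 ∨ σ.card = 2 := by
      have := Finset.card_le_card hσe
      have := hne.card_pos
      have := he.1
      omega
    · obtain ⟨v, rfl⟩ := Finset.card_eq_one.1 hcard
      exact hasUniqueOpenFace_singleton ht (Finset.singleton_subset_iff.1 hσt) hσ t ht hσt
    · obtain rfl := Finset.eq_of_subset_of_card_le hσe (by rw [he.1, hcard])
      exact hasUniqueOpenFace_of_isBranchEdge he hσ t ht hσt
  · push Not at hbranch
    exact hasUniqueOpenFace_of_forall_not_isBranchEdge hbranch hσ t ht hσt

end BranchedSurface.Coorientation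

/-! ### The Euler characteristic of a half-open sector -/

namespace Gluing

variable {V : Type*} {G : Gluing V} {P : Set G.Piece}

theorem exists_flag_ge_inclusion_iff (x : (G.restrict P).Cell)
    {Q : Finset V → Finset V → Prop} :
    (∃ p : G.Flag, inclusion P x ≤ p.cell ∧ Q p.1.1 p.1.2) ↔
      ∃ p : (G.restrict P).Flag, x ≤ p.cell ∧ Q p.1.1 p.1.2 := by
  constructor
  · rintro ⟨p, hle, hQ⟩
    have hpiece : p.cell.piece ∈ P := Cell.piece_eq_of_le hle ▸ exists_inclusion_eq_iff.1 ⟨x, rfl⟩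
    exact ⟨⟨p.1, p.2.1, p.2.2.1, p.2.2.2, hpiece⟩, inclusion_le_inclusion_iff.1 hle, hQ⟩
  · rintro ⟨p, hle, hQ⟩
    exact ⟨(restrict_gluesInto G P).flag p, inclusion_le_inclusion_iff.2 hle, hQ⟩

end Gluing

namespace BranchedSurface

open Gluing

variable {V : Type*} [DecidableEq V] {M : ThreeManifold V} {B : BranchedSurface M} {v : V}
  {n m : ℕ} {ends : Fin m → Fin n × Fin n} {S : Subdivides (linkGraph B.tri v) ends} {j : Fin m}
  {nu : M.BdryOrientation} {s : B.Sector} {t : Finset V}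

namespace CornerModel

variable {G : Gluing V}

/-- The boundary edge at the end `b` of the arc `j`, in a complex glued from the triangles of
`B`. -/
def endFlag (hS : CornerModel S) (hG : B.tri ⊆ G.top) (j : Fin m) (b : Bool) : G.Flag :=
  ⟨(S.endEdge j b, S.endTri j b), ⟨v, mem_endEdge j b⟩, endEdge_subset j b,
    hG (inArc_endTri hS.ne j b).mem.1⟩

theorem card_eq_of_mem_iff_endFlag (hS : CornerModel S) (hG : B.tri ⊆ G.top) {ι : Type*}
    {A : Finset ι} {p : ι → Fin m × Bool}
    (hp : Set.InjOn (fun a => endNode ends (p a).1 (p a).2) A) {E : Finset G.Cell}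
    (hE : ∀ z, z ∈ E ↔ ∃ a ∈ A, (hS.endFlag hG (p a).1 (p a).2).cell = z) :
    E.card = A.card := by
  classical
  rw [← Finset.card_image_of_injOn (f := fun a => (hS.endFlag hG (p a).1 (p a).2).cell)]
  · congr 1
    ext z
    rw [hE, Finset.mem_image]
  · intro a ha a' ha' h
    have hedge : ({v, S.node (endNode ends (p a).1 (p a).2)} : Finset V) =
        {v, S.node (endNode ends (p a').1 (p a').2)} := congrArg Cell.simplex h
    have hmem : S.node (endNode ends (p a).1 (p a).2) ∈
        ({v, S.node (endNode ends (p a').1 (p a').2)} : Finset V) := hedge ▸ by simp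
    rw [Finset.mem_insert, Finset.mem_singleton] at hmem
    exact hp ha ha' (S.node_injective (hmem.resolve_left (hS.node_ne _)))

end CornerModel

/-- The cell `x` lies in the part of the boundary of its sector along which the maw vector field
points into the sector. -/
def IsInward (B : BranchedSurface M) (nu : M.BdryOrientation) (x : B.sheets.Cell) : Prop :=
  ∃ p : B.sheets.Flag, x ≤ p.cell ∧ p.1.1.card = 2 ∧ B.MawInward nu p.1.1 p.1.2

/-- The cell `x` lies in the part of the boundary of its sector along which the maw vector field
points out of the sector. -/
def IsOutward (B : BranchedSurface M) (nu : M.BdryOrientation) (x : B.sheets.Cell) : Prop :=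
  ∃ p : B.sheets.Flag, x ≤ p.cell ∧ p.1.1.card = 2 ∧ B.MawOutward nu p.1.1 p.1.2

theorem exists_flag_ge_cell_iff (p : B.sheets.Flag) {Q : Finset V → Finset V → Prop} :
    (∃ q : B.sheets.Flag, p.cell ≤ q.cell ∧ q.1.1.card = 2 ∧ Q q.1.1 q.1.2) ↔
      ∃ e t, e.card = 2 ∧ p.1.1 ⊆ e ∧ e ⊆ t ∧ B.sheets.SameCell p.1.1 p.1.2 t ∧ Q e t := by
  constructor
  · rintro ⟨q, hle, hcard, hQ⟩
    obtain ⟨hsub, hsame⟩ := Flag.cell_le_cell_iff.1 hle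
    exact ⟨q.1.1, q.1.2, hcard, hsub, q.2.2.1, hsame, hQ⟩
  · rintro ⟨e, t, hcard, hsub, het, hsame, hQ⟩
    exact ⟨⟨(e, t), p.2.1.mono hsub, het, hsame.mem_top_iff.1 p.2.2.2⟩,
      Flag.cell_le_cell_iff.2 ⟨hsub, hsame⟩, hcard, hQ⟩

theorem isInward_cell_iff {p : B.sheets.Flag} :
    B.IsInward nu p.cell ↔ B.InwardFace nu p.1.1 p.1.2 :=
  exists_flag_ge_cell_iff p

theorem isDoubleCorner_iff (x : (B.sheets.sub s).Cell) :
    B.IsDoubleCorner nu s x ↔ (inclusion {s} x).simplex.card = 1 ∧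
      B.IsInward nu (inclusion {s} x) ∧ B.IsOutward nu (inclusion {s} x) := by
  have hin := exists_flag_ge_inclusion_iff (G := B.sheets) (P := {s}) x
    (Q := fun e t => e.card = 2 ∧ B.MawInward nu e t)
  have hout := exists_flag_ge_inclusion_iff (G := B.sheets) (P := {s}) x
    (Q := fun e t => e.card = 2 ∧ B.MawOutward nu e t)
  have hcard : (inclusion {s} x).simplex = Cell.simplex x :=
    simplex_inclusion (G := B.sheets) (P := {s}) x
  refine and_congr (by rw [hcard]) (Iff.trans ⟨?_, ?_⟩ (and_congr hin hout).symm)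
  · rintro ⟨p, q, hp, hq, hxp, hxq, hin, hout⟩
    exact ⟨⟨p, hxp, hp, hin⟩, q, hxq, hq, hout⟩
  · rintro ⟨⟨p, hxp, hp, hin⟩, q, hxq, hq, hout⟩
    exact ⟨p, q, hp, hq, hxp, hxq, hin, hout⟩

section Finite

variable [Finite V]

open Classical in
/-- The cells of the sector `s` that are missing from the half-open sector. -/
def inwardCells (B : BranchedSurface M) (nu : M.BdryOrientation) (s : B.Sector) :
    Finset B.sheets.Cell :=
  Finset.univ.filter fun x => x.piece = s ∧ B.IsInward nu x

theorem mem_inwardCells {x : B.sheets.Cell} :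
    x ∈ B.inwardCells nu s ↔ x.piece = s ∧ B.IsInward nu x := by
  classical exact Finset.mem_filter_univ x

open Classical in
theorem CornerModel.card_inwardCells_above (hS : CornerModel S) {p : B.sheets.Flag}
    (hp : p.1.1 = {v}) (hj : S.InArc j p.1.2) (hs : p.cell.piece = s) :
    ((B.inwardCells nu s).filter fun z => z.simplex.card = 2 ∧ p.cell ≤ z).card =
      (Finset.univ.filter fun b => InwardEnd nu S j b).card := by
  have hG : B.tri ⊆ B.sheets.top := subset_rfl
  refine hS.card_eq_of_mem_iff_endFlag hG (p := fun b => (j, b))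
    (fun b _ c _ h => endNode_injective hS.ne j h) fun z => ?_
  simp only [Finset.mem_filter, mem_inwardCells, Finset.mem_univ, true_and]
  constructor
  · rintro ⟨⟨-, q, hzq, hq, hin⟩, hz, hxz⟩
    obtain rfl := Cell.eq_of_le_of_card_le hzq (by rw [hz, Flag.simplex_cell, hq])
    obtain ⟨hsub, hsame⟩ := Flag.cell_le_cell_iff.1 hxz
    rw [hp] at hsub hsame
    obtain ⟨b, he, ht⟩ := hS.exists_eq_end ((hS.inArc_iff_of_sheets_sameCell hsame).1 hj) hq
      (Finset.singleton_subset_iff.1 hsub) q.2.2.1 (hin.imp And.left And.left)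
    exact ⟨b, by rwa [he, ht] at hin, congrArg Flag.cell (Subtype.ext (Prod.ext he.symm ht.symm))⟩
  · rintro ⟨b, hb, rfl⟩
    have hle : p.cell ≤ (hS.endFlag hG j b).cell := Flag.cell_le_cell_iff.2
      ⟨hp ▸ Finset.singleton_subset_iff.2 (mem_endEdge j b),
        hp ▸ sheets_sameCell_of_inArc hj (inArc_endTri hS.ne j b)⟩
    exact ⟨⟨Cell.piece_eq_of_le hle ▸ hs, _, le_rfl, card_endEdge hS.ne j b, hb⟩,
      card_endEdge hS.ne j b, hle⟩

open Classical in
theorem two_sub_card_inwardCells_above {x : B.sheets.Cell} (hx : x ∈ B.inwardCells nu s)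
    (hcard : x.simplex.card = 1) :
    (2 - ((B.inwardCells nu s).filter fun z => z.simplex.card = 2 ∧ x ≤ z).card : ℤ) =
      if B.IsOutward nu x then 1 else 0 := by
  obtain ⟨p, rfl⟩ := x.exists_flag
  obtain ⟨hs, hin⟩ := mem_inwardCells.1 hx
  obtain ⟨v, hv⟩ := Finset.card_eq_one.1 hcard
  rw [Flag.simplex_cell] at hv
  have hvt : v ∈ p.1.2 := p.2.2.1 (hv ▸ Finset.mem_singleton_self v)
  obtain ⟨q, hpq, -, hq⟩ := id hin
  obtain ⟨n, m, ends, S, hS⟩ := exists_cornerModel p.2.2.2 hvt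
    (Cell.simplex_mono hpq (hv ▸ Finset.mem_singleton_self v : v ∈ p.1.1))
    (hq.imp And.left And.left)
  obtain ⟨j, hj⟩ := exists_inArc (S := S) (fun _ => card_of_mem_tri) p.2.2.2 hvt
  have hout : B.IsOutward nu p.cell ↔ ∃ b, ¬ CornerModel.InwardEnd nu S j b := by
    rw [IsOutward, exists_flag_ge_cell_iff, hv,
      ← exists_congr fun b => hS.mawOutward_endEdge_iff (nu := nu) j b]
    exact hS.exists_face_iff_of_inArc hj fun _ _ h => h.imp And.left And.left
  rw [isInward_cell_iff, hv, hS.inwardFace_iff_of_inArc hj, Bool.exists_bool] at hin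
  rw [hS.card_inwardCells_above hv hj hs, Finset.card_filter, Fintype.sum_bool, hout,
    Bool.exists_bool]
  by_cases hf : CornerModel.InwardEnd nu S j false <;>
    by_cases ht : CornerModel.InwardEnd nu S j true <;> simp_all

open Classical in
theorem doubleCorners_eq_sum (B : BranchedSurface M) (nu : M.BdryOrientation) (s : B.Sector) :
    (B.doubleCorners nu s : ℤ) = ∑ x ∈ B.inwardCells nu s with x.simplex.card = 1,
      if B.IsOutward nu x then 1 else 0 := by
  have himage : inclusion {s} '' {x | B.IsDoubleCorner nu s x} =
      ({x ∈ {x ∈ B.inwardCells nu s | x.simplex.card = 1} | B.IsOutward nu x} :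
        Finset B.sheets.Cell) := by
    ext y
    simp only [Set.mem_image, Set.mem_ofPred_eq, Finset.coe_filter, Finset.mem_filter,
      mem_inwardCells]
    constructor
    · rintro ⟨x, hx, rfl⟩
      obtain ⟨hcard, hin, hout⟩ := (isDoubleCorner_iff x).1 hx
      exact ⟨⟨⟨exists_inclusion_eq_iff.1 ⟨x, rfl⟩, hin⟩, hcard⟩, hout⟩
    · rintro ⟨⟨⟨hs, hin⟩, hcard⟩, hout⟩
      obtain ⟨x, rfl⟩ := exists_inclusion_eq_iff (P := {s}).2 hs
      exact ⟨x, (isDoubleCorner_iff x).2 ⟨hcard, hin, hout⟩, rfl⟩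
  rw [Finset.sum_boole, ← Set.ncard_coe_finset, ← himage,
    Set.ncard_image_of_injective _ inclusion_injective, doubleCorners]
  rfl

open Classical in
theorem mawEulerChar_eq_sum_sign (B : BranchedSurface M) (nu : M.BdryOrientation)
    (s : B.Sector) : B.mawEulerChar nu s =
      (∑ x : B.sheets.Cell with x.piece = s ∧ ¬ B.IsInward nu x, x.sign : ℤ) := by
  have hsector : (B.sheets.sub s).eulerChar = ∑ x ∈ B.inwardCells nu s, x.sign +
      ∑ x : B.sheets.Cell with x.piece = s ∧ ¬ B.IsInward nu x, x.sign := by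
    rw [sub_eq_restrict, eulerChar_restrict]
    rw [← Finset.sum_filter_add_sum_filter_not _ (B.IsInward nu), Finset.filter_filter,
      Finset.filter_filter]
    rfl
  have hinward : 2 * ∑ x ∈ B.inwardCells nu s, x.sign = B.doubleCorners nu s := by
    rw [doubleCorners_eq_sum, two_mul_sum_sign]
    · refine Finset.sum_congr rfl fun x hx => ?_
      obtain ⟨hx, hcard⟩ := Finset.mem_filter.1 hx
      exact two_sub_card_inwardCells_above hx hcard
    · intro z hz x hxz
      obtain ⟨hs, p, hzp, hp⟩ := mem_inwardCells.1 hz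
      exact mem_inwardCells.2 ⟨(Cell.piece_eq_of_le hxz).trans hs, p, hxz.trans hzp, hp⟩
    · intro x hx
      obtain ⟨-, p, hxp, hp, -⟩ := mem_inwardCells.1 hx
      exact hp ▸ Finset.card_le_card (Cell.simplex_mono hxp)
  rw [mawEulerChar, hsector, ← Int.cast_natCast (B.doubleCorners nu s), ← hinward]
  push_cast
  ring

end Finite

end BranchedSurface

/-! ### The half-open sectors behind which a region lies -/

namespace BranchedSurface

open Gluing

variable {V : Type*} [DecidableEq V] {M : ThreeManifold V} {B : BranchedSurface M}
  {nu : M.BdryOrientation} {o : B.Coorientation} {σ t : Finset V}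

theorem exists_inwardEnd {v : V} {n m : ℕ} {ends : Fin m → Fin n × Fin n}
    {S : Subdivides (linkGraph B.tri v) ends} (hS : CornerModel S) (hv : ¬ nu.outward v)
    {j : Fin m} (h : ∃ b, nodeDegree ends (endNode ends j b) = 1) :
    ∃ b, CornerModel.InwardEnd nu S j b :=
  h.imp fun _ hb => (hS.inwardEnd_iff_of_degree_one hb).2 hv

theorem inwardFace_singleton_of_inwardBdry {v : V} (ht : t ∈ B.tri) (hvt : v ∈ t)
    (hv : InwardBdry nu {v}) : B.InwardFace nu {v} t := by
  have hout : ¬ nu.outward v := hv.2 v (Finset.mem_singleton_self v)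
  obtain ⟨S, hS⟩ | ⟨S, hS⟩ := B.boundary_model t ht v hvt hv.1 <;>
    obtain ⟨j, hj⟩ := exists_inArc (S := S) (fun _ => card_of_mem_tri) ht hvt
  · rw [(CornerModel.of_arc hS).inwardFace_iff_of_inArc hj]
    exact exists_inwardEnd (.of_arc hS) hout
      ((by decide : ∀ j, ∃ b, nodeDegree arcModel (endNode arcModel j b) = 1) j)
  · rw [(CornerModel.of_tripod hS).inwardFace_iff_of_inArc hj]
    exact exists_inwardEnd (.of_tripod hS) hout
      ((by decide : ∀ j, ∃ b, nodeDegree tripodModel (endNode tripodModel j b) = 1) j)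

theorem card_le_two_of_isBdry (ht : t ∈ B.tri) (hσt : σ ⊆ t) (hσ : M.IsBdry σ) : σ.card ≤ 2 := by
  by_contra! hcard
  obtain rfl := Finset.eq_of_subset_of_card_le hσt (by rwa [card_of_mem_tri ht])
  exact (B.tri_mem _ ht).2.2 hσ

theorem inwardFace_of_inwardBdry (hne : σ.Nonempty) (ht : t ∈ B.tri) (hσt : σ ⊆ t)
    (hσ : InwardBdry nu σ) : B.InwardFace nu σ t := by
  obtain h1 | h2 : σ.card = 1 ∨ σ.card = 2 := by
    have := hne.card_pos
    have := card_le_two_of_isBdry ht hσt hσ.1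
    omega
  · obtain ⟨v, rfl⟩ := Finset.card_eq_one.1 h1
    exact inwardFace_singleton_of_inwardBdry ht (Finset.singleton_subset_iff.1 hσt) hσ
  · exact ⟨σ, t, h2, subset_rfl, hσt, .refl _ _, Or.inr hσ⟩

namespace Coorientation

/-- The region behind a component of the disjoint union of the surfaces `R₊`. -/
def plusRegion (o : B.Coorientation) : o.plusGluing.Piece → B.Region :=
  Quot.lift (fun t => B.cut.piece (o.back t.1) (o.back_mem t.1 t.2).1) fun _ _ h =>
    B.piece_eq_of_sameCell h.2 _ _

theorem plusRegion_piece_cellMap (o : B.Coorientation) (x : B.sheets.Cell) :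
    o.plusRegion (o.sheets_gluesInto_plusGluing.cellMap x).piece = o.backRegion x.piece := by
  obtain ⟨p, rfl⟩ := x.exists_flag
  rfl

theorem plusRegion_piece_cell_eq_iff {p : o.plusGluing.Flag} {C : B.Region} :
    o.plusRegion p.cell.piece = C ↔ B.cut.InPiece C (o.back p.1.2) :=
  ⟨fun h => ⟨(o.back_mem _ p.2.2.2).1, h⟩, fun ⟨_, h⟩ => h⟩

theorem plusBoundary_eq_restrict (o : B.Coorientation) (C : B.Region) :
    o.plusBoundary C = o.plusGluing.restrict {c | o.plusRegion c = C} := by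
  refine congrArg (fun T => Gluing.mk T o.plusGluing.adj) (Set.ext fun t => ?_)
  exact ⟨fun ⟨ht, _, h⟩ => ⟨ht, h⟩, fun ⟨ht, h⟩ => ⟨ht, (o.back_mem t ht).1, h⟩⟩

variable [Finite V]

theorem existsUnique_not_isInward_cellMap_eq {y : o.plusGluing.Cell}
    (hy : ¬ InwardBdry nu y.simplex) :
    ∃! x : B.sheets.Cell, ¬ B.IsInward nu x ∧ o.sheets_gluesInto_plusGluing.cellMap x = y := by
  obtain ⟨q, rfl⟩ := y.exists_flag
  obtain ⟨t, hqt, hopen, huniq⟩ := hasUniqueOpenFace q.2.1 hy q.1.2 q.2.2.2 q.2.2.1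
  refine ⟨Flag.cell ⟨(q.1.1, t), q.2.1, hqt.subset_iff.1 q.2.2.1, hqt.mem_top_iff.1 q.2.2.2⟩,
    ⟨isInward_cell_iff.not.2 hopen, Flag.cell_eq_iff.2 ⟨rfl, hqt.symm⟩⟩, ?_⟩
  rintro x ⟨hx, hxq⟩
  obtain ⟨p, rfl⟩ := x.exists_flag
  obtain ⟨hsimplex, hsame⟩ := Flag.cell_eq_iff.1 hxq
  change p.1.1 = q.1.1 at hsimplex
  change o.plusGluing.SameCell p.1.1 p.1.2 q.1.2 at hsame
  rw [isInward_cell_iff] at hx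
  rw [hsimplex] at hx hsame
  exact Flag.cell_eq_iff.2 ⟨hsimplex, by
    rw [hsimplex]
    exact (huniq p.1.2 hsame.symm hx).symm⟩

open Classical in
theorem sum_halfOpen_sign (o : B.Coorientation) (nu : M.BdryOrientation) (C : B.Region) :
    ∑ x : B.sheets.Cell with o.backRegion x.piece = C ∧ ¬ B.IsInward nu x, x.sign =
      ∑ y : o.plusGluing.Cell with o.plusRegion y.piece = C ∧ ¬ InwardBdry nu y.simplex,
        y.sign := by
  set φ := o.sheets_gluesInto_plusGluing.cellMap
  have hφ (x : B.sheets.Cell) (hx : ¬ B.IsInward nu x) : ¬ InwardBdry nu (φ x).simplex := by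
    obtain ⟨p, rfl⟩ := x.exists_flag
    exact fun h => hx (isInward_cell_iff.2 (inwardFace_of_inwardBdry p.2.1 p.2.2.2 p.2.2.1 h))
  refine Finset.sum_bij (fun x _ => φ x) (fun x hx => ?_) (fun x hx x' hx' h => ?_)
    (fun y hy => ?_) fun x _ => ?_
  · obtain ⟨hC, hopen⟩ := (Finset.mem_filter.1 hx).2
    exact Finset.mem_filter.2 ⟨Finset.mem_univ _, (plusRegion_piece_cellMap o x).trans hC,
      hφ x hopen⟩
  · exact (existsUnique_not_isInward_cellMap_eq (hφ x' (Finset.mem_filter.1 hx').2.2)).unique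
      ⟨(Finset.mem_filter.1 hx).2.2, h⟩ ⟨(Finset.mem_filter.1 hx').2.2, rfl⟩
  · obtain ⟨hC, hbdry⟩ := (Finset.mem_filter.1 hy).2
    obtain ⟨x, ⟨hopen, rfl⟩, -⟩ := existsUnique_not_isInward_cellMap_eq hbdry
    exact ⟨x, Finset.mem_filter.2 ⟨Finset.mem_univ _, (plusRegion_piece_cellMap o x).symm.trans hC,
      hopen⟩, rfl⟩
  · rw [Cell.sign, Cell.sign, GluesInto.simplex_cellMap]

open Classical in
/-- The cells of `R₊(C)` in the part of the boundary of `M` with inward orientation. -/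
def inwardBdryCells (o : B.Coorientation) (nu : M.BdryOrientation) (C : B.Region) :
    Finset o.plusGluing.Cell :=
  Finset.univ.filter fun y => o.plusRegion y.piece = C ∧ InwardBdry nu y.simplex

theorem mem_inwardBdryCells {C : B.Region} {y : o.plusGluing.Cell} :
    y ∈ o.inwardBdryCells nu C ↔ o.plusRegion y.piece = C ∧ InwardBdry nu y.simplex := by
  classical exact Finset.mem_filter_univ y

theorem outgoing_mawDualGraph (o : B.Coorientation) (nu : M.BdryOrientation) (C : B.Region) :
    (o.mawDualGraph nu).outgoing C =
      ((o.plusBoundary C).eulerChar - ∑ y ∈ o.inwardBdryCells nu C, y.sign : ℤ) := by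
  classical
  have hsectors : (o.mawDualGraph nu).outgoing C =
      (∑ x : B.sheets.Cell with o.backRegion x.piece = C ∧ ¬ B.IsInward nu x, x.sign : ℤ) := by
    simp only [WeightedGraph.outgoing, mawDualGraph, mawEulerChar_eq_sum_sign]
    rw [← Int.cast_sum, ← Finset.sum_fiberwise_of_maps_to (t := Finset.univ.filter fun s =>
      o.backRegion s = C) (g := Cell.piece)]
    · refine congrArg _ (Finset.sum_congr rfl fun s hs => Finset.sum_congr ?_ fun _ _ => rfl)
      obtain rfl := (Finset.mem_filter.1 hs).2
      ext x
      simp only [Finset.mem_filter, Finset.mem_univ, true_and]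
      constructor
      · rintro ⟨rfl, hx⟩
        exact ⟨⟨rfl, hx⟩, rfl⟩
      · rintro ⟨⟨-, hx⟩, hs⟩
        exact ⟨hs, hx⟩
    · exact fun x hx => Finset.mem_filter.2 ⟨Finset.mem_univ _, (Finset.mem_filter.1 hx).2.1⟩
  have hsplit := Finset.sum_filter_add_sum_filter_not
    (Finset.univ.filter fun y : o.plusGluing.Cell => o.plusRegion y.piece = C)
    (fun y => InwardBdry nu y.simplex) Cell.sign
  rw [Finset.filter_filter, Finset.filter_filter] at hsplit
  rw [hsectors, sum_halfOpen_sign, plusBoundary_eq_restrict, eulerChar_restrict]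
  exact congrArg _ (eq_sub_of_add_eq' hsplit)

end Coorientation

end BranchedSurface

/-! ### Cusps at the inward boundary -/

namespace BranchedSurface

open Gluing

variable {V : Type*} [DecidableEq V] {M : ThreeManifold V} {B : BranchedSurface M}
  {nu : M.BdryOrientation} {o : B.Coorientation} {e e' u u' l l' : Finset V} {v : V}

theorem eq_of_isBranchEdge_of_isBdry (hv : M.IsBdry {v}) (he : IsBranchEdge B.tri e) (hve : v ∈ e)
    (he' : IsBranchEdge B.tri e') (hve' : v ∈ e') : e = e' := by
  obtain ⟨S, -⟩ | ⟨S, hS⟩ :=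
    B.boundary_model _ (B.maw_mem e he).1 v ((B.maw_mem e he).2 hve) hv
  · exact absurd he (not_isBranchEdge_of_nodeDegree_ne S (by decide) (by decide) (by decide) hve)
  · obtain ⟨i, rfl, hi⟩ := (CornerModel.of_tripod hS).exists_node_of_isBranchEdge he hve
    obtain ⟨i', rfl, hi'⟩ := (CornerModel.of_tripod hS).exists_node_of_isBranchEdge he' hve'
    have hunique : ∀ i, nodeDegree tripodModel i = 3 → i = 0 := by decide
    rw [hunique i hi, hunique i' hi']

namespace Coorientation

/-- The vertex `y` of the surfaces `R₊` is an end of a cusp: a corner of the upper of the two sheets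
that are tangent to each other along a branch edge. -/
def IsCusp (o : B.Coorientation) (y : o.plusGluing.Cell) : Prop :=
  ∃ p : o.plusGluing.Flag, p.cell = y ∧ ∃ e l, p.1.1 ⊆ e ∧ o.UpperLower e p.1.2 l

/-- The vertices of the boundary of `M`, oriented inward, at which a cusp of the region `C` ends. -/
def inwardCusps (o : B.Coorientation) (nu : M.BdryOrientation) (C : B.Region) : Set V :=
  {v | InwardBdry nu {v} ∧
    ∃ e u l, v ∈ e ∧ o.UpperLower e u l ∧ B.cut.InPiece C (o.back u)}

theorem inwardCusps_reverse (o : B.Coorientation) (nu : M.BdryOrientation) (C : B.Region) :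
    o.reverse.inwardCusps nu C = o.inwardCusps nu C := by
  refine Set.ext fun v => and_congr_right fun _ => ⟨?_, ?_⟩
  · rintro ⟨e, u, l, hv, h, hC⟩
    have h' : o.UpperLower e l u := h.reverse
    exact ⟨e, l, u, hv, h', (h'.between.inPiece_iff C).2 hC⟩
  · rintro ⟨e, u, l, hv, h, hC⟩
    exact ⟨e, l, u, hv, h.reverse, (h.between.inPiece_iff C).1 hC⟩

theorem inwardCusps_eq_empty {C : B.Region}
    (hC : ∀ τ, B.cut.InPiece C τ → ∀ v ∈ τ, M.IsBdry {v} → nu.outward v) :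
    o.inwardCusps nu C = ∅ := by
  refine Set.eq_empty_of_forall_notMem ?_
  rintro v ⟨hv, e, u, l, hve, h, hu⟩
  obtain ⟨hmem, heu⟩ := h.upper_mem
  exact hv.2 v (Finset.mem_singleton_self v) (hC _ hu v ((o.back_mem u hmem).2 (heu hve)) hv.1)

theorem UpperLower.upper_unique [Finite V] (h : o.UpperLower e u l)
    (h' : o.UpperLower e u' l') : u = u' := by
  obtain ⟨hu, hl, hul⟩ := h'.distinct
  obtain ⟨rfl, rfl⟩ | ⟨rfl, rfl⟩ := h.eq_of_ne h'.upper_mem.1 h'.upper_mem.2 h'.lower_mem.1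
    h'.lower_mem.2 hu hl hul
  · rfl
  · exact absurd (h'.below.trans h.below.symm) h.not_sameCell_back

theorem UpperLower.upper_unique_of_isBdry [Finite V] (hv : M.IsBdry {v})
    (h : o.UpperLower e u l) (hve : v ∈ e) (h' : o.UpperLower e' u' l') (hve' : v ∈ e') :
    u = u' := by
  obtain rfl := eq_of_isBranchEdge_of_isBdry hv h.branch hve h'.branch hve'
  exact h.upper_unique h'

section Corner

variable {n m : ℕ} {ends : Fin m → Fin n × Fin n} {p : o.plusGluing.Flag}

theorem inwardBdry_edge_above_iff {S : Subdivides (linkGraph B.tri v) ends} {j : Fin m}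
    (hS : CornerModel S) (hv : ¬ nu.outward v) (hp : p.1.1 = {v}) (hj : S.InArc j p.1.2)
    {z : o.plusGluing.Cell} :
    (InwardBdry nu z.simplex ∧ z.simplex.card = 2 ∧ p.cell ≤ z) ↔
      ∃ a : Fin m × Bool, (nodeDegree ends (endNode ends a.1 a.2) = 1 ∧ o.ArcsGlued S j a.1) ∧
        (hS.endFlag (G := o.plusGluing) subset_rfl a.1 a.2).cell = z := by
  constructor
  · rintro ⟨hz, hcard, hle⟩
    obtain ⟨q, rfl⟩ := z.exists_flag
    rw [Flag.simplex_cell] at hz hcard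
    obtain ⟨hsub, hsame⟩ := Flag.cell_le_cell_iff.1 hle
    rw [hp] at hsub hsame
    have hvq := Finset.singleton_subset_iff.1 hsub
    obtain ⟨k, hk⟩ := exists_inArc (S := S) (fun _ => card_of_mem_tri) q.2.2.2 (q.2.2.1 hvq)
    obtain ⟨b, he, ht⟩ := hS.exists_eq_end hk hcard hvq q.2.2.1 (Or.inr hz.1)
    exact ⟨(k, b), ⟨(hS.isBdry_endEdge_iff k b).1 (he ▸ hz.1), (arcsGlued_iff hS hj hk).2 hsame⟩,
      congrArg Flag.cell (Subtype.ext (Prod.ext he.symm ht.symm))⟩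
  · rintro ⟨⟨k, b⟩, ⟨hdeg, hjk⟩, rfl⟩
    exact ⟨⟨(hS.isBdry_endEdge_iff k b).2 hdeg, (hS.forall_mem_endEdge_outward_iff hdeg Not).2 hv⟩,
      card_endEdge hS.ne k b, Flag.cell_le_cell_iff.2
      ⟨hp ▸ Finset.singleton_subset_iff.2 (mem_endEdge k b),
        hp ▸ (arcsGlued_iff hS hj (inArc_endTri hS.ne k b)).1 hjk⟩⟩

open Classical in
theorem card_inwardBdryCells_above [Finite V] {S : Subdivides (linkGraph B.tri v) ends}
    {j : Fin m} (hS : CornerModel S) (hp : p.1.1 = {v}) (hj : S.InArc j p.1.2) {C : B.Region}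
    (hC : p.cell ∈ o.inwardBdryCells nu C) :
    ((o.inwardBdryCells nu C).filter fun z => z.simplex.card = 2 ∧ p.cell ≤ z).card =
      (Finset.univ.filter fun a : Fin m × Bool =>
        nodeDegree ends (endNode ends a.1 a.2) = 1 ∧ o.ArcsGlued S j a.1).card := by
  obtain ⟨hpiece, hbdry⟩ := mem_inwardBdryCells.1 hC
  refine hS.card_eq_of_mem_iff_endFlag (G := o.plusGluing) subset_rfl (p := id)
    (fun a ha a' _ h => ?_) fun z => ?_
  · have hdeg := (Finset.mem_filter.1 ha).2.1
    rw [nodeDegree] at hdeg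
    exact Finset.card_le_one.1 hdeg.le a (by simp) a' (by simpa using h.symm)
  · simp only [Finset.mem_filter, Finset.mem_univ, true_and, id]
    rw [← inwardBdry_edge_above_iff hS (hbdry.2 v (by simp [hp])) hp hj, mem_inwardBdryCells]
    exact ⟨fun h => ⟨h.1.2, h.2⟩,
      fun h => ⟨⟨Cell.piece_eq_of_le h.2.2 ▸ hpiece, h.1⟩, h.2⟩⟩

theorem not_isCusp_of_arc (S : Subdivides (linkGraph B.tri v) arcModel) (hp : p.1.1 = {v}) :
    ¬ o.IsCusp p.cell := by
  rintro ⟨q, hq, e, l, hsub, h⟩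
  refine not_isBranchEdge_of_nodeDegree_ne S (by decide) (by decide) (by decide) (hsub ?_) h.branch
  rw [(Flag.cell_eq_iff.1 hq).1, hp]
  exact Finset.mem_singleton_self v

theorem TripodArcs.isCusp_iff [Finite V] {S : Subdivides (linkGraph B.tri v) tripodModel}
    {j q r s : Fin 3}
    (h : o.TripodArcs S r q s) (hS : CornerModel S) (hv : M.IsBdry {v}) (hp : p.1.1 = {v})
    (hj : S.InArc j p.1.2) : o.IsCusp p.cell ↔ j = q := by
  have hq := inArc_endTri (S := S) hS.ne q false
  have hsame : o.plusGluing.SameCell {v} p.1.2 (S.endTri q false) ↔ j = q := by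
    rw [← o.arcsGlued_iff hS hj hq, h.arcsGlued_iff hS, iff_true_right rfl]
  rw [← hsame]
  constructor
  · rintro ⟨p', hp', e, l, hsub, h'⟩
    obtain ⟨hσ, hcell⟩ := Flag.cell_eq_iff.1 hp'
    rw [hσ, hp] at hsub hcell
    rw [h.upperLower.upper_unique_of_isBdry hv (by simp) h' (Finset.singleton_subset_iff.1 hsub)]
    exact hcell.symm
  · intro hcell
    exact ⟨⟨({v}, S.endTri q false), by simp, Finset.singleton_subset_iff.2 hq.mem.2, hq.mem.1⟩,
      Flag.cell_eq_iff.2 ⟨hp.symm, hcell.symm⟩, _, _, by simp, h.upperLower⟩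

end Corner

variable [Finite V]

open Classical in
theorem two_sub_card_inwardBdryCells_above {C : B.Region} {y : o.plusGluing.Cell}
    (hy : y ∈ o.inwardBdryCells nu C) (hcard : y.simplex.card = 1) :
    (2 - ((o.inwardBdryCells nu C).filter fun z => z.simplex.card = 2 ∧ y ≤ z).card : ℤ) =
      if o.IsCusp y then 1 else 0 := by
  obtain ⟨p, rfl⟩ := y.exists_flag
  obtain ⟨v, hv⟩ := Finset.card_eq_one.1 hcard
  rw [Flag.simplex_cell] at hv
  have hvt : v ∈ p.1.2 := p.2.2.1 (hv ▸ Finset.mem_singleton_self v)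
  have hbdry : M.IsBdry {v} := hv ▸ (mem_inwardBdryCells.1 hy).2.1
  obtain ⟨S, hS⟩ | ⟨S, hS⟩ := B.boundary_model _ p.2.2.2 v hvt hbdry <;>
    obtain ⟨j, hj⟩ := exists_inArc (S := S) (fun _ => card_of_mem_tri) p.2.2.2 hvt
  · have hglued (k) : o.ArcsGlued S j k :=
      Subsingleton.elim j k ▸ (arcsGlued_equivalence o S).refl j
    rw [card_inwardBdryCells_above (.of_arc hS) hv hj hy, if_neg (not_isCusp_of_arc S hv)]
    simp only [hglued, and_true]
    decide
  · obtain ⟨r, q, s, h⟩ := exists_tripodArcs (.of_tripod hS) o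
    rw [card_inwardBdryCells_above (.of_tripod hS) hv hj hy]
    simp only [h.isCusp_iff (.of_tripod hS) hbdry hv hj, h.arcsGlued_iff (.of_tripod hS)]
    have hcount : ∀ j q : Fin 3, (2 - (Finset.univ.filter fun a : Fin 3 × Bool =>
        nodeDegree tripodModel (endNode tripodModel a.1 a.2) = 1 ∧
          (j = q ↔ a.1 = q)).card : ℤ) = if j = q then 1 else 0 := by
      decide
    convert hcount j q

theorem injOn_simplex_isCusp :
    Set.InjOn (Cell.simplex (G := o.plusGluing))
      {y | y.simplex.card = 1 ∧ M.IsBdry y.simplex ∧ o.IsCusp y} := by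
  rintro _ ⟨hcard, hbdry, p, rfl, e, l, hpe, h⟩ _ ⟨-, -, p', rfl, e', l', hpe', h'⟩ hsimplex
  obtain ⟨v, hv⟩ := Finset.card_eq_one.1 hcard
  change p.1.1 = p'.1.1 at hsimplex
  rw [Flag.simplex_cell] at hv
  have hve : v ∈ e := hpe (hv ▸ Finset.mem_singleton_self v)
  have hve' : v ∈ e' := hpe' ((hsimplex.symm.trans hv).symm ▸ Finset.mem_singleton_self v)
  have htri := h.upper_unique_of_isBdry (hv ▸ hbdry) hve h' hve'
  exact congrArg Flag.cell (Subtype.ext (Prod.ext hsimplex htri))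

open Classical in
theorem image_simplex_isCusp (o : B.Coorientation) (nu : M.BdryOrientation) (C : B.Region) :
    Cell.simplex '' {y | y ∈ o.inwardBdryCells nu C ∧ y.simplex.card = 1 ∧ o.IsCusp y} =
      singleton '' o.inwardCusps nu C := by
  ext σ
  constructor
  · rintro ⟨_, ⟨hI, hcard, p, rfl, e, l, hpe, h⟩, rfl⟩
    obtain ⟨hpiece, hbdry⟩ := mem_inwardBdryCells.1 hI
    obtain ⟨v, hv⟩ := Finset.card_eq_one.1 hcard
    rw [Flag.simplex_cell] at hv hbdry
    rw [hv] at hbdry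
    exact ⟨v, ⟨hbdry, e, _, l, hpe (hv ▸ Finset.mem_singleton_self v), h,
      plusRegion_piece_cell_eq_iff.1 hpiece⟩, hv.symm⟩
  · rintro ⟨v, ⟨hbdry, e, u, l, hv, h, hC⟩, rfl⟩
    have hve := Finset.singleton_subset_iff.2 hv
    let p : o.plusGluing.Flag := ⟨({v}, u), by simp, hve.trans h.upper_mem.2, h.upper_mem.1⟩
    exact ⟨p.cell, ⟨mem_inwardBdryCells.2 ⟨plusRegion_piece_cell_eq_iff.2 hC, hbdry⟩,
      Finset.card_singleton v, p, rfl, e, l, hve, h⟩, rfl⟩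

theorem two_mul_sum_sign_inwardBdryCells (o : B.Coorientation) (nu : M.BdryOrientation)
    (C : B.Region) :
    2 * ∑ y ∈ o.inwardBdryCells nu C, y.sign = (o.inwardCusps nu C).ncard := by
  classical
  have hI : ∀ z ∈ o.inwardBdryCells nu C, ∀ y ≤ z, y ∈ o.inwardBdryCells nu C := by
    intro z hz y hyz
    obtain ⟨hpiece, hbdry, hinward⟩ := mem_inwardBdryCells.1 hz
    have hsub := Cell.simplex_mono hyz
    exact mem_inwardBdryCells.2 ⟨Cell.piece_eq_of_le hyz ▸ hpiece,
      hbdry.mono hsub, fun v hv => hinward v (hsub hv)⟩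
  have hcard : ∀ y ∈ o.inwardBdryCells nu C, y.simplex.card ≤ 2 := by
    intro y hy
    obtain ⟨p, rfl⟩ := y.exists_flag
    exact card_le_two_of_isBdry p.2.2.2 p.2.2.1 (mem_inwardBdryCells.1 hy).2.1
  rw [two_mul_sum_sign hI hcard, Finset.sum_congr rfl fun y hy =>
    two_sub_card_inwardBdryCells_above (Finset.mem_filter.1 hy).1 (Finset.mem_filter.1 hy).2,
    Finset.sum_boole, ← Set.ncard_image_of_injective _ Finset.singleton_injective,
    ← image_simplex_isCusp, Set.InjOn.ncard_image, ← Set.ncard_coe_finset]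
  · simp [and_assoc]
  · refine injOn_simplex_isCusp.mono ?_
    rintro y ⟨hy, hcard, hcusp⟩
    exact ⟨hcard, (mem_inwardBdryCells.1 hy).2.1, hcusp⟩

theorem outgoing_mawDualGraph_eq_eulerChar_sub (o : B.Coorientation) (nu : M.BdryOrientation)
    (C : B.Region) : (o.mawDualGraph nu).outgoing C =
      (o.plusBoundary C).eulerChar - (o.inwardCusps nu C).ncard / 2 := by
  have hcusps : (2 * ∑ y ∈ o.inwardBdryCells nu C, y.sign : ℚ) = (o.inwardCusps nu C).ncard :=
    mod_cast o.two_mul_sum_sign_inwardBdryCells nu C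
  rw [outgoing_mawDualGraph, ← hcusps]
  push_cast
  ring

theorem incoming_mawDualGraph_eq_eulerChar_sub (o : B.Coorientation) (nu : M.BdryOrientation)
    (C : B.Region) : (o.mawDualGraph nu).incoming C =
      (o.minusBoundary C).eulerChar - (o.inwardCusps nu C).ncard / 2 := by
  rw [← inwardCusps_reverse]
  exact o.reverse.outgoing_mawDualGraph_eq_eulerChar_sub nu C

end Coorientation

end BranchedSurface

theorem WeightedGraph.boundary_apply {Vertex Edge : Type*} [Fintype Edge]
    (Γ : WeightedGraph Vertex Edge) (v : Vertex) :
    Γ.boundary v = Γ.incoming v - Γ.outgoing v := by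
  classical
  rw [boundary, incoming, outgoing, Finset.sum_filter, Finset.sum_filter,
    ← Finset.sum_sub_distrib, Finsupp.finsetSum_apply]
  refine Finset.sum_congr rfl fun e _ => ?_
  simp only [Finsupp.smul_apply, Finsupp.sub_apply, Finsupp.single_apply, smul_eq_mul, mul_sub,
    mul_ite, mul_one, mul_zero]

end MawGraph

end

theorem mainTheorem7_general {V : Type*} [Finite V] [DecidableEq V] {M : MawGraph.ThreeManifold V}
    (n : M.BdryOrientation) {B : MawGraph.BranchedSurface M} (o : B.Coorientation)
    (hχ : ∀ C : B.Region, (o.plusBoundary C).eulerChar = (o.minusBoundary C).eulerChar) :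
    (o.mawDualGraph n).IsCycle ∧
    (∀ C : B.Region, (o.mawDualGraph n).incoming C = (o.mawDualGraph n).outgoing C) ∧
    (∀ C : B.Region,
      (∀ τ : Finset V, B.cut.InPiece C τ → ∀ v ∈ τ, M.IsBdry {v} → n.outward v) →
      (o.mawDualGraph n).incoming C = (o.plusBoundary C).eulerChar ∧
      (o.mawDualGraph n).outgoing C = (o.plusBoundary C).eulerChar) := by
  have hout := o.outgoing_mawDualGraph_eq_eulerChar_sub n
  have hbalance (C : B.Region) : (o.mawDualGraph n).incoming C = (o.mawDualGraph n).outgoing C := by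
    rw [hout, o.incoming_mawDualGraph_eq_eulerChar_sub, hχ]
  refine ⟨⟨fun s => ⟨_, B.mawEulerChar_eq_sum_sign n s⟩, ?_⟩, hbalance, fun C hC => ?_⟩
  · ext C
    rw [MawGraph.WeightedGraph.boundary_apply, hbalance, sub_self, Finsupp.zero_apply]
  · rw [hbalance, and_self, hout, o.inwardCusps_eq_empty hC, Set.ncard_empty, Nat.cast_zero,
      zero_div, sub_zero]

theorem mainTheorem7 {V : Type*} [Finite V] [DecidableEq V] (M : MawGraph.ThreeManifold V)
    (n : M.BdryOrientation) (B : MawGraph.BranchedSurface M) (o : B.Coorientation)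
    (hB : ∀ C : B.Region, o.IsProductBall C) :
    (o.mawDualGraph n).IsCycle ∧
    (∀ C : B.Region, (o.mawDualGraph n).incoming C = (o.mawDualGraph n).outgoing C) ∧
    (∀ C : B.Region,
      (∀ τ : Finset V, B.cut.InPiece C τ → ∀ v ∈ τ, M.IsBdry {v} → n.outward v) →
      (o.mawDualGraph n).incoming C = 1 ∧ (o.mawDualGraph n).outgoing C = 1) := by
  have hplus C := MawGraph.Gluing.eulerChar_eq_one_of_isPLBall (hB C).2.1
  have hminus C := MawGraph.Gluing.eulerChar_eq_one_of_isPLBall (hB C).2.2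
  simpa [hplus] using mainTheorem7_general n o fun C => (hplus C).trans (hminus C).symm
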